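/- **Setting.** Let $G$ be a finite factor graph with variable nodes $i\in\{1,\dots,N\}$, $N\ge 1$, and check nodes $\alpha$; $N(v)$ denotes the set of neighbours of a node $v$. Let $C\subseteq\{0,1\}^N$ be its code, i.e. the set of all words $x$ with $\bigoplus_{i\in N(\alpha)}x_i=0$ for every $\alpha$. Let $X$ be uniformly distributed on $C$, and let $Y=(y_1,\dots,y_N)$ be the output when $x_1,\dots,x_N$ are sent independently through binary memoryless symmetric channels $W_1,\dots,W_N$. Let $c_i$ be the $L$-density of $W_i$: the law on $\overline{\mathbb R}$ of the log-likelihood ratio $\ln\frac{p(x_i=0\mid y_i)}{p(x_i=1\mid y_i)}$ (for a uniform prior on $x_i$) given that $0$ is sent. For laws $a,b$ on $\overline{\mathbb R}$ let $a\circledast b$ and $a\boxast b$ be the laws of $A+B$ and of $2\tanh^{-1}\!\big(\tanh\frac A2\tanh\frac B2\big)$, for independent $A\sim a$, $B\sim b$; the empty $\circledast$ is $\Delta_0$ and the empty $\boxast$ is $\Delta_\infty$, where $\Delta_s$ is the point mass at $s$. The entropy is $H(c)=\int\log_2(1+e^{-s})\,c(ds)$. A scheduling policy is a finite sequence $S=(s_1,\dots,s_p)$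 of directed edges of $G$. Start with $c^{(0)}_{(i,\alpha)}=c^{(0)}_{(\alpha,i)}=\Delta_0$ on all edges. At step $t$ only the message on the directed edge $s_t$ changes: if $s_t=(i\to\alpha)$, then $$c^{(t)}_{(i,\alpha)}=c_i\circledast\Big(\circledast_{h\in N(i)\setminus\alpha}\,c^{(t-1)}_{(h,i)}\Big),$$ and if $s_t=(\alpha\to i)$, then $$c^{(t)}_{(\alpha,i)}=\boxast_{j\in N(\alpha)\setminus i}\,c^{(t-1)}_{(j,\alpha)}.$$ Put $$U(\mathbf c,t)=-\frac1N\Big\{\sum_i H\Big(c_i\circledast\big(\circledast_{\alpha\in N(i)}c^{(t)}_{(\alpha,i)}\big)\Big)+\sum_\alpha\sum_{i\in N(\alpha)}H\big(c^{(t)}_{(i,\alpha)}\big)-\sum_\alpha H\big(\boxast_{i\in N(\alpha)}c^{(t)}_{(i,\alpha)}\big)-\sum_{(i,\alpha)}H\big(c^{(t)}_{(i,\alpha)}\circledast c^{(t)}_{(\alpha,i)}\big)\Big\}.$$ **Proposition (Lower limit).** If $G$ is cycle-free, then for every scheduling policy $S=(s_1,\dots,s_p)$, every $0\le t\le p$,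 and every decoder (a measurable map $Y\mapsto\hat X(Y)\in\{0,1\}^N$), $$U(\mathbf c,t)\;\ge\;-\frac1N H(X\mid Y)\;\ge\;-P_e-\frac{H_b(P_e)}{N},$$ where $H(X\mid Y)$ is the conditional entropy in bits, $P_e=\Pr(\hat X(Y)\ne X)$ is the block error rate, and $H_b(p)=-p\log_2p-(1-p)\log_2(1-p)$ is the binary entropy function. -/

import Mathlib

open MeasureTheory
open scoped ENNReal

noncomputable section

namespace GapLowerLimit

/-! ### L-densities and their convolutions -/

/-- `tanh (x / 2)` on the extended reals, with values `-1` and `1` at the two infinities. -/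
def tanhHalf (x : EReal) : ℝ :=
  if x = ⊥ then -1 else if x = ⊤ then 1 else Real.tanh (x.toReal / 2)

/-- `2 artanh d` for `d ∈ [-1, 1]`, with values `-∞` and `+∞` at `-1` and `1`. -/
def twoArtanh (d : ℝ) : EReal :=
  if d ≤ -1 then ⊥ else if 1 ≤ d then ⊤ else ((2 * Real.artanh d : ℝ) : EReal)

/-- The check-node rule for two log-likelihood ratios:
`2 artanh (tanh (a / 2) * tanh (b / 2))`. -/
def boxPlus (a b : EReal) : EReal := twoArtanh (tanhHalf a * tanhHalf b)

theorem measurable_tanhHalf : Measurable tanhHalf := by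
  apply EReal.measurable_of_measurable_real
  have h : (fun p : ℝ => tanhHalf (p : EReal)) = fun p => Real.tanh (p / 2) := by
    funext p
    simp [tanhHalf]
  rw [h]
  simp only [Real.tanh_eq_sinh_div_cosh]
  fun_prop

theorem measurable_twoArtanh : Measurable twoArtanh := by
  unfold twoArtanh
  refine Measurable.ite measurableSet_Iic measurable_const
    (Measurable.ite measurableSet_Ici measurable_const ?_)
  refine measurable_coe_real_ereal.comp (measurable_const.mul ?_)
  unfold Real.artanh
  fun_prop

theorem measurable_boxPlus : Measurable fun p : EReal × EReal => boxPlus p.1 p.2 :=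
  measurable_twoArtanh.comp
    ((measurable_tanhHalf.comp measurable_fst).mul (measurable_tanhHalf.comp measurable_snd))

theorem abs_tanhHalf_le (x : EReal) : |tanhHalf x| ≤ 1 := by
  unfold tanhHalf
  split_ifs
  · simp
  · simp
  · exact (Real.abs_tanh_lt_one _).le

theorem tanhHalf_twoArtanh {d : ℝ} (h : |d| ≤ 1) : tanhHalf (twoArtanh d) = d := by
  obtain ⟨h1, h2⟩ := abs_le.1 h
  unfold twoArtanh
  split_ifs with h3 h4
  · simp [tanhHalf, le_antisymm h3 h1]
  · simp [tanhHalf, le_antisymm h2 h4]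
  · simp only [tanhHalf, EReal.coe_ne_bot, EReal.coe_ne_top, if_false, EReal.toReal_coe]
    rw [mul_div_cancel_left₀ _ (two_ne_zero), Real.tanh_artanh ⟨not_le.1 h3, not_le.1 h4⟩]

theorem tanhHalf_boxPlus (a b : EReal) :
    tanhHalf (boxPlus a b) = tanhHalf a * tanhHalf b := by
  refine tanhHalf_twoArtanh ?_
  rw [abs_mul]
  exact mul_le_one₀ (abs_tanhHalf_le a) (abs_nonneg _) (abs_tanhHalf_le b)

theorem boxPlus_comm (a b : EReal) : boxPlus a b = boxPlus b a := by
  unfold boxPlus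
  rw [mul_comm]

theorem boxPlus_assoc (a b c : EReal) :
    boxPlus (boxPlus a b) c = boxPlus a (boxPlus b c) := by
  have h1 : boxPlus (boxPlus a b) c = twoArtanh (tanhHalf (boxPlus a b) * tanhHalf c) := rfl
  have h2 : boxPlus a (boxPlus b c) = twoArtanh (tanhHalf a * tanhHalf (boxPlus b c)) := rfl
  rw [h1, h2, tanhHalf_boxPlus, tanhHalf_boxPlus, mul_assoc]

/-- The type of L-densities: probability measures on the extended real line. -/
abbrev Density := ProbabilityMeasure EReal

/-- The point mass at `a`; `pointMass 0` carries no information, `pointMass ⊤` is perfect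
knowledge. -/
def pointMass (a : EReal) : Density := ⟨Measure.dirac a, inferInstance⟩

/-- The variable-node convolution: the law of `a + b` for independent `a ∼ c₁`, `b ∼ c₂`. -/
def varConv (c₁ c₂ : Density) : Density :=
  (c₁.prod c₂).map (f := fun p : EReal × EReal => p.1 + p.2) (by fun_prop)

/-- The check-node convolution: the law of `2 artanh (tanh (a / 2) * tanh (b / 2))` for
independent `a ∼ c₁`, `b ∼ c₂`. -/
def checkConv (c₁ c₂ : Density) : Density :=
  (c₁.prod c₂).map (f := fun p : EReal × EReal => boxPlus p.1 p.2)
    measurable_boxPlus.aemeasurable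

theorem map_prod_comm (f : EReal × EReal → EReal) (hf : Measurable f)
    (h : ∀ a b, f (a, b) = f (b, a)) (μ ν : Measure EReal) [SFinite μ] [SFinite ν] :
    (μ.prod ν).map f = (ν.prod μ).map f := by
  rw [← Measure.prod_swap, Measure.map_map hf measurable_swap]
  congr 1
  funext p
  exact h p.2 p.1

theorem map_prod_assoc (f : EReal × EReal → EReal) (hf : Measurable f)
    (h : ∀ a b c, f (f (a, b), c) = f (a, f (b, c)))
    (μ ν ρ : Measure EReal) [IsProbabilityMeasure μ] [IsProbabilityMeasure ν]
    [IsProbabilityMeasure ρ] :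
    (((μ.prod ν).map f).prod ρ).map f = (μ.prod ((ν.prod ρ).map f)).map f := by
  have e1 : ((μ.prod ν).map f).prod ρ
      = ((μ.prod ν).prod ρ).map (Prod.map f id) := by
    rw [← Measure.map_prod_map _ _ hf measurable_id, Measure.map_id]
  have e2 : μ.prod ((ν.prod ρ).map f)
      = (μ.prod (ν.prod ρ)).map (Prod.map id f) := by
    rw [← Measure.map_prod_map _ _ measurable_id hf, Measure.map_id]
  rw [e1, e2, ← Measure.prodAssoc_prod, Measure.map_map hf (hf.prodMap measurable_id),
    Measure.map_map (measurable_id.prodMap hf) (MeasurableEquiv.measurable _),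
    Measure.map_map hf ((measurable_id.prodMap hf).comp (MeasurableEquiv.measurable _))]
  congr 1
  funext p
  exact h p.1.1 p.1.2 p.2

instance : Std.Commutative varConv where
  comm c₁ c₂ := by
    apply ProbabilityMeasure.toMeasure_injective
    exact map_prod_comm (fun p => p.1 + p.2) (by fun_prop) (fun a b => add_comm a b) _ _

instance : Std.Associative varConv where
  assoc c₁ c₂ c₃ := by
    apply ProbabilityMeasure.toMeasure_injective
    exact map_prod_assoc (fun p => p.1 + p.2) (by fun_prop) (fun a b c => add_assoc a b c) _ _ _

instance : Std.Commutative checkConv where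
  comm c₁ c₂ := by
    apply ProbabilityMeasure.toMeasure_injective
    exact map_prod_comm _ measurable_boxPlus (fun a b => boxPlus_comm a b) _ _

instance : Std.Associative checkConv where
  assoc c₁ c₂ c₃ := by
    apply ProbabilityMeasure.toMeasure_injective
    exact map_prod_assoc _ measurable_boxPlus (fun a b c => boxPlus_assoc a b c) _ _ _

/-- Variable-node convolution of a finite family; the empty one is the point mass at `0`. -/
def varConvs {ι : Type*} (s : Finset ι) (c : ι → Density) : Density :=
  s.fold varConv (pointMass 0) c

/-- Check-node convolution of a finite family; the empty one is the point mass at `+∞`. -/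
def checkConvs {ι : Type*} (s : Finset ι) (c : ι → Density) : Density :=
  s.fold checkConv (pointMass ⊤) c

/-- The entropy (in bits) of an L-density, `∫ log₂ (1 + e^{-a}) c(da)`; the integrand vanishes
at `+∞`. (The symmetric L-densities that occur below give no mass to `-∞`.) -/
def entropy (c : Density) : ℝ :=
  ∫ a, Real.logb 2 (1 + (EReal.exp (-a)).toReal) ∂(c : Measure EReal)

/-! ### Joint laws, posteriors, conditional entropy

A joint law of a random element `X` of a finite type `A` and a random element `Y` of `B` is
given by the family of measures `J a = P (X = a, Y ∈ ·)` on `B`. -/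

/-- The conditional probability `P (X = a | Y = y)`. -/
def posterior {A B : Type*} [Fintype A] [MeasurableSpace B] (J : A → Measure B)
    (a : A) (y : B) : ℝ≥0∞ :=
  (J a).rnDeriv (∑ a', J a') y

/-- The conditional entropy `H(X | Y)` in bits: the expectation over `Y` of the entropy of the
conditional law of `X`. -/
def condEntropy {A B : Type*} [Fintype A] [MeasurableSpace B] (J : A → Measure B) : ℝ :=
  ∫ y, ∑ a, Real.negMulLog (posterior J a y).toReal / Real.log 2 ∂(∑ a, J a)

/-- The probability `P (φ(Y) ≠ X)`. -/
def errorProb {A B : Type*} [Fintype A] [MeasurableSpace B] (J : A → Measure B)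
    (φ : B → A) : ℝ :=
  ∑ a, (J a).real {y | φ y ≠ a}

/-- The binary entropy function in bits. -/
def binEntropyBits (p : ℝ) : ℝ := Real.binEntropy p / Real.log 2

/-! ### Binary memoryless symmetric channels -/

/-- A binary-input symmetric channel with output space `Y`: the output laws for the two inputs
are exchanged by a measurable involution of `Y` (for `Y = ℝ`, usually `y ↦ -y`). -/
structure BMSChannel (Y : Type*) [MeasurableSpace Y] where
  law : ZMod 2 → ProbabilityMeasure Y
  flip : Y → Y
  measurable_flip : Measurable flip
  flip_flip : ∀ y, flip (flip y) = y
  law_one : (law 1 : Measure Y) = (law 0 : Measure Y).map flip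

namespace BMSChannel

variable {Y : Type*} [MeasurableSpace Y]

/-- The log-likelihood ratio `ln (p(x = 0 | y) / p(x = 1 | y))` for a uniform input bit `x`. -/
def llr (W : BMSChannel Y) (y : Y) : EReal :=
  ENNReal.log
    (posterior (fun b : ZMod 2 => (2⁻¹ : ℝ≥0∞) • (W.law b : Measure Y)) 0 y /
      posterior (fun b : ZMod 2 => (2⁻¹ : ℝ≥0∞) • (W.law b : Measure Y)) 1 y)

theorem measurable_llr (W : BMSChannel Y) : Measurable W.llr :=
  ENNReal.measurable_log.comp
    ((Measure.measurable_rnDeriv _ _).div (Measure.measurable_rnDeriv _ _))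

/-- The L-density of the channel: the law of the log-likelihood ratio of the output given that
the input is `0`. -/
def density (W : BMSChannel Y) : Density :=
  (W.law 0).map W.measurable_llr.aemeasurable

end BMSChannel

/-! ### Factor graphs, codes, message passing -/

/-- A factor graph with variable nodes `V` and check nodes `C`, given by its set of edges. -/
structure FactorGraph (V C : Type*) where
  edges : Finset (V × C)

/-- The L-densities of all messages: `toCheck i α` from variable node `i` to check node `α`,
`toVar α i` in the other direction. Only the values on edges of the graph matter. -/
structure Messages (V C : Type*) where
  toCheck : V → C → Density
  toVar : C → V → Density

namespace FactorGraph

variable {V C : Type*}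

/-- The factor graph as a bipartite simple graph on `V ⊕ C`. -/
def toSimpleGraph (G : FactorGraph V C) : SimpleGraph (V ⊕ C) where
  Adj
    | Sum.inl i, Sum.inr α => (i, α) ∈ G.edges
    | Sum.inr α, Sum.inl i => (i, α) ∈ G.edges
    | _, _ => False
  symm := ⟨by rintro (i | α) (j | β) h <;> exact h⟩
  loopless := ⟨by rintro (i | α) h <;> exact h⟩

/-- The factor graph has no cycles. -/
def IsCycleFree (G : FactorGraph V C) : Prop := G.toSimpleGraph.IsAcyclic

/-- A directed edge of the factor graph. -/
inductive DirectedEdge (G : FactorGraph V C) : Type _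
  | toCheck (i : V) (α : C) (h : (i, α) ∈ G.edges)
  | toVar (α : C) (i : V) (h : (i, α) ∈ G.edges)

variable [Fintype V] [DecidableEq V] [Fintype C] [DecidableEq C]

/-- The check nodes adjacent to a variable node. -/
def varNbr (G : FactorGraph V C) (i : V) : Finset C :=
  Finset.univ.filter fun α => (i, α) ∈ G.edges

/-- The variable nodes adjacent to a check node. -/
def checkNbr (G : FactorGraph V C) (α : C) : Finset V :=
  Finset.univ.filter fun i => (i, α) ∈ G.edges

/-- The binary code of the factor graph: all words that satisfy every parity check. -/
def code (G : FactorGraph V C) : Finset (V → ZMod 2) :=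
  Finset.univ.filter fun x => ∀ α, ∑ i ∈ G.checkNbr α, x i = 0

/-- The joint law of a uniformly distributed codeword `X` and the output `Y` of the channels `W`,
used independently, one for each coordinate: `x ↦ P (X = x, Y ∈ ·)`. -/
def jointLaw {Y : V → Type*} [∀ i, MeasurableSpace (Y i)] (G : FactorGraph V C)
    (W : ∀ i, BMSChannel (Y i)) (x : V → ZMod 2) : Measure (∀ i, Y i) :=
  if x ∈ G.code then
    (G.code.card : ℝ≥0∞)⁻¹ • Measure.pi fun i => ((W i).law (x i) : Measure (Y i))
  else 0

/-- Pass one message: recompute the density on one directed edge from the current densities on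
the other edges, and leave everything else unchanged. -/
def pass (G : FactorGraph V C) (c : V → Density) (m : Messages V C) :
    G.DirectedEdge → Messages V C
  | .toCheck i α _ =>
      { m with
        toCheck := Function.update m.toCheck i <| Function.update (m.toCheck i) α <|
          varConv (c i) (varConvs ((G.varNbr i).erase α) fun β => m.toVar β i) }
  | .toVar α i _ =>
      { m with
        toVar := Function.update m.toVar α <| Function.update (m.toVar α) i <|
          checkConvs ((G.checkNbr α).erase i) fun j => m.toCheck j α }

/-- The densities after the first `t` messages of the schedule `S`; initially all of them are the
point mass at `0`. -/
def messages (G : FactorGraph V C) (c : V → Density) (S : List G.DirectedEdge) (t : ℕ) :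
    Messages V C :=
  (S.take t).foldl (G.pass c) ⟨fun _ _ => pointMass 0, fun _ _ => pointMass 0⟩

/-- The potential functional of channel densities `c` and message densities `m`. -/
def potential (G : FactorGraph V C) (c : V → Density) (m : Messages V C) : ℝ :=
  -(1 / (Fintype.card V : ℝ)) *
    (∑ i, entropy (varConv (c i) (varConvs (G.varNbr i) fun α => m.toVar α i))
      + ∑ α, ∑ i ∈ G.checkNbr α, entropy (m.toCheck i α)
      - ∑ α, entropy (checkConvs (G.checkNbr α) fun i => m.toCheck i α)
      - ∑ e ∈ G.edges, entropy (varConv (m.toCheck e.1 e.2) (m.toVar e.2 e.1)))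

/-- The GAP functional `U(c, t)` of the graph `G` under the schedule `S`. -/
def gap (G : FactorGraph V C) (c : V → Density) (S : List G.DirectedEdge) (t : ℕ) : ℝ :=
  G.potential c (G.messages c S t)

end FactorGraph

end GapLowerLimit

end

noncomputable section

set_option linter.unusedSectionVars false

namespace GapLowerLimit

/-! ### Elementary identities for `tanhHalf` -/

/-! Write `U = -bethe / N`. The first inequality says that the Bethe entropy of the current messages
is at most `H(X | Y)`. By channel symmetry and linearity of the code, `H(X | Y)` is the expected
logarithm of the partition function, the sum over codewords of likelihoods relative to the zero
word, when zero is sent (`condEntropy_jointLaw_eq_logPartition`).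

Starting from `Δ_0`, every reachable state is improving: all densities are symmetric and each
message is degraded with respect to its own recomputation. In such a state no single update lowers
`bethe` (`IsImproving.bethe_le_setCheck`, `IsImproving.bethe_le_setVar`). The increment is a mixed
second difference of `H(a ⊛ b)` along degradation, and it is nonnegative by
`entropy_varConv_supermodular`: the duality `H(a ⊛ b) + H(a ⊠ b) = H(a) + H(b)` moves the question
to `⊠`, where `1 - H` is a nonnegative combination of even moments of `tanh (x / 2)`. These moments
multiply under `⊠` and grow along degradation.

A forest with an edge has a check all of whose neighbours except one, `i₀`, are leaves
(`IsCycleFree.exists_isPendant`). Updating the messages from the leaves and then the one to `i₀`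
only raises `bethe`. Afterwards the check can be removed and its message absorbed into the channel
of `i₀`. This changes `bethe` (`IsPendant.bethe_eq`) and the expected log-partition function
(`IsPendant.logPartition_add`) by the same entropy. Induction on the number of edges ends at the
edgeless graph, where the two agree.

The second inequality is Fano's, with the `2 ^ N` words as alphabet. -/

@[simp] theorem tanhHalf_bot : tanhHalf ⊥ = -1 := by simp [tanhHalf]

@[simp] theorem tanhHalf_top : tanhHalf ⊤ = 1 := by simp [tanhHalf]

@[simp] theorem tanhHalf_coe (x : ℝ) : tanhHalf x = Real.tanh (x / 2) := by simp [tanhHalf]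

@[simp] theorem tanhHalf_zero : tanhHalf 0 = 0 := by
  rw [← EReal.coe_zero, tanhHalf_coe]; simp

@[simp] theorem tanhHalf_neg (x : EReal) : tanhHalf (-x) = -tanhHalf x := by
  induction x with
  | bot => simp
  | top => simp
  | coe x => rw [← EReal.coe_neg, tanhHalf_coe, tanhHalf_coe, neg_div, Real.tanh_neg]

theorem neg_one_le_tanhHalf (x : EReal) : -1 ≤ tanhHalf x := (abs_le.1 (abs_tanhHalf_le x)).1

theorem twoArtanh_tanhHalf (x : EReal) : twoArtanh (tanhHalf x) = x := by
  induction x with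
  | bot => simp [twoArtanh]
  | top => simp [twoArtanh]
  | coe x =>
    have h := abs_lt.1 (Real.abs_tanh_lt_one (x / 2))
    rw [tanhHalf_coe, twoArtanh, if_neg (not_le.2 h.1), if_neg (not_le.2 h.2), Real.artanh_tanh]
    congr 1; ring

theorem tanhHalf_injective : Function.Injective tanhHalf :=
  Function.LeftInverse.injective twoArtanh_tanhHalf

theorem boxPlus_neg_left (x y : EReal) : boxPlus (-x) y = -boxPlus x y :=
  tanhHalf_injective (by simp [tanhHalf_boxPlus])

theorem boxPlus_neg_right (x y : EReal) : boxPlus x (-y) = -boxPlus x y :=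
  tanhHalf_injective (by simp [tanhHalf_boxPlus])

/-- The likelihood ratio `e^{-x}` as a real number. -/
def lik (x : EReal) : ℝ := (EReal.exp (-x)).toReal

theorem measurable_lik : Measurable lik :=
  (EReal.measurable_exp.comp measurable_neg).ennreal_toReal

theorem lik_nonneg (x : EReal) : 0 ≤ lik x := ENNReal.toReal_nonneg

@[simp] theorem lik_coe (x : ℝ) : lik x = Real.exp (-x) := by
  rw [lik, ← EReal.coe_neg, EReal.exp_coe, ENNReal.toReal_ofReal (Real.exp_pos _).le]

@[simp] theorem lik_top : lik ⊤ = 0 := by simp [lik]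

theorem lik_add {x y : EReal} (hx : x ≠ ⊥) (hy : y ≠ ⊥) : lik (x + y) = lik x * lik y := by
  induction x with
  | bot => exact absurd rfl hx
  | top => rw [EReal.top_add_of_ne_bot hy]; simp
  | coe x =>
    induction y with
    | bot => exact absurd rfl hy
    | top => simp
    | coe y =>
      rw [← EReal.coe_add, lik_coe, lik_coe, lik_coe, ← Real.exp_add]
      congr 1; ring

theorem one_add_tanh_half (x : ℝ) : 1 + Real.tanh (x / 2) = 2 / (1 + Real.exp (-x)) := by
  rw [Real.tanh_eq]
  have h : Real.exp (-x) = Real.exp (-(x / 2)) * Real.exp (-(x / 2)) := by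
    rw [← Real.exp_add]; ring_nf
  have h2 : Real.exp (x / 2) * Real.exp (-(x / 2)) = 1 := by
    rw [← Real.exp_add]; simp
  have h3 := Real.exp_pos (x / 2)
  have h4 := Real.exp_pos (-(x / 2))
  rw [h]
  field_simp
  linear_combination (2 * Real.exp (-(x / 2))) * h2

/-- The exclusion of `⊥` is essential: there the infinite likelihood ratio becomes `0` under
`toReal`, so the right side would be `2`. -/
theorem one_add_tanhHalf {x : EReal} (hx : x ≠ ⊥) : 1 + tanhHalf x = 2 / (1 + lik x) := by
  induction x with
  | bot => exact absurd rfl hx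
  | top => simp; norm_num
  | coe x => rw [tanhHalf_coe, lik_coe, one_add_tanh_half]

theorem tanhHalf_eq_of_ne_bot {x : EReal} (hx : x ≠ ⊥) :
    tanhHalf x = (1 - lik x) / (1 + lik x) := by
  have h := one_add_tanhHalf hx
  have h1 : 0 < 1 + lik x := by linarith [lik_nonneg x]
  rw [eq_sub_of_add_eq' h]
  field_simp
  ring

/-- The addition formula for tanh, multiplied out because its denominator vanishes at opposite
infinities; in this form it survives there, both sides being `0`. -/
theorem tanhHalf_add (x y : EReal) :
    tanhHalf (x + y) * (1 + tanhHalf x * tanhHalf y) = tanhHalf x + tanhHalf y := by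
  have key : ∀ x y : EReal, x ≠ ⊥ → y ≠ ⊥ →
      tanhHalf (x + y) * (1 + tanhHalf x * tanhHalf y) = tanhHalf x + tanhHalf y := by
    intro x y hx hy
    have hxy : x + y ≠ ⊥ := by simp [EReal.add_eq_bot_iff, hx, hy]
    rw [tanhHalf_eq_of_ne_bot hx, tanhHalf_eq_of_ne_bot hy, tanhHalf_eq_of_ne_bot hxy,
      lik_add hx hy]
    have h1 := lik_nonneg x
    have h2 := lik_nonneg y
    have h3 : 0 < 1 + lik x := by linarith
    have h4 : 0 < 1 + lik y := by linarith
    have h5 : 0 < 1 + lik x * lik y := by positivity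
    field_simp
    ring
  induction x with
  | bot =>
    simp only [EReal.bot_add, tanhHalf_bot]; ring
  | top =>
    by_cases hy : y = ⊥
    · subst hy; simp
    · exact key _ _ (by simp) hy
  | coe x =>
    by_cases hy : y = ⊥
    · subst hy; simp
    · exact key _ _ (by simp) hy

/-- The conditional probability of the bit `0` given the log-likelihood ratio `x`. -/
def bitProb (x : EReal) : ℝ≥0∞ := ENNReal.ofReal ((1 + tanhHalf x) / 2)

theorem measurable_bitProb : Measurable bitProb :=
  ((measurable_tanhHalf.const_add 1).div_const 2).ennreal_ofReal

theorem bitProb_ne_top (x : EReal) : bitProb x ≠ ⊤ := ENNReal.ofReal_ne_top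

@[simp] theorem bitProb_bot : bitProb ⊥ = 0 := by simp [bitProb]

@[simp] theorem bitProb_top : bitProb ⊤ = 1 := by simp [bitProb]

theorem half_one_add_tanhHalf_nonneg (x : EReal) : 0 ≤ (1 + tanhHalf x) / 2 := by
  linarith [neg_one_le_tanhHalf x]

theorem bitProb_add_bitProb_neg (x : EReal) : bitProb x + bitProb (-x) = 1 := by
  rw [bitProb, bitProb, ← ENNReal.ofReal_add (half_one_add_tanhHalf_nonneg x)
    (half_one_add_tanhHalf_nonneg (-x)), tanhHalf_neg]
  ring_nf; simp

/-- Two independent bits have even sum when both are `0` or both are `1`. -/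
theorem bitProb_mul_add (x y : EReal) :
    bitProb x * bitProb y + bitProb (-x) * bitProb (-y) = bitProb (boxPlus x y) := by
  have h := half_one_add_tanhHalf_nonneg
  rw [bitProb, bitProb, bitProb, bitProb, bitProb, ← ENNReal.ofReal_mul (h _),
    ← ENNReal.ofReal_mul (h _), ← ENNReal.ofReal_add (mul_nonneg (h _) (h _))
    (mul_nonneg (h _) (h _)), tanhHalf_boxPlus, tanhHalf_neg, tanhHalf_neg]
  ring_nf

/-- Chain rule for two bits: both are `0` when they agree and, given that they agree, their common
value is `0`. Given agreement, the log-likelihood ratios add. -/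
theorem bitProb_boxPlus_mul_bitProb_add (x y : EReal) :
    bitProb (boxPlus x y) * bitProb (x + y) = bitProb x * bitProb y := by
  have h := half_one_add_tanhHalf_nonneg
  rw [bitProb, bitProb, bitProb, bitProb, ← ENNReal.ofReal_mul (h _), ← ENNReal.ofReal_mul (h _),
    tanhHalf_boxPlus]
  congr 1
  linear_combination (1 / 4 : ℝ) * tanhHalf_add x y

/-- On the extended line negation fails to distribute over a sum only at opposite infinities, and
there the parity weight is `0`. -/
theorem bitProb_boxPlus_mul_neg_add (g : EReal → ℝ≥0∞) (x y : EReal) :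
    bitProb (boxPlus x y) * g (-x + -y) = bitProb (boxPlus x y) * g (-(x + y)) := by
  by_cases h1 : x = ⊥ ∧ y = ⊤
  · obtain ⟨rfl, rfl⟩ := h1
    simp [bitProb, tanhHalf_boxPlus]
  by_cases h2 : x = ⊤ ∧ y = ⊥
  · obtain ⟨rfl, rfl⟩ := h2
    simp [bitProb, tanhHalf_boxPlus]
  rw [EReal.neg_add (by tauto) (by tauto), sub_eq_add_neg]

/-! ### Symmetric densities -/

/-- An L-density is symmetric if, conditionally on the absolute value of the log-likelihood
ratio, its sign is positive with the probability given by that absolute value. -/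
def IsSym (c : Density) : Prop :=
  ∀ f : EReal → ℝ≥0∞, Measurable f →
    ∫⁻ x, f x ∂(c : Measure EReal)
      = ∫⁻ x, (bitProb x * f x + bitProb (-x) * f (-x)) ∂(c : Measure EReal)

theorem lintegral_varConv (a b : Density) {f : EReal → ℝ≥0∞} (hf : Measurable f) :
    ∫⁻ z, f z ∂(varConv a b : Measure EReal)
      = ∫⁻ x, ∫⁻ y, f (x + y) ∂(b : Measure EReal) ∂(a : Measure EReal) := by
  rw [varConv, ProbabilityMeasure.toMeasure_map, lintegral_map hf (by fun_prop),
    ProbabilityMeasure.toMeasure_prod, lintegral_prod _ (by fun_prop)]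

theorem lintegral_checkConv (a b : Density) {f : EReal → ℝ≥0∞} (hf : Measurable f) :
    ∫⁻ z, f z ∂(checkConv a b : Measure EReal)
      = ∫⁻ x, ∫⁻ y, f (boxPlus x y) ∂(b : Measure EReal) ∂(a : Measure EReal) := by
  rw [checkConv, ProbabilityMeasure.toMeasure_map, lintegral_map hf measurable_boxPlus,
    ProbabilityMeasure.toMeasure_prod,
    lintegral_prod (fun z => f (boxPlus z.1 z.2)) (hf.comp measurable_boxPlus).aemeasurable]

theorem IsSym.lintegral_lintegral {a b : Density} (ha : IsSym a) (hb : IsSym b)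
    {f : EReal → EReal → ℝ≥0∞} (hf : Measurable (Function.uncurry f)) :
    ∫⁻ x, ∫⁻ y, f x y ∂(b : Measure EReal) ∂(a : Measure EReal)
      = ∫⁻ x, ∫⁻ y, (bitProb x * bitProb y * f x y + bitProb x * bitProb (-y) * f x (-y)
          + bitProb (-x) * bitProb y * f (-x) y + bitProb (-x) * bitProb (-y) * f (-x) (-y))
          ∂(b : Measure EReal) ∂(a : Measure EReal) := by
  have hp := measurable_bitProb
  have hf2 : Measurable fun z : EReal × EReal => f z.1 z.2 := hf
  have hfn : Measurable fun z : EReal × EReal => f z.1 (-z.2) :=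
    hf2.comp (measurable_fst.prodMk measurable_snd.neg)
  have hp2 : Measurable fun z : EReal × EReal => bitProb z.2 := hp.comp measurable_snd
  have hp3 : Measurable fun z : EReal × EReal => bitProb (-z.2) := hp.comp measurable_snd.neg
  obtain ⟨g, hg⟩ : ∃ g : EReal → EReal → ℝ≥0∞,
      ∀ x y, g x y = bitProb y * f x y + bitProb (-y) * f x (-y) := ⟨_, fun _ _ => rfl⟩
  have hgm : Measurable fun z : EReal × EReal => g z.1 z.2 := by
    simp only [hg]
    exact (hp2.mul hf2).add (hp3.mul hfn)
  have hgx : ∀ x, Measurable (g x) := fun x => hgm.comp measurable_prodMk_left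
  have e1 : ∀ x, ∫⁻ y, f x y ∂(b : Measure EReal) = ∫⁻ y, g x y ∂(b : Measure EReal) := by
    intro x
    simp only [hg]
    exact hb _ (hf.comp measurable_prodMk_left)
  have hG : Measurable fun x => ∫⁻ y, g x y ∂(b : Measure EReal) := hgm.lintegral_prod_right'
  rw [lintegral_congr e1, ha _ hG]
  refine lintegral_congr fun x => ?_
  rw [← lintegral_const_mul (bitProb x) (hgx x), ← lintegral_const_mul (bitProb (-x)) (hgx (-x)),
    ← lintegral_add_left ((hgx x).const_mul _)]
  refine lintegral_congr fun y => ?_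
  rw [hg, hg]
  ring

/-- Among the four sign patterns of `(x, y)`, evenness of `g` identifies the two with equal signs
and the two with opposite signs. Their total weights are the probabilities of even and odd parity.
-/
theorem IsSym.lintegral_varConv_even {a b : Density} (ha : IsSym a) (hb : IsSym b)
    {g : EReal → ℝ≥0∞} (hg : Measurable g) (heven : ∀ x, g (-x) = g x) :
    ∫⁻ z, g z ∂(varConv a b : Measure EReal)
      = ∫⁻ x, ∫⁻ y, (bitProb (boxPlus x y) * g (x + y) + bitProb (-boxPlus x y) * g (x + -y))
          ∂(b : Measure EReal) ∂(a : Measure EReal) := by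
  rw [lintegral_varConv a b hg, ha.lintegral_lintegral hb
    (f := fun x y => g (x + y)) (hg.comp (by fun_prop))]
  refine lintegral_congr fun x => lintegral_congr fun y => ?_
  have h1 := bitProb_mul_add x y
  have h2 := bitProb_mul_add x (-y)
  have h3 := bitProb_boxPlus_mul_neg_add g x y
  have h4 := bitProb_boxPlus_mul_neg_add g x (-y)
  rw [boxPlus_neg_right] at h2 h4
  rw [heven] at h3 h4
  rw [neg_neg] at h2 h4
  rw [← h1, ← h2] at *
  -- Evenness is available only multiplied by the parity weight, as in `h3`. That weight cancels
  -- unless the smaller weight occurring here is already zero.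
  have e3 : bitProb (-x) * bitProb (-y) * g (-x + -y) = bitProb (-x) * bitProb (-y) * g (x + y) := by
    by_cases hz : bitProb (-x) * bitProb (-y) = 0
    · simp [hz]
    · have hne : bitProb x * bitProb y + bitProb (-x) * bitProb (-y) ≠ 0 := by
        intro h; exact hz (add_eq_zero.1 h).2
      have hnt : bitProb x * bitProb y + bitProb (-x) * bitProb (-y) ≠ ⊤ := by
        exact ENNReal.add_ne_top.2 ⟨ENNReal.mul_ne_top (bitProb_ne_top _) (bitProb_ne_top _),
          ENNReal.mul_ne_top (bitProb_ne_top _) (bitProb_ne_top _)⟩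
      rw [(ENNReal.mul_right_inj hne hnt).1 h3]
  have e4 : bitProb (-x) * bitProb y * g (-x + y) = bitProb (-x) * bitProb y * g (x + -y) := by
    by_cases hz : bitProb (-x) * bitProb y = 0
    · simp [hz]
    · have hne : bitProb x * bitProb (-y) + bitProb (-x) * bitProb y ≠ 0 := by
        intro h; exact hz (add_eq_zero.1 h).2
      have hnt : bitProb x * bitProb (-y) + bitProb (-x) * bitProb y ≠ ⊤ := by
        exact ENNReal.add_ne_top.2 ⟨ENNReal.mul_ne_top (bitProb_ne_top _) (bitProb_ne_top _),
          ENNReal.mul_ne_top (bitProb_ne_top _) (bitProb_ne_top _)⟩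
      rw [(ENNReal.mul_right_inj hne hnt).1 h4]
  rw [e3, e4]
  ring

/-- The symmetrized test function is even, so its integral reduces to the two parity classes; the
chain rule then splits each class into its two sign patterns. -/
theorem isSym_varConv {a b : Density} (ha : IsSym a) (hb : IsSym b) : IsSym (varConv a b) := by
  intro f hf
  have hp := measurable_bitProb
  have hg : Measurable fun z => bitProb z * f z + bitProb (-z) * f (-z) :=
    (hp.mul hf).add ((hp.comp measurable_neg).mul (hf.comp measurable_neg))
  rw [ha.lintegral_varConv_even hb hg (fun x => by rw [neg_neg, add_comm]),
    lintegral_varConv a b hf, ha.lintegral_lintegral hb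
    (f := fun x y => f (x + y)) (hf.comp (by fun_prop))]
  refine lintegral_congr fun x => lintegral_congr fun y => ?_
  have key : ∀ x y, bitProb (boxPlus x y) * (bitProb (x + y) * f (x + y)
      + bitProb (-(x + y)) * f (-(x + y)))
      = bitProb x * bitProb y * f (x + y) + bitProb (-x) * bitProb (-y) * f (-x + -y) := by
    intro x y
    have h := bitProb_boxPlus_mul_neg_add (fun z => bitProb z * f z) x y
    rw [mul_add, ← h, ← mul_assoc, ← mul_assoc, bitProb_boxPlus_mul_bitProb_add,
      ← bitProb_boxPlus_mul_bitProb_add (-x) (-y), boxPlus_neg_left, boxPlus_neg_right, neg_neg]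
  have k1 := key x y
  have k2 := key x (-y)
  rw [boxPlus_neg_right, neg_neg] at k2
  rw [k1, k2]
  ring

/-- Flipping one argument flips `boxPlus`, so the four sign patterns collapse to two, weighted by
even and odd parity. -/
theorem isSym_checkConv {a b : Density} (ha : IsSym a) (hb : IsSym b) :
    IsSym (checkConv a b) := by
  intro f hf
  have hp := measurable_bitProb
  have hg : Measurable fun z => bitProb z * f z + bitProb (-z) * f (-z) :=
    (hp.mul hf).add ((hp.comp measurable_neg).mul (hf.comp measurable_neg))
  rw [lintegral_checkConv a b hg, lintegral_checkConv a b hf, ha.lintegral_lintegral hb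
    (f := fun x y => f (boxPlus x y)) (hf.comp measurable_boxPlus)]
  refine lintegral_congr fun x => lintegral_congr fun y => ?_
  have h2 := bitProb_mul_add x (-y)
  rw [boxPlus_neg_right, neg_neg] at h2
  simp only [boxPlus_neg_left, boxPlus_neg_right, neg_neg]
  rw [← bitProb_mul_add x y, ← h2]
  ring

theorem coe_pointMass (a : EReal) : (pointMass a : Measure EReal) = Measure.dirac a := rfl

theorem isSym_pointMass_zero : IsSym (pointMass 0) := by
  intro f hf
  simp only [coe_pointMass, lintegral_dirac, neg_zero, ← add_mul]
  have := bitProb_add_bitProb_neg 0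
  rw [neg_zero] at this
  rw [this, one_mul]

theorem isSym_pointMass_top : IsSym (pointMass ⊤) := by
  intro f hf
  simp [coe_pointMass]

/-- Test symmetry on the indicator of `⊥`: each weight on the right vanishes where its indicator
does not, since `bitProb ⊥ = 0`. This licenses the identities that fail at `⊥`. -/
theorem IsSym.ae_ne_bot {c : Density} (hc : IsSym c) : ∀ᵐ x ∂(c : Measure EReal), x ≠ ⊥ := by
  have h := hc (Set.indicator {⊥} 1) (measurable_one.indicator (measurableSet_singleton _))
  rw [lintegral_indicator_one (measurableSet_singleton _)] at h
  have h2 : ∀ x : EReal, bitProb x * (({⊥} : Set EReal).indicator 1 x)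
      + bitProb (-x) * (({⊥} : Set EReal).indicator 1 (-x)) = 0 := by
    intro x
    simp only [Set.indicator_apply, Set.mem_singleton_iff]
    split_ifs with h1 h3 h3 <;> simp_all
  simp only [h2, lintegral_zero] at h
  exact measure_eq_zero_iff_ae_notMem.1 h

/-! ### Convolutions of finite families. -/

section folds

variable {ι : Type*}

theorem varConvs_congr {s : Finset ι} {c c' : ι → Density} (h : ∀ i ∈ s, c i = c' i) :
    varConvs s c = varConvs s c' := Finset.fold_congr h

theorem checkConvs_congr {s : Finset ι} {c c' : ι → Density} (h : ∀ i ∈ s, c i = c' i) :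
    checkConvs s c = checkConvs s c' := Finset.fold_congr h

variable [DecidableEq ι]

theorem varConvs_insert {s : Finset ι} {i : ι} (hi : i ∉ s) (c : ι → Density) :
    varConvs (insert i s) c = varConv (c i) (varConvs s c) := Finset.fold_insert hi

theorem checkConvs_insert {s : Finset ι} {i : ι} (hi : i ∉ s) (c : ι → Density) :
    checkConvs (insert i s) c = checkConv (c i) (checkConvs s c) := Finset.fold_insert hi

theorem varConvs_erase {s : Finset ι} {i : ι} (hi : i ∈ s) (c : ι → Density) :
    varConvs s c = varConv (c i) (varConvs (s.erase i) c) := by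
  rw [← varConvs_insert (Finset.notMem_erase i s), Finset.insert_erase hi]

theorem checkConvs_erase {s : Finset ι} {i : ι} (hi : i ∈ s) (c : ι → Density) :
    checkConvs s c = checkConv (c i) (checkConvs (s.erase i) c) := by
  rw [← checkConvs_insert (Finset.notMem_erase i s), Finset.insert_erase hi]

theorem isSym_varConvs {s : Finset ι} {c : ι → Density} (h : ∀ i ∈ s, IsSym (c i)) :
    IsSym (varConvs s c) := by
  induction s using Finset.induction_on with
  | empty => exact isSym_pointMass_zero
  | insert i s hi ih =>
    rw [varConvs_insert hi]
    exact isSym_varConv (h i (Finset.mem_insert_self i s))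
      (ih fun j hj => h j (Finset.mem_insert_of_mem hj))

theorem isSym_checkConvs {s : Finset ι} {c : ι → Density} (h : ∀ i ∈ s, IsSym (c i)) :
    IsSym (checkConvs s c) := by
  induction s using Finset.induction_on with
  | empty => exact isSym_pointMass_top
  | insert i s hi ih =>
    rw [checkConvs_insert hi]
    exact isSym_checkConv (h i (Finset.mem_insert_self i s))
      (ih fun j hj => h j (Finset.mem_insert_of_mem hj))

end folds

theorem varConv_pointMass_zero (c : Density) : varConv c (pointMass 0) = c := by
  apply ProbabilityMeasure.toMeasure_injective
  refine Measure.ext_of_lintegral _ fun f hf => ?_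
  rw [lintegral_varConv _ _ hf]
  simp [coe_pointMass]

/-! ### Entropy -/

/-- The integrand `log₂ (1 + e^{-x})` of the entropy. -/
def surprisal (x : EReal) : ℝ := Real.logb 2 (1 + lik x)

theorem measurable_surprisal : Measurable surprisal := by
  unfold surprisal Real.logb
  exact (Real.measurable_log.comp (measurable_lik.const_add 1)).div_const _

theorem surprisal_nonneg (x : EReal) : 0 ≤ surprisal x :=
  Real.logb_nonneg one_lt_two (by linarith [lik_nonneg x])

/-- The entropy as an extended nonnegative real number. -/
def lentropy (c : Density) : ℝ≥0∞ := ∫⁻ x, ENNReal.ofReal (surprisal x) ∂(c : Measure EReal)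

theorem entropy_eq_toReal (c : Density) : entropy c = (lentropy c).toReal := by
  change ∫ x, surprisal x ∂(c : Measure EReal) = _
  rw [integral_eq_lintegral_of_nonneg_ae (Filter.Eventually.of_forall surprisal_nonneg)
    measurable_surprisal.aestronglyMeasurable]
  rfl

/-- The entropy in bits of a binary variable with mean `t` on `{-1, 1}`. -/
def signEntropy (t : ℝ) : ℝ := Real.binEntropy ((1 + t) / 2) / Real.log 2

theorem measurable_signEntropy : Measurable signEntropy := by
  unfold signEntropy
  fun_prop

theorem signEntropy_nonneg {t : ℝ} (h : |t| ≤ 1) : 0 ≤ signEntropy t := by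
  obtain ⟨h1, h2⟩ := abs_le.1 h
  exact div_nonneg (Real.binEntropy_nonneg (by linarith) (by linarith))
    (Real.log_nonneg one_le_two)

theorem signEntropy_le_one (t : ℝ) : signEntropy t ≤ 1 :=
  (div_le_one (Real.log_pos one_lt_two)).2 Real.binEntropy_le_log_two

theorem half_one_add_tanhHalf_mul_surprisal (x : EReal) :
    (1 + tanhHalf x) / 2 * surprisal x
      = Real.negMulLog ((1 + tanhHalf x) / 2) / Real.log 2 := by
  by_cases hx : x = ⊥
  · subst hx; simp
  have h : 1 + lik x = ((1 + tanhHalf x) / 2)⁻¹ := by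
    rw [one_add_tanhHalf hx]
    have := lik_nonneg x
    field_simp
  rw [surprisal, h, Real.logb, Real.log_inv, Real.negMulLog]
  ring

/-- Off `⊥`, `surprisal` is `log₂ (1 / p)` with `p = (1 + tanhHalf x) / 2`, so averaging it over the
sign gives the binary entropy of `p`. -/
theorem bitProb_mul_surprisal (x : EReal) :
    bitProb x * ENNReal.ofReal (surprisal x) + bitProb (-x) * ENNReal.ofReal (surprisal (-x))
      = ENNReal.ofReal (signEntropy (tanhHalf x)) := by
  have h := half_one_add_tanhHalf_nonneg
  have hs := surprisal_nonneg
  rw [bitProb, bitProb, ← ENNReal.ofReal_mul (h _), ← ENNReal.ofReal_mul (h _),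
    ← ENNReal.ofReal_add (mul_nonneg (h _) (hs _)) (mul_nonneg (h _) (hs _)),
    half_one_add_tanhHalf_mul_surprisal, half_one_add_tanhHalf_mul_surprisal, signEntropy,
    Real.binEntropy_eq_negMulLog_add_negMulLog_one_sub, ← add_div, tanhHalf_neg]
  ring_nf

theorem IsSym.lentropy_eq {c : Density} (hc : IsSym c) :
    lentropy c = ∫⁻ x, ENNReal.ofReal (signEntropy (tanhHalf x)) ∂(c : Measure EReal) := by
  rw [lentropy, hc _ measurable_surprisal.ennreal_ofReal]
  exact lintegral_congr bitProb_mul_surprisal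

theorem IsSym.lentropy_le_one {c : Density} (hc : IsSym c) : lentropy c ≤ 1 := by
  rw [hc.lentropy_eq]
  calc _ ≤ ∫⁻ _, 1 ∂(c : Measure EReal) :=
        lintegral_mono fun x => ENNReal.ofReal_le_one.2 (signEntropy_le_one _)
    _ = 1 := by simp

theorem IsSym.lentropy_ne_top {c : Density} (hc : IsSym c) : lentropy c ≠ ⊤ :=
  ne_top_of_le_ne_top ENNReal.one_ne_top hc.lentropy_le_one

theorem boxPlus_ne_bot {x y : EReal} (hx : x ≠ ⊥) (hy : y ≠ ⊥) : boxPlus x y ≠ ⊥ := by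
  intro h
  have h1 := tanhHalf_boxPlus x y
  rw [h, tanhHalf_bot, tanhHalf_eq_of_ne_bot hx, tanhHalf_eq_of_ne_bot hy] at h1
  have h2 := lik_nonneg x
  have h3 := lik_nonneg y
  have h4 : 0 < 1 + lik x := by linarith
  have h5 : 0 < 1 + lik y := by linarith
  field_simp at h1
  nlinarith [mul_nonneg h2 h3]

/-- Since `1 + lik x` is the reciprocal of the probability of a zero bit, this is the two-bit chain
rule again; its logarithm is the pointwise form of entropy duality. -/
theorem one_add_lik_mul {x y : EReal} (hx : x ≠ ⊥) (hy : y ≠ ⊥) :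
    (1 + lik (x + y)) * (1 + lik (boxPlus x y)) = (1 + lik x) * (1 + lik y) := by
  have h2 := lik_nonneg x
  have h3 := lik_nonneg y
  have h4 : 0 < 1 + lik x := by linarith
  have h5 : 0 < 1 + lik y := by linarith
  have h6 : 0 < 1 + lik (boxPlus x y) := by linarith [lik_nonneg (boxPlus x y)]
  have h := one_add_tanhHalf (boxPlus_ne_bot hx hy)
  rw [tanhHalf_boxPlus, tanhHalf_eq_of_ne_bot hx, tanhHalf_eq_of_ne_bot hy] at h
  rw [lik_add hx hy]
  field_simp at h
  linarith

theorem surprisal_add_add_boxPlus {x y : EReal} (hx : x ≠ ⊥) (hy : y ≠ ⊥) :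
    surprisal (x + y) + surprisal (boxPlus x y) = surprisal x + surprisal y := by
  have h : ∀ z, 1 + lik z ≠ 0 := fun z => by linarith [lik_nonneg z]
  rw [surprisal, surprisal, ← Real.logb_mul (h _) (h _), one_add_lik_mul hx hy,
    Real.logb_mul (h _) (h _), surprisal, surprisal]

/-- The pointwise identity integrates because symmetric densities give no mass to `⊥`. In entropy
terms, a pair of bits is described by their sum and then by one bit given the sum. -/
theorem lentropy_varConv_add_checkConv {a b : Density} (ha : IsSym a) (hb : IsSym b) :
    lentropy (varConv a b) + lentropy (checkConv a b) = lentropy a + lentropy b := by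
  obtain ⟨g, hg⟩ : ∃ g : EReal → ℝ≥0∞, ∀ x, g x = ENNReal.ofReal (surprisal x) :=
    ⟨_, fun _ => rfl⟩
  have hm : Measurable g := by
    rw [funext hg]
    exact measurable_surprisal.ennreal_ofReal
  have hl : ∀ c, lentropy c = ∫⁻ x, g x ∂(c : Measure EReal) := fun c => by
    simp only [hg, lentropy]
  have hm1 : Measurable fun z : EReal × EReal => g (z.1 + z.2) := hm.comp (by fun_prop)
  have hm2 : Measurable fun x => ∫⁻ y, g (x + y) ∂(b : Measure EReal) :=
    hm1.lintegral_prod_right'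
  have h1 : lentropy a + lentropy b
      = ∫⁻ x, (g x + ∫⁻ y, g y ∂(b : Measure EReal)) ∂(a : Measure EReal) := by
    rw [lintegral_add_left hm, hl, hl]
    simp
  rw [h1, hl, hl, lintegral_varConv a b hm, lintegral_checkConv a b hm, ← lintegral_add_left hm2]
  refine lintegral_congr_ae (ha.ae_ne_bot.mono fun x hx => ?_)
  have hm3 : Measurable fun y => g (x + y) := hm1.comp measurable_prodMk_left
  have h2 : g x + ∫⁻ y, g y ∂(b : Measure EReal) = ∫⁻ y, (g x + g y) ∂(b : Measure EReal) := by
    rw [lintegral_add_left measurable_const]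
    simp
  simp only [h2]
  rw [← lintegral_add_left hm3]
  refine lintegral_congr_ae (hb.ae_ne_bot.mono fun y hy => ?_)
  have hs := surprisal_nonneg
  simp only [hg]
  rw [← ENNReal.ofReal_add (hs _) (hs _), ← ENNReal.ofReal_add (hs _) (hs _),
    surprisal_add_add_boxPlus hx hy]

theorem entropy_varConv_add_checkConv {a b : Density} (ha : IsSym a) (hb : IsSym b) :
    entropy (varConv a b) + entropy (checkConv a b) = entropy a + entropy b := by
  have h := congrArg ENNReal.toReal (lentropy_varConv_add_checkConv ha hb)
  rwa [ENNReal.toReal_add (isSym_varConv ha hb).lentropy_ne_top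
    (isSym_checkConv ha hb).lentropy_ne_top, ENNReal.toReal_add ha.lentropy_ne_top
    hb.lentropy_ne_top, ← entropy_eq_toReal, ← entropy_eq_toReal, ← entropy_eq_toReal,
    ← entropy_eq_toReal] at h

/-! ### Degradation -/

/-- The convex test functions `|α t + β| + |α t - β|` of `t = tanh (x / 2)`. -/
def spread (α β : ℝ) (x : EReal) : ℝ≥0∞ :=
  ENNReal.ofReal (|α * tanhHalf x + β| + |α * tanhHalf x - β|)

theorem measurable_spread (α β : ℝ) : Measurable (spread α β) := by
  have h := measurable_tanhHalf.const_mul α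
  exact ((h.add_const β).abs.add (h.sub_const β).abs).ennreal_ofReal

theorem spread_neg (α β : ℝ) (x : EReal) : spread α β (-x) = spread α β x := by
  rw [spread, spread, tanhHalf_neg, ← abs_neg (α * -tanhHalf x + β),
    ← abs_neg (α * -tanhHalf x - β), add_comm]
  ring_nf

/-- `a` is degraded with respect to `b`. -/
def Degraded (a b : Density) : Prop :=
  ∀ α β, ∫⁻ x, spread α β x ∂(a : Measure EReal) ≤ ∫⁻ x, spread α β x ∂(b : Measure EReal)

theorem Degraded.refl (a : Density) : Degraded a a := fun _ _ => le_rfl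

theorem Degraded.trans {a b c : Density} (h : Degraded a b) (h' : Degraded b c) : Degraded a c :=
  fun α β => (h α β).trans (h' α β)

/-- The triangle inequality bounds each test function below by `2 |β|`, its value at `t = 0`. -/
theorem degraded_pointMass_zero (c : Density) : Degraded (pointMass 0) c := by
  intro α β
  rw [coe_pointMass, lintegral_dirac]
  calc spread α β 0 = ∫⁻ _, spread α β 0 ∂(c : Measure EReal) := by simp
    _ ≤ _ := by
      refine lintegral_mono fun x => ENNReal.ofReal_le_ofReal ?_
      simp only [tanhHalf_zero, mul_zero, zero_add, zero_sub, abs_neg]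
      have h1 := abs_sub (α * tanhHalf x + β) (α * tanhHalf x - β)
      have h2 : α * tanhHalf x + β - (α * tanhHalf x - β) = 2 * β := by ring
      rw [h2, abs_mul, abs_two] at h1
      linarith

/-- For fixed `x` the test functions are closed under the check rule, which makes `checkConv`
monotone without any symmetry. -/
theorem spread_boxPlus (α β : ℝ) (x y : EReal) :
    spread α β (boxPlus x y) = spread (α * tanhHalf x) β y := by
  simp only [spread, tanhHalf_boxPlus, mul_assoc]

/-- The test functions are closed under the variable rule too: the parity weight clears the
denominator in the addition formula for tanh, leaving absolute values of affine functions of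
`tanhHalf y`. -/
theorem bitProb_mul_spread_add (α β : ℝ) (x y : EReal) :
    bitProb (boxPlus x y) * spread α β (x + y) + bitProb (-boxPlus x y) * spread α β (x + -y)
      = 2⁻¹ * (spread (α + β * tanhHalf x) (α * tanhHalf x + β) y
        + spread (α - β * tanhHalf x) (α * tanhHalf x - β) y) := by
  have key : ∀ y, bitProb (boxPlus x y) * spread α β (x + y)
      = ENNReal.ofReal ((|(α + β * tanhHalf x) * tanhHalf y + (α * tanhHalf x + β)|
        + |(α - β * tanhHalf x) * tanhHalf y + (α * tanhHalf x - β)|) / 2) := by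
    intro y
    have h := half_one_add_tanhHalf_nonneg (boxPlus x y)
    rw [bitProb, spread, ← ENNReal.ofReal_mul h, mul_add]
    nth_rewrite 1 [← abs_of_nonneg h]
    nth_rewrite 2 [← abs_of_nonneg h]
    rw [← abs_mul, ← abs_mul, tanhHalf_boxPlus]
    have h2 := tanhHalf_add x y
    have e1 : (1 + tanhHalf x * tanhHalf y) / 2 * (α * tanhHalf (x + y) + β)
        = ((α + β * tanhHalf x) * tanhHalf y + (α * tanhHalf x + β)) / 2 := by
      linear_combination α / 2 * h2
    have e2 : (1 + tanhHalf x * tanhHalf y) / 2 * (α * tanhHalf (x + y) - β)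
        = ((α - β * tanhHalf x) * tanhHalf y + (α * tanhHalf x - β)) / 2 := by
      linear_combination α / 2 * h2
    rw [e1, e2, abs_div, abs_div, abs_two, add_div]
  have k1 := key y
  have k2 := key (-y)
  rw [boxPlus_neg_right] at k2
  have h2 : (2⁻¹ : ℝ≥0∞) = ENNReal.ofReal 2⁻¹ := by
    rw [ENNReal.ofReal_inv_of_pos two_pos]; simp
  rw [k1, k2, spread, spread, ← ENNReal.ofReal_add (by positivity) (by positivity),
    ← ENNReal.ofReal_add (by positivity) (by positivity), h2,
    ← ENNReal.ofReal_mul (by positivity), tanhHalf_neg,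
    ← abs_neg ((α + β * tanhHalf x) * -tanhHalf y + (α * tanhHalf x + β)),
    ← abs_neg ((α - β * tanhHalf x) * -tanhHalf y + (α * tanhHalf x - β))]
  ring_nf

theorem Degraded.varConv_right {a b b' : Density} (ha : IsSym a) (hb : IsSym b) (hb' : IsSym b')
    (h : Degraded b b') : Degraded (varConv a b) (varConv a b') := by
  intro α β
  rw [ha.lintegral_varConv_even hb (measurable_spread α β) (spread_neg α β),
    ha.lintegral_varConv_even hb' (measurable_spread α β) (spread_neg α β)]
  refine lintegral_mono fun x => ?_
  simp only [bitProb_mul_spread_add]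
  rw [lintegral_const_mul' _ _ (by simp), lintegral_const_mul' _ _ (by simp),
    lintegral_add_left (measurable_spread _ _), lintegral_add_left (measurable_spread _ _)]
  exact mul_le_mul_right (add_le_add (h _ _) (h _ _)) _

theorem Degraded.checkConv_right {a b b' : Density}
    (h : Degraded b b') : Degraded (checkConv a b) (checkConv a b') := by
  intro α β
  rw [lintegral_checkConv _ _ (measurable_spread α β),
    lintegral_checkConv _ _ (measurable_spread α β)]
  refine lintegral_mono fun x => ?_
  simp only [spread_boxPlus]
  exact h _ _

theorem varConv_comm (a b : Density) : varConv a b = varConv b a :=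
  Std.Commutative.comm a b

theorem checkConv_comm (a b : Density) : checkConv a b = checkConv b a :=
  Std.Commutative.comm a b

theorem varConv_assoc (a b c : Density) : varConv (varConv a b) c = varConv a (varConv b c) :=
  Std.Associative.assoc a b c

theorem Degraded.varConv {a a' b b' : Density} (ha : IsSym a) (ha' : IsSym a') (hb : IsSym b)
    (hb' : IsSym b') (h : Degraded a a') (h' : Degraded b b') :
    Degraded (varConv a b) (varConv a' b') := by
  refine (h'.varConv_right ha hb hb').trans ?_
  rw [varConv_comm a, varConv_comm a']
  exact h.varConv_right hb' ha ha'

theorem Degraded.checkConv {a a' b b' : Density} (h : Degraded a a') (h' : Degraded b b') :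
    Degraded (checkConv a b) (checkConv a' b') := by
  refine h'.checkConv_right.trans ?_
  rw [checkConv_comm a, checkConv_comm a']
  exact h.checkConv_right

section folds

variable {ι : Type*} [DecidableEq ι]

theorem Degraded.varConvs {s : Finset ι} {c c' : ι → Density} (hc : ∀ i ∈ s, IsSym (c i))
    (hc' : ∀ i ∈ s, IsSym (c' i)) (h : ∀ i ∈ s, Degraded (c i) (c' i)) :
    Degraded (varConvs s c) (varConvs s c') := by
  induction s using Finset.induction_on with
  | empty => exact Degraded.refl _
  | insert i s hi ih =>
    rw [varConvs_insert hi, varConvs_insert hi]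
    simp only [Finset.forall_mem_insert] at hc hc' h
    exact Degraded.varConv hc.1 hc'.1 (isSym_varConvs hc.2) (isSym_varConvs hc'.2) h.1
      (ih hc.2 hc'.2 h.2)

theorem Degraded.checkConvs {s : Finset ι} {c c' : ι → Density}
    (h : ∀ i ∈ s, Degraded (c i) (c' i)) :
    Degraded (checkConvs s c) (checkConvs s c') := by
  induction s using Finset.induction_on with
  | empty => exact Degraded.refl _
  | insert i s hi ih =>
    rw [checkConvs_insert hi, checkConvs_insert hi]
    simp only [Finset.forall_mem_insert] at h
    exact Degraded.checkConv h.1 (ih h.2)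

end folds

/-! ### Moments -/

/-- The `n`-th absolute moment of `tanh (x / 2)`. -/
def moment (n : ℕ) (c : Density) : ℝ≥0∞ :=
  ∫⁻ x, ENNReal.ofReal (|tanhHalf x| ^ n) ∂(c : Measure EReal)

theorem measurable_abs_tanhHalf_pow (n : ℕ) :
    Measurable fun x => ENNReal.ofReal (|tanhHalf x| ^ n) :=
  (measurable_tanhHalf.abs.pow_const n).ennreal_ofReal

theorem moment_checkConv (n : ℕ) (a b : Density) :
    moment n (checkConv a b) = moment n a * moment n b := by
  rw [moment, lintegral_checkConv _ _ (measurable_abs_tanhHalf_pow n), moment, moment,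
    ← lintegral_mul_const _ (measurable_abs_tanhHalf_pow n)]
  refine lintegral_congr fun x => ?_
  rw [← lintegral_const_mul _ (measurable_abs_tanhHalf_pow n)]
  refine lintegral_congr fun y => ?_
  rw [tanhHalf_boxPlus, abs_mul, mul_pow, ENNReal.ofReal_mul (by positivity)]

theorem spread_one (θ : ℝ) (hθ : 0 ≤ θ) (x : EReal) :
    spread 1 θ x = ENNReal.ofReal (2 * max |tanhHalf x| θ) := by
  rw [spread, one_mul]
  congr 1
  rcases abs_cases (tanhHalf x) with h | h <;> rcases max_cases |tanhHalf x| θ with h' | h' <;>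
  rcases abs_cases (tanhHalf x + θ) with h1 | h1 <;>
  rcases abs_cases (tanhHalf x - θ) with h2 | h2 <;> linarith

/-- A convex function is a mixture of the hinges `max u θ`, weighted by its second derivative; for
`u ^ (k + 2)` the weight is `(k + 1) (k + 2) θ ^ k`, and `k + 1` is the leftover constant. -/
theorem intervalIntegral_pow_mul_max (k : ℕ) {u : ℝ} (h0 : 0 ≤ u) (h1 : u ≤ 1) :
    ∫ θ in (0 : ℝ)..1, ((k + 1) * (k + 2) : ℝ) * θ ^ k * max u θ = u ^ (k + 2) + (k + 1) := by
  have hc : Continuous fun θ : ℝ => ((k + 1) * (k + 2) : ℝ) * θ ^ k * max u θ := by fun_prop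
  rw [← intervalIntegral.integral_add_adjacent_intervals (hc.intervalIntegrable 0 u)
    (hc.intervalIntegrable u 1)]
  have e1 : ∫ θ in (0 : ℝ)..u, ((k + 1) * (k + 2) : ℝ) * θ ^ k * max u θ
      = ∫ θ in (0 : ℝ)..u, ((k + 1) * (k + 2) * u : ℝ) * θ ^ k := by
    refine intervalIntegral.integral_congr fun θ hθ => ?_
    rw [Set.uIcc_of_le h0] at hθ
    simp only [max_eq_left hθ.2]
    ring
  have e2 : ∫ θ in u..1, ((k + 1) * (k + 2) : ℝ) * θ ^ k * max u θ
      = ∫ θ in u..1, ((k + 1) * (k + 2) : ℝ) * θ ^ (k + 1) := by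
    refine intervalIntegral.integral_congr fun θ hθ => ?_
    rw [Set.uIcc_of_le h1] at hθ
    simp only [max_eq_right hθ.1]
    ring
  rw [e1, e2, intervalIntegral.integral_const_mul, intervalIntegral.integral_const_mul,
    integral_pow, integral_pow]
  push_cast
  have : (k : ℝ) + 1 ≠ 0 := by positivity
  have : (k : ℝ) + 1 + 1 ≠ 0 := by positivity
  field_simp
  ring

theorem lintegral_pow_mul_spread (k : ℕ) (x : EReal) :
    ∫⁻ θ in Set.Ioc (0 : ℝ) 1, ENNReal.ofReal ((k + 1) * (k + 2) / 2 * θ ^ k) * spread 1 θ x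
      = ENNReal.ofReal (|tanhHalf x| ^ (k + 2)) + (k + 1 : ℕ) := by
  have hc : Continuous fun θ : ℝ => ((k + 1) * (k + 2) : ℝ) * θ ^ k * max |tanhHalf x| θ := by
    fun_prop
  have h := intervalIntegral_pow_mul_max k (abs_nonneg _) (abs_tanhHalf_le x)
  rw [intervalIntegral.integral_of_le zero_le_one] at h
  rw [← ENNReal.ofReal_natCast, ← ENNReal.ofReal_add (by positivity) (by positivity)]
  push_cast
  rw [← h, ofReal_integral_eq_lintegral_ofReal]
  · refine setLIntegral_congr_fun measurableSet_Ioc fun θ hθ => ?_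
    have := hθ.1.le
    rw [spread_one θ hθ.1.le, ← ENNReal.ofReal_mul (by positivity)]
    congr 1
    ring
  · exact (hc.integrableOn_Icc).mono_set Set.Ioc_subset_Icc_self
  · refine (ae_restrict_iff' measurableSet_Ioc).2 (Filter.Eventually.of_forall fun θ hθ => ?_)
    have := hθ.1.le
    simp only [Pi.zero_apply]
    positivity

/-- Up to the finite constant `k + 1`, a moment of order at least two is a nonnegative mixture of
the functions `spread 1 θ`, each of which degradation controls. -/
theorem Degraded.moment_le {a b : Density} (h : Degraded a b) (k : ℕ) :
    moment (k + 2) a ≤ moment (k + 2) b := by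
  have key : ∀ c : Density, moment (k + 2) c + (k + 1 : ℕ)
      = ∫⁻ θ in Set.Ioc (0 : ℝ) 1, ENNReal.ofReal ((k + 1) * (k + 2) / 2 * θ ^ k)
        * ∫⁻ x, spread 1 θ x ∂(c : Measure EReal) := by
    intro c
    have h1 : moment (k + 2) c + (k + 1 : ℕ)
        = ∫⁻ x, (ENNReal.ofReal (|tanhHalf x| ^ (k + 2)) + (k + 1 : ℕ)) ∂(c : Measure EReal) := by
      rw [lintegral_add_right _ measurable_const, moment]
      simp
    have hm : Measurable fun p : EReal × ℝ =>
        ENNReal.ofReal ((k + 1) * (k + 2) / 2 * p.2 ^ k) * spread 1 p.2 p.1 := by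
      have := measurable_tanhHalf
      unfold spread
      fun_prop
    rw [h1]
    simp only [← lintegral_pow_mul_spread]
    rw [lintegral_lintegral_swap hm.aemeasurable]
    refine lintegral_congr fun θ => ?_
    rw [lintegral_const_mul _ (measurable_spread _ _)]
  have h2 : moment (k + 2) a + (k + 1 : ℕ) ≤ moment (k + 2) b + (k + 1 : ℕ) := by
    rw [key, key]
    exact lintegral_mono fun θ => mul_le_mul_right (h _ _) _
  exact (ENNReal.add_le_add_iff_right (ENNReal.natCast_ne_top _)).1 h2

/-! ### The power series of the entropy -/

/-- Regroup as `t (log (1 + t) - log (1 - t)) + log (1 - t ^ 2)` and subtract the two known series: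
`2 / (2 k + 1) - 1 / (k + 1)` is the stated coefficient. -/
theorem hasSum_mul_log_add_mul_log {t : ℝ} (ht : |t| < 1) :
    HasSum (fun k : ℕ => t ^ (2 * k + 2) / ((k + 1) * (2 * k + 1)))
      ((1 + t) * Real.log (1 + t) + (1 - t) * Real.log (1 - t)) := by
  obtain ⟨h1, h2⟩ := abs_lt.1 ht
  have ht2 : |t ^ 2| < 1 := by
    rw [abs_pow]; exact pow_lt_one₀ (abs_nonneg _) ht two_ne_zero
  have hA := Real.hasSum_pow_div_log_of_abs_lt_one ht2
  have hB := (Real.hasSum_log_sub_log_of_abs_lt_one ht).mul_left t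
  have hC := hB.sub hA
  have e : 1 - t ^ 2 = (1 + t) * (1 - t) := by ring
  rw [e, Real.log_mul (by linarith) (by linarith)] at hC
  have e2 : t * (Real.log (1 + t) - Real.log (1 - t)) - -(Real.log (1 + t) + Real.log (1 - t))
      = (1 + t) * Real.log (1 + t) + (1 - t) * Real.log (1 - t) := by ring
  rw [e2] at hC
  refine hC.congr_fun fun k => ?_
  have : (k : ℝ) + 1 ≠ 0 := by positivity
  have : 2 * (k : ℝ) + 1 ≠ 0 := by positivity
  field_simp
  ring

/-- The coefficients of the power series of `1 - signEntropy`. -/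
def entropyCoeff (k : ℕ) : ℝ := 1 / ((k + 1) * (2 * k + 1)) / (2 * Real.log 2)

theorem entropyCoeff_nonneg (k : ℕ) : 0 ≤ entropyCoeff k := by
  have := Real.log_nonneg one_le_two
  unfold entropyCoeff
  positivity

theorem signEntropy_eq {t : ℝ} (ht : |t| < 1) :
    1 - signEntropy t = ((1 + t) * Real.log (1 + t) + (1 - t) * Real.log (1 - t))
      / (2 * Real.log 2) := by
  obtain ⟨h1, h2⟩ := abs_lt.1 ht
  have hl := Real.log_pos one_lt_two
  have e : 1 - (1 + t) / 2 = (1 - t) / 2 := by ring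
  rw [signEntropy, Real.binEntropy_eq_negMulLog_add_negMulLog_one_sub, e, Real.negMulLog,
    Real.negMulLog, Real.log_div (by linarith) two_ne_zero,
    Real.log_div (by linarith) two_ne_zero]
  field_simp
  ring

theorem continuous_signEntropy : Continuous signEntropy := by
  unfold signEntropy
  fun_prop

theorem summable_entropyCoeff : Summable entropyCoeff := by
  have h : Summable fun k : ℕ => (1 : ℝ) / ((k + 1 : ℕ) : ℝ) ^ 2 :=
    (summable_nat_add_iff 1).2 (Real.summable_one_div_nat_pow.2 one_lt_two)
  refine Summable.div_const (Summable.of_nonneg_of_le (fun k => by positivity) (fun k => ?_) h) _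
  push_cast
  apply one_div_le_one_div_of_le (by positivity)
  nlinarith [(Nat.cast_nonneg k : (0 : ℝ) ≤ k)]

/-- The endpoints matter, being the values of `tanhHalf` at infinity. Summable coefficients give
uniform convergence on the closed interval, so the identity extends there by continuity. -/
theorem hasSum_entropyCoeff {t : ℝ} (ht : |t| ≤ 1) :
    HasSum (fun k => entropyCoeff k * t ^ (2 * k + 2)) (1 - signEntropy t) := by
  have hbd : ∀ (k : ℕ) (s : ℝ), s ∈ Set.Icc (-1 : ℝ) 1 →
      ‖entropyCoeff k * s ^ (2 * k + 2)‖ ≤ entropyCoeff k := by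
    intro k s hs
    rw [norm_mul, Real.norm_of_nonneg (entropyCoeff_nonneg k), norm_pow, Real.norm_eq_abs]
    exact mul_le_of_le_one_right (entropyCoeff_nonneg k)
      (pow_le_one₀ (abs_nonneg _) (abs_le.2 hs))
  have hcont : ContinuousOn (fun s : ℝ => ∑' k, entropyCoeff k * s ^ (2 * k + 2))
      (Set.Icc (-1) 1) :=
    continuousOn_tsum (fun k => by fun_prop) summable_entropyCoeff hbd
  have heq : Set.EqOn (fun s : ℝ => ∑' k, entropyCoeff k * s ^ (2 * k + 2))
      (fun s => 1 - signEntropy s) (Set.Ioo (-1) 1) := by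
    intro s hs
    have hs' : |s| < 1 := abs_lt.2 hs
    have h := (hasSum_mul_log_add_mul_log hs').div_const (2 * Real.log 2)
    rw [← signEntropy_eq hs'] at h
    simp only
    rw [← h.tsum_eq]
    refine tsum_congr fun k => ?_
    rw [entropyCoeff]
    ring
  have hext := heq.of_subset_closure hcont
    (continuous_const.sub continuous_signEntropy).continuousOn Set.Ioo_subset_Icc_self
    (by rw [closure_Ioo (by norm_num)])
  have hmem : t ∈ Set.Icc (-1 : ℝ) 1 := abs_le.1 ht
  have hsum : Summable fun k => entropyCoeff k * t ^ (2 * k + 2) :=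
    Summable.of_norm_bounded summable_entropyCoeff fun k => hbd k t hmem
  have h := hext hmem
  simp only at h
  rw [← h]
  exact hsum.hasSum

/-- The information `1 - H(c)` as a combination of moments. -/
def momentSum (c : Density) : ℝ≥0∞ :=
  ∑' k : ℕ, ENNReal.ofReal (entropyCoeff k) * moment (2 * k + 2) c

theorem IsSym.lentropy_add_momentSum {c : Density} (hc : IsSym c) :
    lentropy c + momentSum c = 1 := by
  have h1 : momentSum c = ∫⁻ x, ∑' k : ℕ, ENNReal.ofReal (entropyCoeff k)
      * ENNReal.ofReal (|tanhHalf x| ^ (2 * k + 2)) ∂(c : Measure EReal) := by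
    rw [lintegral_tsum fun k => ((measurable_abs_tanhHalf_pow _).const_mul _).aemeasurable]
    refine tsum_congr fun k => ?_
    rw [lintegral_const_mul _ (measurable_abs_tanhHalf_pow _), moment]
  have hm : Measurable fun x => ENNReal.ofReal (signEntropy (tanhHalf x)) :=
    (measurable_signEntropy.comp measurable_tanhHalf).ennreal_ofReal
  rw [h1, hc.lentropy_eq, ← lintegral_add_left hm]
  calc _ = ∫⁻ _, 1 ∂(c : Measure EReal) := by
        refine lintegral_congr fun x => ?_
        have hs := hasSum_entropyCoeff (abs_tanhHalf_le x)
        have e : ∀ k : ℕ, ENNReal.ofReal (entropyCoeff k)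
            * ENNReal.ofReal (|tanhHalf x| ^ (2 * k + 2))
            = ENNReal.ofReal (entropyCoeff k * tanhHalf x ^ (2 * k + 2)) := by
          intro k
          rw [← ENNReal.ofReal_mul (entropyCoeff_nonneg k),
            Even.pow_abs (Even.add (even_two_mul k) even_two)]
        have hnn : ∀ k : ℕ, 0 ≤ entropyCoeff k * tanhHalf x ^ (2 * k + 2) := fun k =>
          mul_nonneg (entropyCoeff_nonneg k) (Even.pow_nonneg (Even.add (even_two_mul k) even_two) _)
        simp only [e]
        rw [← ENNReal.ofReal_tsum_of_nonneg hnn hs.summable, hs.tsum_eq,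
          ← ENNReal.ofReal_add (signEntropy_nonneg (abs_tanhHalf_le x))
          (sub_nonneg.2 (signEntropy_le_one _))]
        simp
    _ = 1 := by simp

theorem IsSym.entropy_eq {c : Density} (hc : IsSym c) :
    entropy c = 1 - (momentSum c).toReal := by
  have h := hc.lentropy_add_momentSum
  have h2 := congrArg ENNReal.toReal h
  rw [ENNReal.toReal_add hc.lentropy_ne_top
    (ne_top_of_le_ne_top ENNReal.one_ne_top (h ▸ le_add_self)), ENNReal.toReal_one] at h2
  rw [entropy_eq_toReal]
  linarith

theorem IsSym.momentSum_ne_top {c : Density} (hc : IsSym c) : momentSum c ≠ ⊤ :=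
  ne_top_of_le_ne_top ENNReal.one_ne_top (hc.lentropy_add_momentSum ▸ le_add_self)

/-! ### Supermodularity of the entropy along degradation. -/

theorem momentSum_checkConv_supermodular {a a' b b' : Density} (h : Degraded a a')
    (h' : Degraded b b') :
    momentSum (checkConv a' b) + momentSum (checkConv a b')
      ≤ momentSum (checkConv a b) + momentSum (checkConv a' b') := by
  simp only [momentSum, ← ENNReal.tsum_add, ← mul_add, moment_checkConv]
  refine ENNReal.tsum_le_tsum fun k => mul_le_mul_right ?_ _
  -- Moments multiply, so with increments `d` and `e` the two sides differ by `d * e`.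
  obtain ⟨d, hd⟩ := exists_add_of_le (h.moment_le (2 * k))
  obtain ⟨e, he⟩ := exists_add_of_le (h'.moment_le (2 * k))
  rw [hd, he]
  refine le_trans (le_add_right le_rfl : _ ≤ _ + d * e) (le_of_eq ?_)
  ring

/-- Duality replaces each term by a marginal contribution plus `momentSum` of the check convolution;
the marginal contributions agree on both sides. -/
theorem entropy_varConv_supermodular {a a' b b' : Density} (ha : IsSym a) (ha' : IsSym a')
    (hb : IsSym b) (hb' : IsSym b') (h : Degraded a a') (h' : Degraded b b') :
    entropy (varConv a' b) + entropy (varConv a b')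
      ≤ entropy (varConv a b) + entropy (varConv a' b') := by
  have h1 := entropy_varConv_add_checkConv ha hb
  have h2 := entropy_varConv_add_checkConv ha hb'
  have h3 := entropy_varConv_add_checkConv ha' hb
  have h4 := entropy_varConv_add_checkConv ha' hb'
  have s1 := isSym_checkConv ha hb
  have s2 := isSym_checkConv ha hb'
  have s3 := isSym_checkConv ha' hb
  have s4 := isSym_checkConv ha' hb'
  rw [s1.entropy_eq] at h1
  rw [s2.entropy_eq] at h2
  rw [s3.entropy_eq] at h3
  rw [s4.entropy_eq] at h4
  have h5 := ENNReal.toReal_mono (ENNReal.add_ne_top.2 ⟨s1.momentSum_ne_top, s4.momentSum_ne_top⟩)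
    (momentSum_checkConv_supermodular h h')
  rw [ENNReal.toReal_add s3.momentSum_ne_top s2.momentSum_ne_top,
    ENNReal.toReal_add s1.momentSum_ne_top s4.momentSum_ne_top] at h5
  linarith

/-! ### The Bethe entropy as a function of one message. -/

theorem exists_sum_eq_add {ι A : Type*} [DecidableEq ι] (s : Finset ι) {e : ι} (he : e ∈ s)
    (f : A → ι → ℝ) (h : ∀ a a', ∀ x ≠ e, f a x = f a' x) :
    ∃ R, ∀ a, ∑ x ∈ s, f a x = R + f a e := by
  rcases isEmpty_or_nonempty A with hA | ⟨⟨a₀⟩⟩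
  · exact ⟨0, fun a => hA.elim a⟩
  · refine ⟨∑ x ∈ s.erase e, f a₀ x, fun a => ?_⟩
    rw [← Finset.sum_erase_add _ _ he,
      Finset.sum_congr rfl fun x hx => h a a₀ x (Finset.ne_of_mem_erase hx)]

namespace Messages

variable {V C : Type*} [DecidableEq V] [DecidableEq C]

/-- Replace the message from `i` to `α`. -/
def setCheck (m : Messages V C) (i : V) (α : C) (a : Density) : Messages V C :=
  { m with toCheck := Function.update m.toCheck i <| Function.update (m.toCheck i) α a }

/-- Replace the message from `α` to `i`. -/
def setVar (m : Messages V C) (α : C) (i : V) (b : Density) : Messages V C :=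
  { m with toVar := Function.update m.toVar α <| Function.update (m.toVar α) i b }

variable (m : Messages V C)

@[simp] theorem setCheck_toVar (i : V) (α : C) (a : Density) :
    (m.setCheck i α a).toVar = m.toVar := rfl

@[simp] theorem setVar_toCheck (α : C) (i : V) (b : Density) :
    (m.setVar α i b).toCheck = m.toCheck := rfl

@[simp] theorem setCheck_toCheck_self (i : V) (α : C) (a : Density) :
    (m.setCheck i α a).toCheck i α = a := by simp [setCheck]

@[simp] theorem setVar_toVar_self (α : C) (i : V) (b : Density) :
    (m.setVar α i b).toVar α i = b := by simp [setVar]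

theorem setCheck_toCheck_of_ne {i j : V} {α β : C} (a : Density) (h : (j, β) ≠ (i, α)) :
    (m.setCheck i α a).toCheck j β = m.toCheck j β := by
  simp only [setCheck, Function.update_apply]
  split_ifs with h1
  · subst h1
    rw [Function.update_of_ne]
    rintro rfl
    exact h rfl
  · rfl

theorem setVar_toVar_of_ne {i j : V} {α β : C} (b : Density) (h : (β, j) ≠ (α, i)) :
    (m.setVar α i b).toVar β j = m.toVar β j := by
  simp only [setVar, Function.update_apply]
  split_ifs with h1
  · subst h1
    rw [Function.update_of_ne]
    rintro rfl
    exact h rfl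
  · rfl

@[simp] theorem setCheck_eq_self (i : V) (α : C) : m.setCheck i α (m.toCheck i α) = m := by
  simp [setCheck]

@[simp] theorem setVar_eq_self (α : C) (i : V) : m.setVar α i (m.toVar α i) = m := by
  simp [setVar]

end Messages

namespace FactorGraph

variable {V C : Type*} [Fintype V] [DecidableEq V] [Fintype C] [DecidableEq C]
  (G : FactorGraph V C) (c : V → Density)

@[simp] theorem mem_varNbr {i : V} {α : C} : α ∈ G.varNbr i ↔ (i, α) ∈ G.edges := by
  simp [varNbr]

@[simp] theorem mem_checkNbr {i : V} {α : C} : i ∈ G.checkNbr α ↔ (i, α) ∈ G.edges := by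
  simp [checkNbr]

/-- The recomputed message from `i` to `α`. -/
def varUpdate (m : Messages V C) (i : V) (α : C) : Density :=
  varConv (c i) (varConvs ((G.varNbr i).erase α) fun β => m.toVar β i)

/-- The recomputed message from `α` to `i`. -/
def checkUpdate (m : Messages V C) (α : C) (i : V) : Density :=
  checkConvs ((G.checkNbr α).erase i) fun j => m.toCheck j α

/-- The Bethe entropy: the potential functional without the factor `-1 / N`. -/
def bethe (m : Messages V C) : ℝ :=
  ∑ i, entropy (varConv (c i) (varConvs (G.varNbr i) fun α => m.toVar α i))
    + ∑ α, ∑ i ∈ G.checkNbr α, entropy (m.toCheck i α)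
    - ∑ α, entropy (checkConvs (G.checkNbr α) fun i => m.toCheck i α)
    - ∑ e ∈ G.edges, entropy (varConv (m.toCheck e.1 e.2) (m.toVar e.2 e.1))

theorem potential_eq (m : Messages V C) :
    G.potential c m = -(1 / (Fintype.card V : ℝ)) * G.bethe c m := rfl

/-- All densities are symmetric and recomputing a message can only improve it. -/
structure IsImproving (m : Messages V C) : Prop where
  isSym_channel : ∀ i, IsSym (c i)
  isSym_toCheck : ∀ {i α}, (i, α) ∈ G.edges → IsSym (m.toCheck i α)
  isSym_toVar : ∀ {i α}, (i, α) ∈ G.edges → IsSym (m.toVar α i)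
  degraded_toCheck : ∀ {i α}, (i, α) ∈ G.edges → Degraded (m.toCheck i α) (G.varUpdate c m i α)
  degraded_toVar : ∀ {i α}, (i, α) ∈ G.edges → Degraded (m.toVar α i) (G.checkUpdate m α i)

variable {G c}

namespace IsImproving

variable {m m' : Messages V C}

theorem isSym_varUpdate (h : G.IsImproving c m) (i : V) (α : C) : IsSym (G.varUpdate c m i α) :=
  isSym_varConv (h.isSym_channel i) (isSym_varConvs fun β hβ =>
    h.isSym_toVar (by simpa using (Finset.mem_of_mem_erase hβ)))

theorem isSym_checkUpdate (h : G.IsImproving c m) (α : C) (i : V) :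
    IsSym (G.checkUpdate m α i) :=
  isSym_checkConvs fun j hj => h.isSym_toCheck (by simpa using (Finset.mem_of_mem_erase hj))

/-- Recomputing some of the messages keeps the property. -/
theorem of_update (h : G.IsImproving c m)
    (h1 : ∀ i α, (i, α) ∈ G.edges →
      m'.toCheck i α = m.toCheck i α ∨ m'.toCheck i α = G.varUpdate c m i α)
    (h2 : ∀ i α, (i, α) ∈ G.edges →
      m'.toVar α i = m.toVar α i ∨ m'.toVar α i = G.checkUpdate m α i) :
    G.IsImproving c m' := by
  have s1 : ∀ {i α}, (i, α) ∈ G.edges → IsSym (m'.toCheck i α) := by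
    intro i α he
    rcases h1 i α he with e | e <;> rw [e]
    exacts [h.isSym_toCheck he, h.isSym_varUpdate i α]
  have s2 : ∀ {i α}, (i, α) ∈ G.edges → IsSym (m'.toVar α i) := by
    intro i α he
    rcases h2 i α he with e | e <;> rw [e]
    exacts [h.isSym_toVar he, h.isSym_checkUpdate α i]
  have d1 : ∀ {i α}, (i, α) ∈ G.edges → Degraded (m.toCheck i α) (m'.toCheck i α) := by
    intro i α he
    rcases h1 i α he with e | e <;> rw [e]
    exacts [Degraded.refl _, h.degraded_toCheck he]
  have d2 : ∀ {i α}, (i, α) ∈ G.edges → Degraded (m.toVar α i) (m'.toVar α i) := by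
    intro i α he
    rcases h2 i α he with e | e <;> rw [e]
    exacts [Degraded.refl _, h.degraded_toVar he]
  -- The new messages dominate the old ones, and convolutions are monotone, so the recomputations
  -- move up as well and stay ahead of the messages.
  have u1 : ∀ i α, Degraded (G.varUpdate c m i α) (G.varUpdate c m' i α) := by
    intro i α
    have hm : ∀ β ∈ (G.varNbr i).erase α, (i, β) ∈ G.edges := fun β hβ => by
      simpa using (Finset.mem_of_mem_erase hβ)
    exact (Degraded.refl _).varConv (h.isSym_channel i) (h.isSym_channel i)
      (isSym_varConvs fun β hβ => h.isSym_toVar (hm β hβ))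
      (isSym_varConvs fun β hβ => s2 (hm β hβ))
      (Degraded.varConvs (fun β hβ => h.isSym_toVar (hm β hβ)) (fun β hβ => s2 (hm β hβ))
        fun β hβ => d2 (hm β hβ))
  have u2 : ∀ α i, Degraded (G.checkUpdate m α i) (G.checkUpdate m' α i) := by
    intro α i
    exact Degraded.checkConvs fun j hj => d1 (by simpa using (Finset.mem_of_mem_erase hj))
  refine ⟨h.isSym_channel, s1, s2, fun {i α} he => ?_, fun {i α} he => ?_⟩
  · rcases h1 i α he with e | e <;> rw [e]
    exacts [(h.degraded_toCheck he).trans (u1 i α), u1 i α]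
  · rcases h2 i α he with e | e <;> rw [e]
    exacts [(h.degraded_toVar he).trans (u2 α i), u2 α i]

theorem setCheck (h : G.IsImproving c m) (i : V) (α : C) :
    G.IsImproving c (m.setCheck i α (G.varUpdate c m i α)) := by
  refine h.of_update (fun j β _ => ?_) fun j β _ => Or.inl rfl
  by_cases he : (j, β) = (i, α)
  · obtain ⟨rfl, rfl⟩ := Prod.mk.inj he
    simp
  · rw [m.setCheck_toCheck_of_ne _ he]
    exact Or.inl rfl

theorem setVar (h : G.IsImproving c m) (α : C) (i : V) :
    G.IsImproving c (m.setVar α i (G.checkUpdate m α i)) := by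
  refine h.of_update (fun j β _ => Or.inl rfl) fun j β _ => ?_
  by_cases he : (β, j) = (α, i)
  · obtain ⟨rfl, rfl⟩ := Prod.mk.inj he
    simp
  · rw [m.setVar_toVar_of_ne _ he]
    exact Or.inl rfl

theorem pass (h : G.IsImproving c m) (e : G.DirectedEdge) : G.IsImproving c (G.pass c m e) := by
  cases e with
  | toCheck i α _ => exact h.setCheck i α
  | toVar α i _ => exact h.setVar α i

theorem initial (hc : ∀ i, IsSym (c i)) :
    G.IsImproving c ⟨fun _ _ => pointMass 0, fun _ _ => pointMass 0⟩ :=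
  ⟨hc, fun _ => isSym_pointMass_zero, fun _ => isSym_pointMass_zero,
    fun _ => degraded_pointMass_zero _, fun _ => degraded_pointMass_zero _⟩

theorem messages (hc : ∀ i, IsSym (c i)) (S : List G.DirectedEdge) (t : ℕ) :
    G.IsImproving c (G.messages c S t) := by
  have key : ∀ (l : List G.DirectedEdge) (m : Messages V C), G.IsImproving c m →
      G.IsImproving c (l.foldl (G.pass c) m) := by
    intro l
    induction l with
    | nil => exact fun m h => h
    | cons e l ih => exact fun m h => ih _ (h.pass e)
  exact key _ _ (initial hc)

end IsImproving

theorem exists_bethe_setCheck (m : Messages V C) {i : V} {α : C} (he : (i, α) ∈ G.edges) :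
    ∃ R, ∀ a, G.bethe c (m.setCheck i α a) = R + entropy a
      - entropy (checkConv a (G.checkUpdate m α i)) - entropy (varConv a (m.toVar α i)) := by
  have hi : i ∈ G.checkNbr α := by simpa using he
  have hne : ∀ {j : V} {β : C}, β ≠ α → (j, β) ≠ (i, α) := fun h h' => h (Prod.mk.inj h').2
  obtain ⟨R1, h1⟩ := exists_sum_eq_add Finset.univ (Finset.mem_univ α)
    (fun (a : Density) β => ∑ j ∈ G.checkNbr β, entropy ((m.setCheck i α a).toCheck j β))
    (fun a a' β hβ => Finset.sum_congr rfl fun j _ => by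
      rw [m.setCheck_toCheck_of_ne _ (hne hβ), m.setCheck_toCheck_of_ne _ (hne hβ)])
  obtain ⟨R2, h2⟩ := exists_sum_eq_add (G.checkNbr α) hi
    (fun (a : Density) j => entropy ((m.setCheck i α a).toCheck j α))
    (fun a a' j hj => by
      have : (j, α) ≠ (i, α) := fun h => hj (Prod.mk.inj h).1
      rw [m.setCheck_toCheck_of_ne _ this, m.setCheck_toCheck_of_ne _ this])
  obtain ⟨R3, h3⟩ := exists_sum_eq_add Finset.univ (Finset.mem_univ α)
    (fun (a : Density) β =>
      entropy (checkConvs (G.checkNbr β) fun j => (m.setCheck i α a).toCheck j β))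
    (fun a a' β hβ => by
      rw [checkConvs_congr fun j _ => ?_]
      rw [m.setCheck_toCheck_of_ne _ (hne hβ), m.setCheck_toCheck_of_ne _ (hne hβ)])
  obtain ⟨R4, h4⟩ := exists_sum_eq_add G.edges he
    (fun (a : Density) e => entropy (varConv ((m.setCheck i α a).toCheck e.1 e.2)
      (m.toVar e.2 e.1)))
    (fun a a' e hne => by
      rw [m.setCheck_toCheck_of_ne _ hne, m.setCheck_toCheck_of_ne _ hne])
  refine ⟨∑ i, entropy (varConv (c i) (varConvs (G.varNbr i) fun α => m.toVar α i))
    + R1 + R2 - R3 - R4, fun a => ?_⟩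
  simp only at h1 h2 h3 h4
  have e3 : checkConvs (G.checkNbr α) (fun j => (m.setCheck i α a).toCheck j α)
      = checkConv a (G.checkUpdate m α i) := by
    rw [checkConvs_erase hi, m.setCheck_toCheck_self, checkUpdate]
    congr 1
    refine checkConvs_congr fun j hj => m.setCheck_toCheck_of_ne _ ?_
    exact fun h => Finset.ne_of_mem_erase hj (Prod.mk.inj h).1
  rw [bethe, h1, h2, h3, Messages.setCheck_toVar, h4, e3, m.setCheck_toCheck_self]
  ring

theorem exists_bethe_setVar (m : Messages V C) {i : V} {α : C} (he : (i, α) ∈ G.edges) :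
    ∃ R, ∀ b, G.bethe c (m.setVar α i b) = R + entropy (varConv b (G.varUpdate c m i α))
      - entropy (varConv b (m.toCheck i α)) := by
  have hα : α ∈ G.varNbr i := by simpa using he
  obtain ⟨R1, h1⟩ := exists_sum_eq_add Finset.univ (Finset.mem_univ i)
    (fun (b : Density) j => entropy (varConv (c j)
      (varConvs (G.varNbr j) fun β => (m.setVar α i b).toVar β j)))
    (fun a a' j hj => by
      have : ∀ β, (β, j) ≠ (α, i) := fun β h => hj (Prod.mk.inj h).2
      rw [varConvs_congr fun β _ => ?_]
      rw [m.setVar_toVar_of_ne _ (this β), m.setVar_toVar_of_ne _ (this β)])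
  obtain ⟨R4, h4⟩ := exists_sum_eq_add G.edges he
    (fun (b : Density) e => entropy (varConv (m.toCheck e.1 e.2)
      ((m.setVar α i b).toVar e.2 e.1)))
    (fun a a' e hne => by
      have : (e.2, e.1) ≠ (α, i) := fun h =>
        hne (Prod.ext (Prod.mk.inj h).2 (Prod.mk.inj h).1)
      rw [m.setVar_toVar_of_ne _ this, m.setVar_toVar_of_ne _ this])
  refine ⟨R1 + ∑ α, ∑ i ∈ G.checkNbr α, entropy (m.toCheck i α)
    - ∑ α, entropy (checkConvs (G.checkNbr α) fun i => m.toCheck i α) - R4, fun b => ?_⟩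
  simp only at h1 h4
  have e1 : varConv (c i) (varConvs (G.varNbr i) fun β => (m.setVar α i b).toVar β i)
      = varConv b (G.varUpdate c m i α) := by
    rw [varConvs_erase hα, m.setVar_toVar_self, varUpdate, ← varConv_assoc, varConv_comm _ b,
      varConv_assoc]
    congr 2
    refine varConvs_congr fun β hβ => m.setVar_toVar_of_ne _ ?_
    exact fun h => Finset.ne_of_mem_erase hβ (Prod.mk.inj h).1
  rw [bethe, h1, Messages.setVar_toCheck, h4, e1, m.setVar_toVar_self, varConv_comm b (m.toCheck i α)]
  ring

/-- Let `A` be the recomputed reverse message and `b` the current one. Duality turns `H(a) - H(a ⊠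
A)` into `H(a ⊛ A) - H(A)`, so `a` enters through `H(a ⊛ A) - H(a ⊛ b)`. Improving `a` raises this
difference by supermodularity, as `b` is degraded with respect to `A`. -/
theorem IsImproving.bethe_le_setCheck {m : Messages V C} (h : G.IsImproving c m) {i : V} {α : C}
    (he : (i, α) ∈ G.edges) :
    G.bethe c m ≤ G.bethe c (m.setCheck i α (G.varUpdate c m i α)) := by
  obtain ⟨R, hR⟩ := exists_bethe_setCheck (c := c) m he
  have h0 := hR (m.toCheck i α)
  rw [m.setCheck_eq_self] at h0
  have h1 := hR (G.varUpdate c m i α)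
  have sA := h.isSym_checkUpdate α i
  have d0 := entropy_varConv_add_checkConv (h.isSym_toCheck he) sA
  have d1 := entropy_varConv_add_checkConv (h.isSym_varUpdate i α) sA
  have hs := entropy_varConv_supermodular (h.isSym_toCheck he) (h.isSym_varUpdate i α)
    (h.isSym_toVar he) sA (h.degraded_toCheck he) (h.degraded_toVar he)
  linarith

/-- No duality is needed here: the message already enters as a difference of two variable-node
entropies. -/
theorem IsImproving.bethe_le_setVar {m : Messages V C} (h : G.IsImproving c m) {i : V} {α : C}
    (he : (i, α) ∈ G.edges) :
    G.bethe c m ≤ G.bethe c (m.setVar α i (G.checkUpdate m α i)) := by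
  obtain ⟨R, hR⟩ := exists_bethe_setVar (c := c) m he
  have h0 := hR (m.toVar α i)
  rw [m.setVar_eq_self] at h0
  have h1 := hR (G.checkUpdate m α i)
  have hs := entropy_varConv_supermodular (h.isSym_toVar he) (h.isSym_checkUpdate α i)
    (h.isSym_toCheck he) (h.isSym_varUpdate i α) (h.degraded_toVar he) (h.degraded_toCheck he)
  linarith

end FactorGraph

/-! ### Longest paths and pendant checks in a forest. -/

theorem exists_isPath_length_maximal {U : Type*} [Fintype U] {Γ : SimpleGraph U} {a b : U}
    (h : Γ.Adj a b) : ∃ (u v : U) (p : Γ.Walk u v), p.IsPath ∧ 1 ≤ p.length ∧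
      ∀ (u' v' : U) (q : Γ.Walk u' v'), q.IsPath → q.length ≤ p.length := by
  classical
  let P : ℕ → Prop := fun n => ∃ (u v : U) (p : Γ.Walk u v), p.IsPath ∧ p.length = n
  have hb : ∀ {u v : U} (p : Γ.Walk u v), p.IsPath → p.length ≤ Fintype.card U :=
    fun p hp => hp.length_lt.le
  have h1 : P 1 := ⟨a, b, .cons h .nil, by simp [h.ne], rfl⟩
  have hc : 1 ≤ Fintype.card U := Fintype.card_pos_iff.2 ⟨a⟩
  obtain ⟨u, v, p, hp, hl⟩ : P (Nat.findGreatest P (Fintype.card U)) :=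
    Nat.findGreatest_spec hc h1
  refine ⟨u, v, p, hp, hl ▸ Nat.le_findGreatest hc h1, fun u' v' q hq => ?_⟩
  rw [hl]
  exact Nat.le_findGreatest (hb q hq) ⟨u', v', q, hq, rfl⟩

/-- A neighbour of the start lying off the path would lengthen it; one lying on the path and
different from the second vertex would close a cycle. -/
theorem eq_snd_of_adj_of_length_maximal {U : Type*} {Γ : SimpleGraph U}
    (hΓ : Γ.IsAcyclic) {u v w : U} {p : Γ.Walk u v} (hp : p.IsPath)
    (hmax : ∀ (u' v' : U) (q : Γ.Walk u' v'), q.IsPath → q.length ≤ p.length)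
    (hw : Γ.Adj u w) : w = p.snd := by
  refine hΓ.eq_snd_of_adj_start hp hw ?_
  by_contra hs
  have := hmax _ _ (SimpleGraph.Walk.cons hw.symm p) (hp.cons hs)
  simp at this

namespace FactorGraph

variable {V C : Type*}

@[simp] theorem toSimpleGraph_adj_inl_inr (G : FactorGraph V C) (i : V) (α : C) :
    G.toSimpleGraph.Adj (.inl i) (.inr α) ↔ (i, α) ∈ G.edges := Iff.rfl

@[simp] theorem toSimpleGraph_adj_inr_inl (G : FactorGraph V C) (i : V) (α : C) :
    G.toSimpleGraph.Adj (.inr α) (.inl i) ↔ (i, α) ∈ G.edges := Iff.rfl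

/-- All neighbours of the check node `α` other than `i` are leaves. -/
structure IsPendant (G : FactorGraph V C) (α : C) (i : V) : Prop where
  mem : (i, α) ∈ G.edges
  eq_of_mem : ∀ {j β}, (j, α) ∈ G.edges → j ≠ i → (j, β) ∈ G.edges → β = α

/-- Look at the start of a longest path. If it is a check, that check has a single neighbour. If it
is a variable, the adjacent check works, with the next variable on the path as the exception. -/
theorem IsCycleFree.exists_isPendant [Fintype V] [Fintype C] {G : FactorGraph V C}
    (hG : G.IsCycleFree) (he : G.edges.Nonempty) : ∃ α i, G.IsPendant α i := by
  obtain ⟨⟨i₀, α₀⟩, he⟩ := he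
  obtain ⟨u, v, p, hp, hl, hmax⟩ := exists_isPath_length_maximal
    ((G.toSimpleGraph_adj_inl_inr i₀ α₀).2 he)
  rcases u with i | α
  · cases p with
    | nil => simp at hl
    | @cons _ w _ hadj q =>
      rcases w with j | α
      · exact hadj.elim
      · have hq := hp.of_cons
        -- Starting from `j` instead of `i` gives a path of the same maximal length, so `j` has no
        -- neighbour but `α`.
        have leaf : ∀ j, (j, α) ∈ G.edges → Sum.inl j ∉ q.support →
            ∀ β, (j, β) ∈ G.edges → β = α := by
          intro j hj hs β hβ
          have h1 := eq_snd_of_adj_of_length_maximal hG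
            (p := SimpleGraph.Walk.cons ((G.toSimpleGraph_adj_inl_inr j α).2 hj) q)
            (hq.cons hs) hmax ((G.toSimpleGraph_adj_inl_inr j β).2 hβ)
          simpa using h1
        cases q with
        | nil =>
          -- The path is a single edge, so every neighbour of `α` is a leaf and `i` may serve as the
          -- exception.
          exact ⟨α, i, hadj, fun {j β} hj _ hβ => leaf j hj (by simp) β hβ⟩
        | @cons _ w _ hadj' q' =>
          rcases w with k | γ
          · refine ⟨α, k, hadj', fun {j β} hj hjk hβ => leaf j hj (fun hs => hjk ?_) β hβ⟩
            have := hG.eq_snd_of_adj_start hq ((G.toSimpleGraph_adj_inr_inl j α).2 hj) hs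
            simpa using this
          · exact hadj'.elim
  · have huniq : ∀ j, (j, α) ∈ G.edges → Sum.inl j = p.snd := fun j hj =>
      eq_snd_of_adj_of_length_maximal hG hp hmax ((G.toSimpleGraph_adj_inr_inl j α).2 hj)
    have hnil : ¬ p.Nil := by
      rw [← SimpleGraph.Walk.length_eq_zero_iff]; omega
    have hadj := p.adj_snd hnil
    rcases hs : p.snd with k | γ
    · rw [hs] at hadj huniq
      exact ⟨α, k, hadj, fun {j β} hj hjk _ => absurd (Sum.inl_injective (huniq j hj)) hjk⟩
    · rw [hs] at hadj
      exact hadj.elim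

/-! ### Removing a pendant check. -/

variable [DecidableEq C]

/-- Remove all edges at the check node `α`. -/
def removeCheck (G : FactorGraph V C) (α : C) : FactorGraph V C :=
  ⟨G.edges.filter fun e => e.2 ≠ α⟩

variable {G : FactorGraph V C}

@[simp] theorem mem_removeCheck {α : C} {e : V × C} :
    e ∈ (G.removeCheck α).edges ↔ e ∈ G.edges ∧ e.2 ≠ α := by
  simp [removeCheck]

theorem IsCycleFree.removeCheck (hG : G.IsCycleFree) (α : C) : (G.removeCheck α).IsCycleFree := by
  refine SimpleGraph.IsAcyclic.anti ?_ hG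
  rintro (i | β) (j | γ) h
  · exact h
  · exact (mem_removeCheck.1 h).1
  · exact (mem_removeCheck.1 h).1
  · exact h

variable [Fintype V] [DecidableEq V] [Fintype C] {c : V → Density} {α : C} {i₀ : V}

theorem varNbr_removeCheck (i : V) : (G.removeCheck α).varNbr i = (G.varNbr i).erase α := by
  ext β; simp [and_comm]

theorem checkNbr_removeCheck_self : (G.removeCheck α).checkNbr α = ∅ := by
  ext β; simp

theorem checkNbr_removeCheck_of_ne {β : C} (h : β ≠ α) :
    (G.removeCheck α).checkNbr β = G.checkNbr β := by
  ext i; simp [h]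

/-- The neighbours of `α` other than `i₀`. -/
def leaves (G : FactorGraph V C) (α : C) (i₀ : V) : Finset V := (G.checkNbr α).erase i₀

theorem mem_leaves {j : V} : j ∈ G.leaves α i₀ ↔ j ≠ i₀ ∧ (j, α) ∈ G.edges := by
  simp [leaves]

theorem notMem_leaves : i₀ ∉ G.leaves α i₀ := by simp [leaves]

theorem IsPendant.insert_leaves (h : G.IsPendant α i₀) :
    insert i₀ (G.leaves α i₀) = G.checkNbr α :=
  Finset.insert_erase (by simpa using h.mem)

theorem IsPendant.varNbr_eq (h : G.IsPendant α i₀) {j : V} (hj : j ∈ G.leaves α i₀) :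
    G.varNbr j = {α} := by
  rw [mem_leaves] at hj
  ext β
  rw [mem_varNbr, Finset.mem_singleton]
  exact ⟨h.eq_of_mem hj.2 hj.1, fun hβ => hβ ▸ hj.2⟩

theorem IsPendant.notMem_varNbr {j : V} (hj : j ∉ G.leaves α i₀) (hj0 : j ≠ i₀) :
    α ∉ G.varNbr j := fun hα => hj (mem_leaves.2 ⟨hj0, by simpa using hα⟩)

theorem IsPendant.notMem_leaves_of_mem (h : G.IsPendant α i₀) {i : V} {β : C} (hβ : β ≠ α)
    (hi : (i, β) ∈ G.edges) : i ∉ G.leaves α i₀ := fun hj =>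
  hβ (h.eq_of_mem (mem_leaves.1 hj).2 (mem_leaves.1 hj).1 hi)

/-- The channel densities after absorbing the check node `α` into the channel of `i₀`. -/
def absorb (G : FactorGraph V C) (c : V → Density) (α : C) (i₀ : V) : V → Density :=
  Function.update c i₀ (varConv (c i₀) (checkConvs (G.leaves α i₀) c))

theorem isSym_absorb (hc : ∀ i, IsSym (c i)) (α : C) (i₀ i : V) :
    IsSym (G.absorb c α i₀ i) := by
  unfold absorb
  by_cases h : i = i₀
  · subst h
    rw [Function.update_self]
    exact isSym_varConv (hc i) (isSym_checkConvs fun j _ => hc j)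
  · rw [Function.update_of_ne h]
    exact hc i

/-- Recompute the messages from the leaves to `α`, then the one from `α` to `i₀`. A leaf has no
other check, so its recomputed message is its channel density; each step preserves improvement and
cannot lower `bethe`. -/
theorem IsPendant.exists_bethe_le (h : G.IsPendant α i₀) {m : Messages V C}
    (hm : G.IsImproving c m) : ∃ m' : Messages V C, G.IsImproving c m' ∧
      G.bethe c m ≤ G.bethe c m' ∧ (∀ j ∈ G.leaves α i₀, m'.toCheck j α = c j) ∧
      m'.toVar α i₀ = checkConvs (G.leaves α i₀) c := by
  have key : ∀ s ⊆ G.leaves α i₀, ∃ m' : Messages V C, G.IsImproving c m' ∧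
      G.bethe c m ≤ G.bethe c m' ∧ ∀ j ∈ s, m'.toCheck j α = c j := by
    intro s
    induction s using Finset.induction_on with
    | empty => exact fun _ => ⟨m, hm, le_rfl, by simp⟩
    | insert j s hj ih =>
      intro hs
      obtain ⟨m', h1, h2, h3⟩ := ih fun k hk => hs (Finset.mem_insert_of_mem hk)
      have hjl := hs (Finset.mem_insert_self j s)
      have he := (mem_leaves.1 hjl).2
      refine ⟨_, h1.setCheck j α, h2.trans (h1.bethe_le_setCheck he), fun k hk => ?_⟩
      rcases Finset.mem_insert.1 hk with rfl | hk
      · rw [Messages.setCheck_toCheck_self, varUpdate, h.varNbr_eq hjl]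
        rw [Finset.erase_singleton]
        exact varConv_pointMass_zero _
      · rw [Messages.setCheck_toCheck_of_ne, h3 k hk]
        intro heq
        exact hj ((Prod.mk.inj heq).1 ▸ hk)
  obtain ⟨m', h1, h2, h3⟩ := key _ subset_rfl
  refine ⟨_, h1.setVar α i₀, h2.trans (h1.bethe_le_setVar h.mem), h3, ?_⟩
  rw [Messages.setVar_toVar_self]
  exact checkConvs_congr h3

/-- The factor that `i₀` loses with its incoming message from `α` is exactly the one its channel
absorbs; a variable with an edge to `β ≠ α` is not a leaf, so no other recomputation is affected. -/
theorem IsPendant.varUpdate_removeCheck (h : G.IsPendant α i₀) {m : Messages V C}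
    (h2 : m.toVar α i₀ = checkConvs (G.leaves α i₀) c) {i : V} {β : C} (hβ : β ≠ α)
    (hi : (i, β) ∈ G.edges) :
    (G.removeCheck α).varUpdate (G.absorb c α i₀) m i β = G.varUpdate c m i β := by
  rw [varUpdate, varUpdate, varNbr_removeCheck]
  by_cases hi0 : i = i₀
  · subst hi0
    have hmem : α ∈ (G.varNbr i).erase β := by simp [hβ.symm, h.mem]
    rw [absorb, Function.update_self, varConvs_erase hmem, h2, varConv_assoc,
      Finset.erase_right_comm]
  · rw [absorb, Function.update_of_ne hi0, Finset.erase_eq_of_notMem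
      (IsPendant.notMem_varNbr (h.notMem_leaves_of_mem hβ hi) hi0)]

theorem IsPendant.isImproving_removeCheck (h : G.IsPendant α i₀) {m : Messages V C}
    (hm : G.IsImproving c m) (h2 : m.toVar α i₀ = checkConvs (G.leaves α i₀) c) :
    (G.removeCheck α).IsImproving (G.absorb c α i₀) m := by
  refine ⟨isSym_absorb hm.isSym_channel α i₀, fun he => hm.isSym_toCheck (mem_removeCheck.1 he).1,
    fun he => hm.isSym_toVar (mem_removeCheck.1 he).1, fun {i β} he => ?_, fun {i β} he => ?_⟩
  · obtain ⟨he1, he2⟩ := mem_removeCheck.1 he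
    rw [h.varUpdate_removeCheck h2 he2 he1]
    exact hm.degraded_toCheck he1
  · obtain ⟨he1, he2⟩ := mem_removeCheck.1 he
    rw [checkUpdate, checkNbr_removeCheck_of_ne he2]
    exact hm.degraded_toVar he1

theorem entropy_pointMass_top : entropy (pointMass ⊤) = 0 := by
  rw [entropy_eq_toReal, lentropy, coe_pointMass, lintegral_dirac]
  simp [surprisal]

/-- The variable terms of the leaves cancel against their edge terms, and their message entropies
against the channel entropies they keep as isolated nodes. With `K` the absorbed density and `a` the
message from `i₀` to `α`, what remains is `H(a) - H(a ⊠ K) - H(a ⊛ K) = -H(K)`. -/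
theorem IsPendant.bethe_eq (h : G.IsPendant α i₀) {m : Messages V C}
    (hm : G.IsImproving c m) (h1 : ∀ j ∈ G.leaves α i₀, m.toCheck j α = c j)
    (h2 : m.toVar α i₀ = checkConvs (G.leaves α i₀) c) :
    G.bethe c m = (G.removeCheck α).bethe (G.absorb c α i₀) m
      - entropy (checkConvs (G.leaves α i₀) c) := by
  have hi0 : i₀ ∉ G.leaves α i₀ := notMem_leaves
  have hd := entropy_varConv_add_checkConv (hm.isSym_toCheck h.mem)
    (isSym_checkConvs (s := G.leaves α i₀) (c := c) fun j _ => hm.isSym_channel j)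
  have e1 : ∑ i, entropy (varConv (c i) (varConvs (G.varNbr i) fun β => m.toVar β i))
      = ∑ i, entropy (varConv (G.absorb c α i₀ i)
          (varConvs ((G.removeCheck α).varNbr i) fun β => m.toVar β i))
        + ∑ j ∈ G.leaves α i₀, (entropy (varConv (c j) (m.toVar α j)) - entropy (c j)) := by
    rw [← sub_eq_iff_eq_add', ← Finset.sum_sub_distrib,
      ← Finset.sum_subset (Finset.subset_univ (G.leaves α i₀))]
    · refine Finset.sum_congr rfl fun j hj => ?_
      have hj0 : j ≠ i₀ := (mem_leaves.1 hj).1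
      rw [varNbr_removeCheck, h.varNbr_eq hj, absorb, Function.update_of_ne hj0]
      have e : varConvs {α} (fun β => m.toVar β j) = m.toVar α j := by
        rw [varConvs, Finset.fold_singleton]
        exact varConv_pointMass_zero _
      have e' : varConvs (({α} : Finset C).erase α) (fun β => m.toVar β j) = pointMass 0 := by
        simp [varConvs]
      rw [e, e', varConv_pointMass_zero]
    · intro j _ hj
      rw [varNbr_removeCheck]
      by_cases hj0 : j = i₀
      · subst hj0
        have hmem : α ∈ G.varNbr j := by simpa using h.mem
        rw [absorb, Function.update_self, varConvs_erase hmem, h2, varConv_assoc, sub_self]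
      · rw [absorb, Function.update_of_ne hj0, Finset.erase_eq_of_notMem
          (IsPendant.notMem_varNbr hj hj0), sub_self]
  have e2 : ∑ β, ∑ i ∈ G.checkNbr β, entropy (m.toCheck i β)
      = ∑ β, ∑ i ∈ (G.removeCheck α).checkNbr β, entropy (m.toCheck i β)
        + (entropy (m.toCheck i₀ α) + ∑ j ∈ G.leaves α i₀, entropy (c j)) := by
    rw [← Finset.sum_erase_add _ _ (Finset.mem_univ α), ← Finset.sum_erase_add _
      (fun β => ∑ i ∈ (G.removeCheck α).checkNbr β, entropy (m.toCheck i β)) (Finset.mem_univ α),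
      checkNbr_removeCheck_self, Finset.sum_empty, add_zero, ← h.insert_leaves,
      Finset.sum_insert hi0]
    congr 1
    · refine Finset.sum_congr rfl fun β hβ => ?_
      rw [checkNbr_removeCheck_of_ne (Finset.ne_of_mem_erase hβ)]
    · congr 1
      exact Finset.sum_congr rfl fun j hj => by rw [h1 j hj]
  have e3 : ∑ β, entropy (checkConvs (G.checkNbr β) fun i => m.toCheck i β)
      = ∑ β, entropy (checkConvs ((G.removeCheck α).checkNbr β) fun i => m.toCheck i β)
        + entropy (checkConv (m.toCheck i₀ α) (checkConvs (G.leaves α i₀) c)) := by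
    -- The check `α` stays as an isolated node; its empty convolution is `Δ_∞`, which has no
    -- entropy.
    have e : entropy (checkConvs ((G.removeCheck α).checkNbr α) fun i => m.toCheck i α) = 0 := by
      rw [checkNbr_removeCheck_self]
      exact entropy_pointMass_top
    rw [← Finset.sum_erase_add _ _ (Finset.mem_univ α), ← Finset.sum_erase_add _
      (fun β => entropy (checkConvs ((G.removeCheck α).checkNbr β) _)) (Finset.mem_univ α),
      e, add_zero, ← h.insert_leaves, checkConvs_insert hi0, checkConvs_congr h1]
    congr 1
    refine Finset.sum_congr rfl fun β hβ => ?_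
    rw [checkNbr_removeCheck_of_ne (Finset.ne_of_mem_erase hβ)]
  have e4 : ∑ e ∈ G.edges, entropy (varConv (m.toCheck e.1 e.2) (m.toVar e.2 e.1))
      = ∑ e ∈ (G.removeCheck α).edges, entropy (varConv (m.toCheck e.1 e.2) (m.toVar e.2 e.1))
        + (entropy (varConv (m.toCheck i₀ α) (checkConvs (G.leaves α i₀) c))
          + ∑ j ∈ G.leaves α i₀, entropy (varConv (c j) (m.toVar α j))) := by
    have e : ∑ e ∈ G.edges with ¬ e.2 ≠ α,
        entropy (varConv (m.toCheck e.1 e.2) (m.toVar e.2 e.1))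
        = ∑ j ∈ G.checkNbr α, entropy (varConv (m.toCheck j α) (m.toVar α j)) := by
      refine (Finset.sum_bij (fun j _ => (j, α)) ?_ ?_ ?_ ?_).symm
      · intro j hj; simpa using hj
      · intro j _ k _ hjk; exact (Prod.mk.inj hjk).1
      · rintro ⟨j, β⟩ hj
        simp only [ne_eq, not_not, Finset.mem_filter] at hj
        obtain ⟨hj, rfl⟩ := hj
        exact ⟨j, by simpa using hj, rfl⟩
      · intro j _; rfl
    rw [← Finset.sum_filter_add_sum_filter_not G.edges (fun e => e.2 ≠ α), e, ← h.insert_leaves,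
      Finset.sum_insert hi0, h2]
    congr 2
    exact Finset.sum_congr rfl fun j hj => by rw [h1 j hj]
  rw [bethe, bethe, e1, e2, e3, e4, Finset.sum_sub_distrib]
  linarith

end FactorGraph

/-! ### Sums over binary words -/

theorem sum_zmod_two {M : Type*} [AddCommMonoid M] (f : ZMod 2 → M) : ∑ b, f b = f 0 + f 1 :=
  Fin.sum_univ_two f

theorem zmod_two_ne_zero_iff {b : ZMod 2} : b ≠ 0 ↔ b = 1 := by
  revert b; decide

/-- The sign `(-1)^b` of a bit. -/
def bitSign (b : ZMod 2) : ℝ := if b = 0 then 1 else -1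

theorem bitSign_add (a b : ZMod 2) : bitSign (a + b) = bitSign a * bitSign b := by
  have h1 : (1 : ZMod 2) + 1 = 0 := by decide
  by_cases ha : a = 0 <;> by_cases hb : b = 0
  · simp [ha, bitSign]
  · simp [ha, bitSign]
  · simp [hb, bitSign]
  · rw [← ne_eq, zmod_two_ne_zero_iff] at ha hb
    simp [ha, hb, bitSign, h1]

theorem bitSign_sum {ι : Type*} (s : Finset ι) (x : ι → ZMod 2) :
    bitSign (∑ i ∈ s, x i) = ∏ i ∈ s, bitSign (x i) := by
  classical
  induction s using Finset.induction_on with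
  | empty => simp [bitSign]
  | insert i s hi ih => rw [Finset.sum_insert hi, Finset.prod_insert hi, bitSign_add, ih]

theorem ite_eq_zero_eq_bitSign (b : ZMod 2) (r : ℝ) :
    (if b = 0 then r else 0) = r * (1 + bitSign b) / 2 := by
  unfold bitSign
  split_ifs <;> ring

/-- The words that agree with `y` outside `J`. -/
def agreeing {V : Type*} [Fintype V] [DecidableEq V] (J : Finset V) (y : V → ZMod 2) :
    Finset (V → ZMod 2) :=
  Fintype.piFinset fun i => if i ∈ J then Finset.univ else {y i}

theorem mem_agreeing {V : Type*} [Fintype V] [DecidableEq V] {J : Finset V} {x y : V → ZMod 2} :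
    x ∈ agreeing J y ↔ ∀ i ∉ J, x i = y i := by
  rw [agreeing, Fintype.mem_piFinset]
  refine forall_congr' fun i => ?_
  by_cases hi : i ∈ J <;> simp [hi]

theorem sum_agreeing_prod {V : Type*} [Fintype V] [DecidableEq V] (J : Finset V)
    (y : V → ZMod 2) (w : V → ZMod 2 → ℝ) :
    ∑ x ∈ agreeing J y, ∏ i, w i (x i)
      = (∏ j ∈ J, (w j 0 + w j 1)) * ∏ i ∈ Jᶜ, w i (y i) := by
  rw [agreeing, ← Finset.prod_univ_sum, ← Finset.prod_mul_prod_compl J]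
  congr 1
  · refine Finset.prod_congr rfl fun j hj => ?_
    rw [if_pos hj, sum_zmod_two]
  · refine Finset.prod_congr rfl fun j hj => ?_
    rw [if_neg (Finset.mem_compl.1 hj), Finset.sum_singleton]

/-! ### The partition function -/

/-- The likelihood of the bit `b`, relative to the bit `0`, for the log-likelihood ratio `x`. -/
def bitWeight (x : EReal) (b : ZMod 2) : ℝ := if b = 0 then 1 else lik x

@[simp] theorem bitWeight_zero (x : EReal) : bitWeight x 0 = 1 := by simp [bitWeight]

@[simp] theorem bitWeight_one (x : EReal) : bitWeight x 1 = lik x := by simp [bitWeight]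

theorem bitWeight_nonneg (x : EReal) (b : ZMod 2) : 0 ≤ bitWeight x b := by
  unfold bitWeight
  split_ifs
  exacts [zero_le_one, lik_nonneg x]

theorem measurable_bitWeight (b : ZMod 2) : Measurable fun x => bitWeight x b := by
  unfold bitWeight
  split_ifs
  exacts [measurable_const, measurable_lik]

/-- The check-node combination of finitely many log-likelihood ratios. -/
def boxSum {ι : Type*} (s : Finset ι) (l : ι → EReal) : EReal :=
  twoArtanh (∏ i ∈ s, tanhHalf (l i))

theorem tanhHalf_boxSum {ι : Type*} (s : Finset ι) (l : ι → EReal) :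
    tanhHalf (boxSum s l) = ∏ i ∈ s, tanhHalf (l i) := by
  refine tanhHalf_twoArtanh ?_
  rw [Finset.abs_prod]
  exact Finset.prod_le_one (fun i _ => abs_nonneg _) fun i _ => abs_tanhHalf_le _

theorem boxSum_empty {ι : Type*} (l : ι → EReal) : boxSum ∅ l = ⊤ :=
  tanhHalf_injective (by simp [tanhHalf_boxSum])

theorem boxSum_insert {ι : Type*} [DecidableEq ι] {s : Finset ι} {i : ι} (hi : i ∉ s)
    (l : ι → EReal) : boxSum (insert i s) l = boxPlus (l i) (boxSum s l) :=
  tanhHalf_injective (by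
    rw [tanhHalf_boxPlus, tanhHalf_boxSum, tanhHalf_boxSum, Finset.prod_insert hi])

theorem boxSum_ne_bot {ι : Type*} {s : Finset ι} {l : ι → EReal} (h : ∀ i, l i ≠ ⊥) :
    boxSum s l ≠ ⊥ := by
  classical
  induction s using Finset.induction_on with
  | empty => simp [boxSum_empty]
  | insert i s hi ih =>
    rw [boxSum_insert hi]
    exact boxPlus_ne_bot (h i) ih

theorem measurable_boxSum {ι : Type*} (s : Finset ι) : Measurable (boxSum s) := by
  refine measurable_twoArtanh.comp (Finset.measurable_prod _ fun i _ => ?_)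
  exact measurable_tanhHalf.comp (measurable_pi_apply i)

theorem boxSum_congr {ι : Type*} {s : Finset ι} {l l' : ι → EReal} (h : ∀ i ∈ s, l i = l' i) :
    boxSum s l = boxSum s l' := by
  rw [boxSum, boxSum, Finset.prod_congr rfl fun i hi => by rw [h i hi]]

/-- The product rule for tanh with denominators cleared, the form needed to sum out leaf bits. -/
theorem one_sub_lik_boxSum_mul {ι : Type*} (s : Finset ι) {l : ι → EReal} (h : ∀ i, l i ≠ ⊥) :
    (1 - lik (boxSum s l)) * ∏ i ∈ s, (1 + lik (l i))
      = (1 + lik (boxSum s l)) * ∏ i ∈ s, (1 - lik (l i)) := by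
  have h1 := tanhHalf_boxSum s l
  have hp : ∀ x, 1 + lik x ≠ 0 := fun x => by linarith [lik_nonneg x]
  rw [tanhHalf_eq_of_ne_bot (boxSum_ne_bot h),
    Finset.prod_congr rfl fun i _ => tanhHalf_eq_of_ne_bot (h i), Finset.prod_div_distrib,
    div_eq_div_iff (hp _) (Finset.prod_ne_zero_iff.2 fun i _ => hp _)] at h1
  rw [h1, mul_comm]

namespace FactorGraph

variable {V C : Type*} [Fintype V] [DecidableEq V] [Fintype C] [DecidableEq C]

/-- The sum over the code of the likelihoods of its words, relative to the zero word. -/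
def partition (G : FactorGraph V C) (l : V → EReal) : ℝ :=
  ∑ x ∈ G.code, ∏ i, bitWeight (l i) (x i)

variable {G : FactorGraph V C} {α : C} {i₀ : V}

theorem mem_code {x : V → ZMod 2} : x ∈ G.code ↔ ∀ α, ∑ i ∈ G.checkNbr α, x i = 0 := by
  simp [code]

theorem zero_mem_code : (0 : V → ZMod 2) ∈ G.code := by simp [mem_code]

theorem measurable_partition (G : FactorGraph V C) : Measurable G.partition :=
  Finset.measurable_sum _ fun x _ => Finset.measurable_prod _ fun i _ =>
    (measurable_bitWeight (x i)).comp (measurable_pi_apply i)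

theorem one_le_partition (l : V → EReal) : 1 ≤ G.partition l := by
  have h := Finset.single_le_sum (f := fun x : V → ZMod 2 => ∏ i, bitWeight (l i) (x i))
    (fun x _ => Finset.prod_nonneg fun i _ => bitWeight_nonneg _ _) (zero_mem_code (G := G))
  simpa [partition] using h

/-- The words of the code without the check `α` that vanish on the leaves of `α`. -/
def reducedCode (G : FactorGraph V C) (α : C) (i₀ : V) : Finset (V → ZMod 2) :=
  (G.removeCheck α).code.filter fun y => ∀ j ∈ G.leaves α i₀, y j = 0

/-- The partition function of the graph without the check `α` and its leaves. -/
def reducedPartition (G : FactorGraph V C) (α : C) (i₀ : V) (l : V → EReal) : ℝ :=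
  ∑ y ∈ G.reducedCode α i₀, ∏ i ∈ (G.leaves α i₀)ᶜ, bitWeight (l i) (y i)

theorem measurable_reducedPartition (G : FactorGraph V C) (α : C) (i₀ : V) :
    Measurable (G.reducedPartition α i₀) :=
  Finset.measurable_sum _ fun x _ => Finset.measurable_prod _ fun i _ =>
    (measurable_bitWeight (x i)).comp (measurable_pi_apply i)

theorem one_le_reducedPartition (l : V → EReal) : 1 ≤ G.reducedPartition α i₀ l := by
  have hz : (0 : V → ZMod 2) ∈ G.reducedCode α i₀ := by simp [reducedCode, zero_mem_code]
  have h := Finset.single_le_sum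
    (f := fun y : V → ZMod 2 => ∏ i ∈ (G.leaves α i₀)ᶜ, bitWeight (l i) (y i))
    (fun x _ => Finset.prod_nonneg fun i _ => bitWeight_nonneg _ _) hz
  simpa [reducedPartition] using h

theorem reducedPartition_congr {l l' : V → EReal} (h : ∀ i ∉ G.leaves α i₀, l i = l' i) :
    G.reducedPartition α i₀ l = G.reducedPartition α i₀ l' := by
  refine Finset.sum_congr rfl fun y _ => Finset.prod_congr rfl fun i hi => ?_
  rw [h i (Finset.mem_compl.1 hi)]

theorem mem_code_iff : ∀ x : V → ZMod 2, x ∈ G.code ↔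
    x ∈ (G.removeCheck α).code ∧ ∑ i ∈ G.checkNbr α, x i = 0 := by
  intro x
  simp only [mem_code]
  constructor
  · refine fun h => ⟨fun β => ?_, h α⟩
    by_cases hβ : β = α
    · subst hβ; rw [checkNbr_removeCheck_self, Finset.sum_empty]
    · rw [checkNbr_removeCheck_of_ne hβ]; exact h β
  · rintro ⟨h, h'⟩ β
    by_cases hβ : β = α
    · subst hβ; exact h'
    · rw [← checkNbr_removeCheck_of_ne hβ]; exact h β

theorem IsPendant.mem_code_removeCheck_congr (h : G.IsPendant α i₀) {x y : V → ZMod 2}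
    (hxy : ∀ i ∉ G.leaves α i₀, x i = y i) :
    x ∈ (G.removeCheck α).code ↔ y ∈ (G.removeCheck α).code := by
  simp only [mem_code]
  refine forall_congr' fun β => ?_
  by_cases hβ : β = α
  · subst hβ; simp [checkNbr_removeCheck_self]
  · rw [checkNbr_removeCheck_of_ne hβ, Finset.sum_congr rfl fun i hi =>
      hxy i (h.notMem_leaves_of_mem hβ (by simpa using hi))]

/-- Without `α` the leaf bits are unconstrained, so the code fibres over its words with the leaf
bits set to zero. -/
theorem IsPendant.sum_code_removeCheck (h : G.IsPendant α i₀) (f : (V → ZMod 2) → ℝ) :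
    ∑ x ∈ (G.removeCheck α).code, f x
      = ∑ y ∈ G.reducedCode α i₀, ∑ x ∈ agreeing (G.leaves α i₀) y, f x := by
  rw [← Finset.sum_fiberwise_of_maps_to (t := G.reducedCode α i₀)
    (g := fun x i => if i ∈ G.leaves α i₀ then 0 else x i)]
  · refine Finset.sum_congr rfl fun y hy => Finset.sum_congr ?_ fun _ _ => rfl
    obtain ⟨hy1, hy2⟩ := Finset.mem_filter.1 hy
    ext x
    rw [Finset.mem_filter, mem_agreeing]
    constructor
    · rintro ⟨_, h2⟩ i hi
      rw [← h2]
      simp [hi]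
    · intro hx
      refine ⟨(h.mem_code_removeCheck_congr hx).2 hy1, funext fun i => ?_⟩
      by_cases hi : i ∈ G.leaves α i₀
      · simp [hi, hy2 i hi]
      · simp [hi, hx i hi]
  · intro x hx
    refine Finset.mem_filter.2 ⟨(h.mem_code_removeCheck_congr fun i hi => ?_).1 hx, ?_⟩
    · simp [hi]
    · intro j hj
      simp [hj]

theorem IsPendant.partition_removeCheck (h : G.IsPendant α i₀) (l : V → EReal) :
    (G.removeCheck α).partition l
      = (∏ j ∈ G.leaves α i₀, (1 + lik (l j))) * G.reducedPartition α i₀ l := by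
  rw [partition, h.sum_code_removeCheck, reducedPartition, Finset.mul_sum]
  refine Finset.sum_congr rfl fun y _ => ?_
  rw [sum_agreeing_prod]
  simp

/-- Writing the parity indicator as `(1 + ∏ signs) / 2` decouples the leaf bits; summing them freely
gives factors `1 + lik` without the sign and `1 - lik` with it. -/
theorem IsPendant.partition_eq (h : G.IsPendant α i₀) (l : V → EReal) :
    G.partition l = ∑ y ∈ G.reducedCode α i₀,
      (∏ j ∈ G.leaves α i₀, (1 + lik (l j))
        + bitSign (y i₀) * ∏ j ∈ G.leaves α i₀, (1 - lik (l j))) / 2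
      * ∏ i ∈ (G.leaves α i₀)ᶜ, bitWeight (l i) (y i) := by
  have e1 : G.code = (G.removeCheck α).code.filter fun x => ∑ i ∈ G.checkNbr α, x i = 0 := by
    ext x
    rw [Finset.mem_filter, mem_code_iff]
  rw [partition, e1, Finset.sum_filter, h.sum_code_removeCheck]
  refine Finset.sum_congr rfl fun y _ => ?_
  -- Only the leaf weights are twisted by the sign; the sign of `i₀` is constant on the fibre and
  -- stays outside.
  let w : V → ZMod 2 → ℝ := fun i b =>
    if i ∈ G.leaves α i₀ then bitSign b * bitWeight (l i) b else bitWeight (l i) b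
  have e2 : ∀ x ∈ agreeing (G.leaves α i₀) y,
      (if ∑ i ∈ G.checkNbr α, x i = 0 then ∏ i, bitWeight (l i) (x i) else 0)
      = (∏ i, bitWeight (l i) (x i) + bitSign (y i₀) * ∏ i, w i (x i)) / 2 := by
    intro x hx
    have hx0 : x i₀ = y i₀ := mem_agreeing.1 hx i₀ notMem_leaves
    have hw : ∏ i, w i (x i)
        = (∏ j ∈ G.leaves α i₀, bitSign (x j)) * ∏ i, bitWeight (l i) (x i) := by
      rw [← Finset.prod_mul_prod_compl (G.leaves α i₀) fun i => bitWeight (l i) (x i),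
        ← Finset.prod_mul_prod_compl (G.leaves α i₀) fun i => w i (x i), ← mul_assoc,
        ← Finset.prod_mul_distrib]
      congr 1
      · exact Finset.prod_congr rfl fun j hj => if_pos hj
      · exact Finset.prod_congr rfl fun j hj => if_neg (Finset.mem_compl.1 hj)
    rw [ite_eq_zero_eq_bitSign, ← h.insert_leaves, bitSign_sum,
      Finset.prod_insert notMem_leaves, hx0, hw]
    ring
  rw [Finset.sum_congr rfl e2, ← Finset.sum_div, Finset.sum_add_distrib, ← Finset.mul_sum,
    sum_agreeing_prod, sum_agreeing_prod]
  have e3 : ∏ j ∈ G.leaves α i₀, (bitWeight (l j) 0 + bitWeight (l j) 1)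
      = ∏ j ∈ G.leaves α i₀, (1 + lik (l j)) := by simp
  have e4 : ∏ j ∈ G.leaves α i₀, (w j 0 + w j 1)
      = ∏ j ∈ G.leaves α i₀, (1 - lik (l j)) := by
    refine Finset.prod_congr rfl fun j hj => ?_
    simp only [w, if_pos hj, bitSign]
    simp
    ring
  have e5 : ∏ i ∈ (G.leaves α i₀)ᶜ, w i (y i)
      = ∏ i ∈ (G.leaves α i₀)ᶜ, bitWeight (l i) (y i) :=
    Finset.prod_congr rfl fun j hj => if_neg (Finset.mem_compl.1 hj)
  rw [e3, e4, e5]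
  ring

/-- Absorb the check node `α` and its leaves into the log-likelihood ratio of `i₀`. -/
def absorbLlr (G : FactorGraph V C) (α : C) (i₀ : V) (l : V → EReal) : V → EReal :=
  Function.update l i₀ (l i₀ + boxSum (G.leaves α i₀) l)

/-- Summed over the leaf bits, the check acts on the bit of `i₀` like one more independent
observation with log-likelihood ratio `boxSum`, up to a normalization independent of that bit. -/
theorem IsPendant.partition_mul (h : G.IsPendant α i₀) {l : V → EReal} (hl : ∀ i, l i ≠ ⊥) :
    G.partition l * (1 + lik (boxSum (G.leaves α i₀) l))
      = (∏ j ∈ G.leaves α i₀, (1 + lik (l j)))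
        * G.reducedPartition α i₀ (G.absorbLlr α i₀ l) := by
  rw [h.partition_eq, Finset.sum_mul, reducedPartition, Finset.mul_sum]
  refine Finset.sum_congr rfl fun y _ => ?_
  have hmem : i₀ ∈ (G.leaves α i₀)ᶜ := Finset.mem_compl.2 notMem_leaves
  have e1 : ∏ i ∈ (G.leaves α i₀)ᶜ, bitWeight (G.absorbLlr α i₀ l i) (y i)
      = bitWeight (boxSum (G.leaves α i₀) l) (y i₀)
        * ∏ i ∈ (G.leaves α i₀)ᶜ, bitWeight (l i) (y i) := by
    rw [← Finset.mul_prod_erase _ _ hmem, ← Finset.mul_prod_erase _ _ hmem, ← mul_assoc]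
    congr 1
    · rw [absorbLlr, Function.update_self]
      by_cases hy : y i₀ = 0
      · simp [hy]
      · rw [← ne_eq, zmod_two_ne_zero_iff] at hy
        rw [hy, bitWeight_one, bitWeight_one, bitWeight_one, lik_add (hl i₀) (boxSum_ne_bot hl),
          mul_comm]
    · refine Finset.prod_congr rfl fun i hi => ?_
      rw [absorbLlr, Function.update_of_ne (Finset.ne_of_mem_erase hi)]
  have e2 := one_sub_lik_boxSum_mul (G.leaves α i₀) hl
  rw [e1]
  by_cases hy : y i₀ = 0
  · simp only [hy, bitSign, if_true, bitWeight_zero]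
    linear_combination (-(∏ i ∈ (G.leaves α i₀)ᶜ, bitWeight (l i) (y i)) / 2) * e2
  · have hy' := zmod_two_ne_zero_iff.1 hy
    have hs : bitSign 1 = -1 := by simp [bitSign]
    simp only [hy', hs, bitWeight_one]
    linear_combination ((∏ i ∈ (G.leaves α i₀)ᶜ, bitWeight (l i) (y i)) / 2) * e2

end FactorGraph

/-! ### Independent log-likelihood ratios -/

/-- The law of independent log-likelihood ratios with the given densities. -/
def productLaw {V : Type*} [Fintype V] (c : V → Density) : Measure (V → EReal) :=
  Measure.pi fun i => (c i : Measure EReal)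

instance {V : Type*} [Fintype V] (c : V → Density) : IsProbabilityMeasure (productLaw c) := by
  unfold productLaw; infer_instance

section pi

variable {V : Type*} [Fintype V] [DecidableEq V]

theorem measurable_update_prod (i : V) :
    Measurable fun p : (V → EReal) × EReal => Function.update p.1 i p.2 := by
  refine measurable_pi_iff.2 fun j => ?_
  by_cases h : j = i
  · subst h
    simpa using measurable_snd
  · simp only [Function.update_of_ne h]
    exact (measurable_pi_apply j).comp measurable_fst

/-- Resampling one coordinate independently changes only that marginal of a product law. Boxes
suffice to check it. -/
theorem map_update_prod (c : V → Density) (i : V) (ν : Density) :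
    ((productLaw c).prod (ν : Measure EReal)).map (fun p => Function.update p.1 i p.2)
      = productLaw (Function.update c i ν) := by
  symm
  refine Measure.pi_eq fun s hs => ?_
  rw [Measure.map_apply (measurable_update_prod i) (MeasurableSet.univ_pi hs)]
  have hpre : (fun p : (V → EReal) × EReal => Function.update p.1 i p.2) ⁻¹' Set.univ.pi s
      = (Set.univ.pi (Function.update s i Set.univ)) ×ˢ s i := by
    ext ⟨l, w⟩
    simp only [Set.mem_preimage, Set.mem_pi, Set.mem_univ, true_implies, Set.mem_prod]
    constructor
    · intro h
      refine ⟨fun j => ?_, by simpa using h i⟩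
      by_cases hj : j = i
      · subst hj; simp
      · simpa [hj] using h j
    · rintro ⟨h1, h2⟩ j
      by_cases hj : j = i
      · subst hj; simpa using h2
      · simpa [hj] using h1 j
  rw [hpre, Measure.prod_prod, productLaw, Measure.pi_pi,
    ← Finset.prod_erase_mul _ _ (Finset.mem_univ i),
    ← Finset.prod_erase_mul Finset.univ (fun j => (Function.update c i ν j : Measure EReal) (s j))
      (Finset.mem_univ i)]
  simp only [Function.update_self, measure_univ, mul_one]
  congr 1
  refine Finset.prod_congr rfl fun j hj => ?_
  rw [Function.update_of_ne (Finset.ne_of_mem_erase hj),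
    Function.update_of_ne (Finset.ne_of_mem_erase hj)]

theorem lintegral_productLaw_update (c : V → Density) (i : V) (ν : Density)
    {f : (V → EReal) → ℝ≥0∞} (hf : Measurable f) :
    ∫⁻ l, f l ∂(productLaw (Function.update c i ν))
      = ∫⁻ l, ∫⁻ w, f (Function.update l i w) ∂(ν : Measure EReal) ∂(productLaw c) := by
  rw [← map_update_prod, lintegral_map hf (measurable_update_prod i),
    lintegral_prod (fun p => f (Function.update p.1 i p.2))
      (hf.comp (measurable_update_prod i)).aemeasurable]

theorem lintegral_productLaw (c : V → Density) (i : V)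
    {f : (V → EReal) → ℝ≥0∞} (hf : Measurable f) :
    ∫⁻ l, f l ∂(productLaw c)
      = ∫⁻ l, ∫⁻ w, f (Function.update l i w) ∂(c i : Measure EReal) ∂(productLaw c) := by
  rw [← lintegral_productLaw_update c i (c i) hf, Function.update_eq_self]

theorem lintegral_eval_productLaw (c : V → Density) (i : V)
    {f : EReal → ℝ≥0∞} (hf : Measurable f) :
    ∫⁻ l, f (l i) ∂(productLaw c) = ∫⁻ x, f x ∂(c i : Measure EReal) := by
  have hm : Measurable fun l : V → EReal => f (l i) := hf.comp (measurable_pi_apply i)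
  rw [lintegral_productLaw c i hm]
  simp

theorem ae_productLaw_ne_bot {c : V → Density} (hc : ∀ i, IsSym (c i)) :
    ∀ᵐ l ∂(productLaw c), ∀ i, l i ≠ ⊥ := by
  refine ae_all_iff.2 fun i => ?_
  have hm : Measurable (Set.indicator {(⊥ : EReal)} (1 : EReal → ℝ≥0∞)) :=
    measurable_one.indicator (measurableSet_singleton _)
  have h := lintegral_eval_productLaw c i hm
  have h0 : ∫⁻ x, Set.indicator {(⊥ : EReal)} (1 : EReal → ℝ≥0∞) x ∂(c i : Measure EReal) = 0 := by
    rw [lintegral_indicator_one (measurableSet_singleton _)]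
    exact measure_eq_zero_iff_ae_notMem.2 (hc i).ae_ne_bot
  have hm' : Measurable fun l : V → EReal => Set.indicator {(⊥ : EReal)} (1 : EReal → ℝ≥0∞) (l i) :=
    hm.comp (measurable_pi_apply i)
  rw [h0, lintegral_eq_zero_iff hm'] at h
  filter_upwards [h] with l hl hbot
  simp [hbot] at hl

/-- Since `Φ z` ignores the coordinates in `s`, `boxSum s l` is independent of all it depends on and
may be replaced by a fresh draw. The induction resamples one coordinate of `s` at a time. -/
theorem lintegral_boxSum (c : V → Density) (s : Finset V) {Φ : EReal → (V → EReal) → ℝ≥0∞}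
    (hΦ : Measurable (Function.uncurry Φ))
    (hs : ∀ z, ∀ j ∈ s, ∀ l w, Φ z (Function.update l j w) = Φ z l) :
    ∫⁻ l, Φ (boxSum s l) l ∂(productLaw c)
      = ∫⁻ z, ∫⁻ l, Φ z l ∂(productLaw c) ∂(checkConvs s c : Measure EReal) := by
  induction s using Finset.induction_on generalizing Φ with
  | empty =>
    have h : (checkConvs (∅ : Finset V) c : Measure EReal) = Measure.dirac ⊤ := rfl
    have hm : Measurable fun z => ∫⁻ l, Φ z l ∂(productLaw c) :=
      Measurable.lintegral_prod_right' (f := Function.uncurry Φ) hΦ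
    rw [h, lintegral_dirac' _ hm]
    simp only [boxSum_empty]
  | insert j s hj ih =>
    have hΦ' : Measurable fun p : EReal × (V → EReal) => Φ p.1 p.2 := hΦ
    have hm1 : Measurable fun l => Φ (boxSum (insert j s) l) l :=
      hΦ'.comp ((measurable_boxSum _).prodMk measurable_id)
    have hm2 : Measurable fun z => ∫⁻ l, Φ z l ∂(productLaw c) :=
      Measurable.lintegral_prod_right' (f := Function.uncurry Φ) hΦ
    have e1 : ∀ l w, Φ (boxSum (insert j s) (Function.update l j w)) (Function.update l j w)
        = Φ (boxPlus w (boxSum s l)) l := by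
      intro l w
      rw [hs _ j (Finset.mem_insert_self j s), boxSum_insert hj, Function.update_self,
        boxSum_congr fun i hi => Function.update_of_ne (ne_of_mem_of_not_mem hi hj) _ _]
    have hm3 : Measurable fun p : (V → EReal) × EReal => Φ (boxPlus p.2 (boxSum s p.1)) p.1 := by
      refine hΦ'.comp (Measurable.prodMk ?_ measurable_fst)
      exact measurable_boxPlus.comp
        (measurable_snd.prodMk ((measurable_boxSum s).comp measurable_fst))
    rw [lintegral_productLaw c j hm1]
    simp only [e1]
    rw [lintegral_lintegral_swap hm3.aemeasurable, checkConvs_insert hj,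
      lintegral_checkConv _ _ hm2]
    refine lintegral_congr fun w => ?_
    refine ih (Φ := fun z l => Φ (boxPlus w z) l) ?_ ?_
    · exact hΦ'.comp (Measurable.prodMk (measurable_boxPlus.comp
        (measurable_const.prodMk measurable_fst)) measurable_snd)
    · intro z i hi l w'
      exact hs _ i (Finset.mem_insert_of_mem hi) l w'

end pi

namespace FactorGraph

variable {V C : Type*} [Fintype V] [DecidableEq V] [Fintype C] [DecidableEq C]

/-- The expected logarithm (in bits) of the partition function. -/
def logPartition (G : FactorGraph V C) (c : V → Density) : ℝ≥0∞ :=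
  ∫⁻ l, ENNReal.ofReal (Real.logb 2 (G.partition l)) ∂(productLaw c)

variable {G : FactorGraph V C} {c : V → Density} {α : C} {i₀ : V}

/-- The expected logarithm (in bits) of the reduced partition function. -/
def logReducedPartition (G : FactorGraph V C) (α : C) (i₀ : V) (c : V → Density) : ℝ≥0∞ :=
  ∫⁻ l, ENNReal.ofReal (Real.logb 2 (G.reducedPartition α i₀ l)) ∂(productLaw c)

theorem measurable_logReducedPartition (G : FactorGraph V C) (α : C) (i₀ : V) :
    Measurable fun l => ENNReal.ofReal (Real.logb 2 (G.reducedPartition α i₀ l)) :=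
  ((Real.measurable_log.comp (measurable_reducedPartition G α i₀)).div_const _).ennreal_ofReal

theorem measurable_logPartition (G : FactorGraph V C) :
    Measurable fun l => ENNReal.ofReal (Real.logb 2 (G.partition l)) :=
  ((Real.measurable_log.comp (measurable_partition G)).div_const _).ennreal_ofReal

theorem ofReal_logb_mul {x y : ℝ} (hx : 1 ≤ x) (hy : 1 ≤ y) :
    ENNReal.ofReal (Real.logb 2 (x * y))
      = ENNReal.ofReal (Real.logb 2 x) + ENNReal.ofReal (Real.logb 2 y) := by
  rw [Real.logb_mul (by linarith) (by linarith), ENNReal.ofReal_add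
    (Real.logb_nonneg one_lt_two hx) (Real.logb_nonneg one_lt_two hy)]

theorem ofReal_logb_prod {ι : Type*} (s : Finset ι) {f : ι → ℝ} (hf : ∀ i ∈ s, 1 ≤ f i) :
    ENNReal.ofReal (Real.logb 2 (∏ i ∈ s, f i)) = ∑ i ∈ s, ENNReal.ofReal (Real.logb 2 (f i)) := by
  rw [Real.logb_prod _ _ fun i hi => by linarith [hf i hi],
    ENNReal.ofReal_sum_of_nonneg fun i hi => Real.logb_nonneg one_lt_two (hf i hi)]

theorem one_le_one_add_lik (x : EReal) : 1 ≤ 1 + lik x := by linarith [lik_nonneg x]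

theorem one_le_prod_one_add_lik {ι : Type*} (s : Finset ι) (l : ι → EReal) :
    1 ≤ ∏ j ∈ s, (1 + lik (l j)) := by
  calc (1 : ℝ) = ∏ j ∈ s, 1 := by simp
    _ ≤ _ := Finset.prod_le_prod (fun _ _ => zero_le_one) fun j _ => one_le_one_add_lik _

theorem measurable_ofReal_surprisal : Measurable fun x => ENNReal.ofReal (surprisal x) :=
  measurable_surprisal.ennreal_ofReal

theorem measurable_ofReal_surprisal_eval (j : V) :
    Measurable fun l : V → EReal => ENNReal.ofReal (surprisal (l j)) :=
  measurable_ofReal_surprisal.comp (measurable_pi_apply j)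

theorem lintegral_sum_surprisal (c : V → Density) (s : Finset V) :
    ∫⁻ l, ∑ j ∈ s, ENNReal.ofReal (surprisal (l j)) ∂(productLaw c) = ∑ j ∈ s, lentropy (c j) := by
  rw [lintegral_finsetSum s fun j _ => measurable_ofReal_surprisal_eval j]
  exact Finset.sum_congr rfl fun j _ => lintegral_eval_productLaw c j measurable_ofReal_surprisal

theorem IsPendant.logPartition_removeCheck (h : G.IsPendant α i₀) (c : V → Density) :
    (G.removeCheck α).logPartition c
      = ∑ j ∈ G.leaves α i₀, lentropy (c j) + G.logReducedPartition α i₀ c := by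
  rw [← lintegral_sum_surprisal, logReducedPartition,
    ← lintegral_add_right _ (measurable_logReducedPartition G α i₀), logPartition]
  refine lintegral_congr fun l => ?_
  rw [h.partition_removeCheck, ofReal_logb_mul (one_le_prod_one_add_lik _ _)
    (one_le_reducedPartition l), ofReal_logb_prod _ fun j _ => one_le_one_add_lik _]
  rfl

/-- Absorbing in the densities or in the log-likelihood ratios gives the same law for everything the
reduced partition function sees, because it ignores the leaves from which `boxSum` is formed. -/
theorem logReducedPartition_absorb (c : V → Density) :
    G.logReducedPartition α i₀ (G.absorb c α i₀)
      = ∫⁻ l, ENNReal.ofReal (Real.logb 2 (G.reducedPartition α i₀ (G.absorbLlr α i₀ l)))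
        ∂(productLaw c) := by
  obtain ⟨f, hf⟩ : ∃ f : (V → EReal) → ℝ≥0∞, ∀ l,
      f l = ENNReal.ofReal (Real.logb 2 (G.reducedPartition α i₀ l)) := ⟨_, fun _ => rfl⟩
  have hfm : Measurable f := by
    rw [funext hf]; exact measurable_logReducedPartition G α i₀
  simp only [logReducedPartition, ← hf, absorbLlr, absorb]
  have hm2 : Measurable fun p : EReal × (V → EReal) =>
      f (Function.update p.2 i₀ (p.2 i₀ + p.1)) := by
    refine hfm.comp ((measurable_update_prod i₀).comp (measurable_snd.prodMk ?_))
    exact ((measurable_pi_apply i₀).comp measurable_snd).add measurable_fst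
  have hb := lintegral_boxSum c (G.leaves α i₀)
    (Φ := fun z l => f (Function.update l i₀ (l i₀ + z))) hm2 (by
      intro z j hj l w
      have hj0 : j ≠ i₀ := (mem_leaves.1 hj).1
      rw [hf, hf, reducedPartition_congr fun i hi => ?_]
      have hij : i ≠ j := fun e => hi (e ▸ hj)
      by_cases h0 : i = i₀
      · subst h0; simp [hj0.symm]
      · simp [h0, hij])
  rw [hb, lintegral_productLaw_update c i₀ _ hfm]
  have e1 : ∀ l, ∫⁻ w, f (Function.update l i₀ w)
        ∂(varConv (c i₀) (checkConvs (G.leaves α i₀) c) : Measure EReal)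
      = ∫⁻ x, ∫⁻ z, f (Function.update l i₀ (x + z))
        ∂(checkConvs (G.leaves α i₀) c : Measure EReal) ∂(c i₀ : Measure EReal) := fun l =>
    lintegral_varConv _ _ (hfm.comp (measurable_update l))
  simp only [e1]
  have e2 : ∀ z, ∫⁻ l, f (Function.update l i₀ (l i₀ + z)) ∂(productLaw c)
      = ∫⁻ l, ∫⁻ x, f (Function.update l i₀ (x + z)) ∂(c i₀ : Measure EReal) ∂(productLaw c) := by
    intro z
    have hm3 : Measurable fun l => f (Function.update l i₀ (l i₀ + z)) :=
      hm2.comp measurable_prodMk_left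
    rw [lintegral_productLaw c i₀ hm3]
    simp
  simp only [e2]
  symm
  rw [lintegral_lintegral_swap]
  · refine lintegral_congr fun l => ?_
    rw [lintegral_lintegral_swap]
    have hadd : Measurable fun p : EReal × EReal => p.2 + p.1 := by fun_prop
    exact (hfm.comp ((measurable_update l).comp hadd)).aemeasurable
  · have hm3 : Measurable fun q : (EReal × (V → EReal)) × EReal =>
        f (Function.update q.1.2 i₀ (q.2 + q.1.1)) := by
      refine hfm.comp ((measurable_update_prod i₀).comp (Measurable.prodMk ?_ ?_))
      · exact measurable_snd.comp measurable_fst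
      · exact measurable_snd.add (measurable_fst.comp measurable_fst)
    exact (Measurable.lintegral_prod_right' hm3).aemeasurable

/-- The expected logarithm of `IsPendant.partition_mul`. It is the recursion that
`IsPendant.bethe_eq` gives for the Bethe entropy. -/
theorem IsPendant.logPartition_add (h : G.IsPendant α i₀) (hc : ∀ i, IsSym (c i)) :
    G.logPartition c + lentropy (checkConvs (G.leaves α i₀) c)
      = (G.removeCheck α).logPartition (G.absorb c α i₀) := by
  have hb : ∫⁻ l, ENNReal.ofReal (surprisal (boxSum (G.leaves α i₀) l)) ∂(productLaw c)
      = lentropy (checkConvs (G.leaves α i₀) c) := by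
    rw [lintegral_boxSum c (G.leaves α i₀) (Φ := fun z _ => ENNReal.ofReal (surprisal z))
      (measurable_ofReal_surprisal.comp measurable_fst) (fun _ _ _ _ _ => rfl)]
    simp [lentropy]
  have e1 : ∑ j ∈ G.leaves α i₀, lentropy (G.absorb c α i₀ j)
      = ∑ j ∈ G.leaves α i₀, lentropy (c j) := by
    refine Finset.sum_congr rfl fun j hj => ?_
    rw [absorb, Function.update_of_ne (mem_leaves.1 hj).1]
  rw [h.logPartition_removeCheck, e1, logReducedPartition_absorb, ← lintegral_sum_surprisal, ← hb,
    logPartition, ← lintegral_add_left (measurable_logPartition G), ← lintegral_add_left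
    (Finset.measurable_sum _ fun j _ => measurable_ofReal_surprisal_eval j)]
  refine lintegral_congr_ae ((ae_productLaw_ne_bot hc).mono fun l hl => ?_)
  simp only
  have h1 := ofReal_logb_mul (one_le_partition (G := G) l)
    (one_le_one_add_lik (boxSum (G.leaves α i₀) l))
  rw [h.partition_mul hl, ofReal_logb_mul (one_le_prod_one_add_lik _ _)
    (one_le_reducedPartition _), ofReal_logb_prod _ fun j _ => one_le_one_add_lik _] at h1
  exact h1.symm

/-- Every word is a codeword, the partition function factors, and both quantities are the sum of the
channel entropies. -/
theorem bethe_le_logPartition_of_edges_eq_empty (he : G.edges = ∅) (hc : ∀ i, IsSym (c i))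
    (m : Messages V C) :
    G.logPartition c ≠ ⊤ ∧ G.bethe c m ≤ (G.logPartition c).toReal := by
  have hv : ∀ i, G.varNbr i = ∅ := fun i => by ext; simp [he]
  have hk : ∀ α, G.checkNbr α = ∅ := fun i => by ext; simp [he]
  have hcode : G.code = Finset.univ := by ext; simp [mem_code, hk]
  have hz : ∀ l, G.partition l = ∏ i, (1 + lik (l i)) := by
    intro l
    rw [partition, hcode, ← Fintype.piFinset_univ, ← Finset.prod_univ_sum]
    exact Finset.prod_congr rfl fun i _ => by rw [sum_zmod_two]; simp
  have e : G.logPartition c = ∑ i, lentropy (c i) := by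
    rw [← lintegral_sum_surprisal, logPartition]
    refine lintegral_congr fun l => ?_
    rw [hz, ofReal_logb_prod _ fun j _ => one_le_one_add_lik _]
    rfl
  rw [e]
  refine ⟨ENNReal.sum_ne_top.2 fun i _ => (hc i).lentropy_ne_top, ?_⟩
  rw [ENNReal.toReal_sum fun i _ => (hc i).lentropy_ne_top, bethe, he]
  have e1 : ∀ i, varConv (c i) (varConvs (G.varNbr i) fun α => m.toVar α i) = c i := fun i => by
    rw [hv]; exact varConv_pointMass_zero _
  have e2 : ∀ α, entropy (checkConvs (G.checkNbr α) fun i => m.toCheck i α) = 0 := fun α => by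
    rw [hk]; exact entropy_pointMass_top
  simp only [e1, e2]
  simp [hk, entropy_eq_toReal]

/-- The claim is made for arbitrary symmetric densities and improving messages, since the induction
on edges alters the channel of `i₀`. Finiteness is carried along so that `toReal` is harmless. -/
theorem IsCycleFree.bethe_le_logPartition (hG : G.IsCycleFree) {m : Messages V C}
    (hm : G.IsImproving c m) :
    G.logPartition c ≠ ⊤ ∧ G.bethe c m ≤ (G.logPartition c).toReal := by
  induction hn : G.edges.card using Nat.strong_induction_on generalizing G c m with
  | _ n ih =>
    rcases G.edges.eq_empty_or_nonempty with he | he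
    · exact bethe_le_logPartition_of_edges_eq_empty he hm.isSym_channel m
    obtain ⟨α, i₀, h⟩ := hG.exists_isPendant he
    obtain ⟨m', hm', hle, h1, h2⟩ := h.exists_bethe_le hm
    have hlt : (G.removeCheck α).edges.card < n := by
      rw [← hn]
      refine Finset.card_lt_card (Finset.filter_ssubset.2 ⟨(i₀, α), h.mem, by simp⟩)
    obtain ⟨ih1, ih2⟩ := ih _ hlt (hG.removeCheck α) (h.isImproving_removeCheck hm' h2) rfl
    have hadd := h.logPartition_add hm.isSym_channel
    have hsym := isSym_checkConvs (s := G.leaves α i₀) fun j _ => hm.isSym_channel j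
    have hne : G.logPartition c ≠ ⊤ := ne_top_of_le_ne_top ih1 (hadd ▸ le_self_add)
    refine ⟨hne, ?_⟩
    have hr := congrArg ENNReal.toReal hadd
    rw [ENNReal.toReal_add hne hsym.lentropy_ne_top, ← entropy_eq_toReal] at hr
    have hb := h.bethe_eq hm' h1 h2
    linarith

end FactorGraph

/-! ### Posteriors and Fano's inequality -/

section posterior

variable {A B : Type*} [Fintype A] [MeasurableSpace B] (J : A → Measure B)
  [∀ a, IsFiniteMeasure (J a)]

omit [∀ a, IsFiniteMeasure (J a)] in
theorem measurable_posterior (a : A) : Measurable (posterior J a) :=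
  Measure.measurable_rnDeriv _ _

omit [∀ a, IsFiniteMeasure (J a)] in
theorem absolutelyContinuous_sum (a : A) : J a ≪ ∑ a', J a' := by
  refine Measure.AbsolutelyContinuous.mk fun s _ h => ?_
  rw [Measure.finsetSum_apply] at h
  exact Finset.sum_eq_zero_iff.1 h a (Finset.mem_univ a)

theorem withDensity_posterior (a : A) : (∑ a', J a').withDensity (posterior J a) = J a :=
  Measure.withDensity_rnDeriv_eq _ _ (absolutelyContinuous_sum J a)

theorem ae_sum_posterior : ∀ᵐ y ∂(∑ a, J a), ∑ a, posterior J a y = 1 := by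
  have hm : Measurable fun y => ∑ a, posterior J a y :=
    Finset.measurable_sum _ fun a _ => measurable_posterior J a
  have h : (∑ a, J a).withDensity (fun y => ∑ a, posterior J a y)
      = (∑ a, J a).withDensity (fun _ => 1) := by
    ext s hs
    rw [withDensity_apply _ hs, withDensity_apply _ hs, lintegral_finsetSum _
      fun a _ => measurable_posterior J a]
    simp only [lintegral_const, one_mul, Measure.restrict_apply_univ, Measure.finsetSum_apply]
    refine Finset.sum_congr rfl fun a _ => ?_
    rw [← withDensity_apply _ hs, withDensity_posterior]
  exact (withDensity_eq_iff_of_sigmaFinite hm.aemeasurable aemeasurable_const).1 h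

theorem ae_posterior_le_one : ∀ᵐ y ∂(∑ a, J a), ∀ a, posterior J a y ≤ 1 := by
  filter_upwards [ae_sum_posterior J] with y hy a
  rw [← hy]
  exact Finset.single_le_sum (f := fun a => posterior J a y) (fun _ _ => zero_le)
    (Finset.mem_univ a)

theorem ae_sum_posterior_toReal : ∀ᵐ y ∂(∑ a, J a), ∑ a, (posterior J a y).toReal = 1 := by
  filter_upwards [ae_sum_posterior J, ae_posterior_le_one J] with y hy hy'
  rw [← ENNReal.toReal_sum fun a _ => ne_top_of_le_ne_top ENNReal.one_ne_top (hy' a), hy,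
    ENNReal.toReal_one]

theorem toReal_le_one_of_le_one {x : ℝ≥0∞} (h : x ≤ 1) : x.toReal ≤ 1 :=
  ENNReal.toReal_mono ENNReal.one_ne_top h

theorem ofReal_negMulLog_div {x : ℝ≥0∞} (h : x ≤ 1) :
    ENNReal.ofReal (Real.negMulLog x.toReal / Real.log 2)
      = x * ENNReal.ofReal (-Real.logb 2 x.toReal) := by
  have e : Real.negMulLog x.toReal / Real.log 2 = x.toReal * -Real.logb 2 x.toReal := by
    rw [Real.negMulLog, Real.logb]; ring
  rw [e, ENNReal.ofReal_mul ENNReal.toReal_nonneg,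
    ENNReal.ofReal_toReal (ne_top_of_le_ne_top ENNReal.one_ne_top h)]

/-- A factor `p` in `p log (1 / p)` is the density of `J a` in the output law, so entropy becomes
expected surprisal under the joint law, a form to which the symmetry of the code applies. -/
theorem condEntropy_eq_toReal :
    condEntropy J
      = (∑ a, ∫⁻ y, ENNReal.ofReal (-Real.logb 2 (posterior J a y).toReal) ∂(J a)).toReal := by
  have hm : ∀ a, Measurable fun y => (posterior J a y).toReal := fun a =>
    (measurable_posterior J a).ennreal_toReal
  have hm2 : ∀ a, Measurable fun y => ENNReal.ofReal (-Real.logb 2 (posterior J a y).toReal) :=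
    fun a => ((Real.measurable_log.comp (hm a)).div_const _).neg.ennreal_ofReal
  have hl := Real.log_pos one_lt_two
  have hnn : ∀ᵐ y ∂(∑ a, J a), ∀ a,
      0 ≤ Real.negMulLog (posterior J a y).toReal / Real.log 2 := by
    filter_upwards [ae_posterior_le_one J] with y hy a
    exact div_nonneg (Real.negMulLog_nonneg ENNReal.toReal_nonneg
      (toReal_le_one_of_le_one (hy a))) hl.le
  rw [condEntropy, integral_eq_lintegral_of_nonneg_ae]
  · congr 1
    have e : ∀ a, ∫⁻ y, ENNReal.ofReal (-Real.logb 2 (posterior J a y).toReal) ∂(J a)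
        = ∫⁻ y, posterior J a y * ENNReal.ofReal (-Real.logb 2 (posterior J a y).toReal)
          ∂(∑ a, J a) := by
      intro a
      conv_lhs => rw [← withDensity_posterior J a]
      rw [lintegral_withDensity_eq_lintegral_mul _ (measurable_posterior J a) (hm2 a)]
      rfl
    simp only [e]
    have hm3 : ∀ a, Measurable fun y => posterior J a y
        * ENNReal.ofReal (-Real.logb 2 (posterior J a y).toReal) := fun a =>
      (measurable_posterior J a).mul (hm2 a)
    rw [← lintegral_finsetSum _ fun a _ => hm3 a]
    refine lintegral_congr_ae ?_
    filter_upwards [ae_posterior_le_one J, hnn] with y hy hy'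
    rw [ENNReal.ofReal_sum_of_nonneg fun a _ => hy' a]
    exact Finset.sum_congr rfl fun a _ => ofReal_negMulLog_div (hy a)
  · filter_upwards [hnn] with y hy
    exact Finset.sum_nonneg fun a _ => hy a
  · refine Measurable.aestronglyMeasurable (Finset.measurable_sum _ fun a _ => ?_)
    exact (Real.continuous_negMulLog.measurable.comp (hm a)).div_const _

end posterior

/-- Gibbs' inequality for one term, from `log u ≤ u - 1` at `u = q / p`. -/
theorem negMulLog_le_of_pos {p q : ℝ} (hp : 0 ≤ p) (hq : 0 < q) :
    Real.negMulLog p ≤ -p * Real.log q + q - p := by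
  rcases hp.eq_or_lt with rfl | hp
  · simpa using hq.le
  · have h := Real.log_le_sub_one_of_pos (div_pos hq hp)
    rw [Real.log_div hq.ne' hp.ne'] at h
    have h2 := mul_le_mul_of_nonneg_left h hp.le
    have h3 : p * (q / p - 1) = q - p := by field_simp
    rw [Real.negMulLog]
    linarith

theorem sum_negMulLog_le {A : Type*} [Fintype A] [DecidableEq A] {p : A → ℝ} (hp : ∀ a, 0 ≤ p a)
    (hsum : ∑ a, p a = 1) (a₀ : A) :
    ∑ a, Real.negMulLog (p a)
      ≤ Real.binEntropy (1 - p a₀) + (1 - p a₀) * Real.log (Fintype.card A) := by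
  have he : ∑ a ∈ Finset.univ.erase a₀, p a = 1 - p a₀ := by
    rw [← hsum, ← Finset.sum_erase_add _ _ (Finset.mem_univ a₀)]; ring
  have h1 : 0 ≤ 1 - p a₀ := he ▸ Finset.sum_nonneg fun a _ => hp a
  have hn : (1 : ℝ) ≤ Fintype.card A := by
    exact_mod_cast Fintype.card_pos_iff.2 ⟨a₀⟩
  rw [← Finset.sum_erase_add _ _ (Finset.mem_univ a₀), Real.binEntropy_one_sub,
    Real.binEntropy_eq_negMulLog_add_negMulLog_one_sub]
  suffices h : ∑ a ∈ Finset.univ.erase a₀, Real.negMulLog (p a)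
      ≤ Real.negMulLog (1 - p a₀) + (1 - p a₀) * Real.log (Fintype.card A) by linarith
  rcases h1.eq_or_lt with h0 | h0
  · have hz : ∀ a ∈ Finset.univ.erase a₀, p a = 0 :=
      (Finset.sum_eq_zero_iff_of_nonneg fun a _ => hp a).1 (he.trans h0.symm)
    rw [Finset.sum_congr rfl fun a ha => by rw [hz a ha], ← h0]
    simp
  -- Compare with the missing mass spread in shares of size `1 / |A|`; using `|A|` rather than `|A|
  -- - 1` avoids a degenerate denominator and only loosens the bound.
  · have hq : 0 < (1 - p a₀) / Fintype.card A := by positivity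
    calc _ ≤ ∑ a ∈ Finset.univ.erase a₀, (-p a * Real.log ((1 - p a₀) / Fintype.card A)
            + (1 - p a₀) / Fintype.card A - p a) :=
          Finset.sum_le_sum fun a _ => negMulLog_le_of_pos (hp a) hq
      _ = -(1 - p a₀) * Real.log ((1 - p a₀) / Fintype.card A)
          + ((Fintype.card A : ℝ) - 1) * ((1 - p a₀) / Fintype.card A) - (1 - p a₀) := by
          rw [Finset.sum_sub_distrib, Finset.sum_add_distrib, ← Finset.sum_mul,
            Finset.sum_neg_distrib, he, Finset.sum_const, Finset.card_erase_of_mem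
            (Finset.mem_univ a₀), Finset.card_univ, nsmul_eq_mul,
            Nat.cast_sub (Fintype.card_pos_iff.2 ⟨a₀⟩)]
          simp
      _ ≤ _ := by
          rw [Real.log_div h0.ne' (by linarith), Real.negMulLog]
          have h2 : ((Fintype.card A : ℝ) - 1) * ((1 - p a₀) / Fintype.card A)
              = (1 - p a₀) - (1 - p a₀) / Fintype.card A := by
            have : (Fintype.card A : ℝ) ≠ 0 := by linarith
            field_simp
          rw [h2]
          linarith

/-- Fano's inequality. -/
theorem condEntropy_le_fano {A B : Type*} [Fintype A] [DecidableEq A] [MeasurableSpace B]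
    (J : A → Measure B) [∀ a, IsFiniteMeasure (J a)] [IsProbabilityMeasure (∑ a, J a)] (φ : B → A)
    (hφ : ∀ a, MeasurableSet (φ ⁻¹' {a})) :
    condEntropy J ≤ binEntropyBits (errorProb J φ)
      + errorProb J φ * Real.logb 2 (Fintype.card A) := by
  have hl := Real.log_pos one_lt_two
  -- The conditional error probability given `y`. The pointwise bound is in terms of it, and
  -- concavity of the binary entropy then passes to its mean.
  let err : B → ℝ := fun y => ∑ a, ({y | φ y ≠ a} : Set B).indicator
    (fun y => (posterior J a y).toReal) y
  have hset : ∀ a, MeasurableSet {y | φ y ≠ a} := fun a => (hφ a).compl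
  have hpm : ∀ a, Measurable fun y => (posterior J a y).toReal := fun a =>
    (measurable_posterior J a).ennreal_toReal
  have hem : Measurable err := Finset.measurable_sum _ fun a _ => (hpm a).indicator (hset a)
  have heq : ∀ᵐ y ∂(∑ a, J a), err y = 1 - (posterior J (φ y) y).toReal := by
    filter_upwards [ae_sum_posterior_toReal J] with y hy
    have e1 : err y = ∑ a ∈ Finset.univ.erase (φ y), (posterior J a y).toReal := by
      simp only [err]
      rw [← Finset.sum_erase_add _ _ (Finset.mem_univ (φ y)), Set.indicator_of_notMem (by simp),
        add_zero]
      refine Finset.sum_congr rfl fun a ha => Set.indicator_of_mem ?_ _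
      exact (Finset.ne_of_mem_erase ha).symm
    rw [e1, ← hy, ← Finset.sum_erase_add _ _ (Finset.mem_univ (φ y))]
    ring
  have hmem : ∀ᵐ y ∂(∑ a, J a), err y ∈ Set.Icc (0 : ℝ) 1 := by
    filter_upwards [heq, ae_posterior_le_one J] with y hy hy'
    have h1 := toReal_le_one_of_le_one (hy' (φ y))
    have h2 : 0 ≤ (posterior J (φ y) y).toReal := ENNReal.toReal_nonneg
    rw [hy]
    constructor <;> linarith
  have hei : Integrable err (∑ a, J a) := by
    refine Integrable.of_bound hem.aestronglyMeasurable 1 ?_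
    filter_upwards [hmem] with y hy
    rw [Real.norm_of_nonneg hy.1]
    exact hy.2
  have hbi : Integrable (fun y => Real.binEntropy (err y)) (∑ a, J a) := by
    refine Integrable.of_bound
      (Real.binEntropy_continuous.measurable.comp hem).aestronglyMeasurable (Real.log 2) ?_
    filter_upwards [hmem] with y hy
    rw [Real.norm_of_nonneg (Real.binEntropy_nonneg hy.1 hy.2)]
    exact Real.binEntropy_le_log_two
  have hint : ∫ y, err y ∂(∑ a, J a) = errorProb J φ := by
    simp only [err]
    rw [integral_finsetSum, errorProb]
    · refine Finset.sum_congr rfl fun a _ => ?_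
      rw [integral_indicator (hset a)]
      exact Measure.setIntegral_toReal_rnDeriv (absolutelyContinuous_sum J a) _
    · exact fun a _ => Measure.integrable_toReal_rnDeriv.indicator (hset a)
  have hjensen : ∫ y, Real.binEntropy (err y) ∂(∑ a, J a) ≤ Real.binEntropy (errorProb J φ) := by
    rw [← hint]
    exact Real.strictConcave_binEntropy.concaveOn.le_map_integral
      Real.binEntropy_continuous.continuousOn isClosed_Icc hmem hei hbi
  have hbound : condEntropy J ≤ ∫ y, (Real.binEntropy (err y)
      + err y * Real.log (Fintype.card A)) / Real.log 2 ∂(∑ a, J a) := by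
    refine integral_mono_of_nonneg ?_ ((hbi.add (hei.mul_const _)).div_const _) ?_
    · filter_upwards [ae_posterior_le_one J] with y hy
      exact Finset.sum_nonneg fun a _ => div_nonneg (Real.negMulLog_nonneg ENNReal.toReal_nonneg
        (toReal_le_one_of_le_one (hy a))) hl.le
    · filter_upwards [heq, ae_sum_posterior_toReal J] with y hy hy'
      rw [← Finset.sum_div, hy]
      exact div_le_div_of_nonneg_right
        (sum_negMulLog_le (fun a => ENNReal.toReal_nonneg) hy' (φ y)) hl.le
  have hsplit : ∫ y, (Real.binEntropy (err y) + err y * Real.log (Fintype.card A)) / Real.log 2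
      ∂(∑ a, J a) = (∫ y, Real.binEntropy (err y) ∂(∑ a, J a)
        + errorProb J φ * Real.log (Fintype.card A)) / Real.log 2 := by
    rw [integral_div, integral_add hbi (hei.mul_const _), integral_mul_const, hint]
  rw [hsplit] at hbound
  refine hbound.trans ?_
  rw [binEntropyBits, Real.logb, ← mul_div_assoc, ← add_div]
  exact div_le_div_of_nonneg_right (by linarith) hl.le

/-! ### Symmetry of the channel L-densities. -/

theorem bitProb_log_div {a b : ℝ≥0∞} (h : a + b = 1) : bitProb (ENNReal.log (a / b)) = a := by
  have ha : a ≠ ⊤ := ne_top_of_le_ne_top ENNReal.one_ne_top (h ▸ le_self_add)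
  have hb : b ≠ ⊤ := ne_top_of_le_ne_top ENNReal.one_ne_top (h ▸ le_add_self)
  by_cases h0 : a = 0
  · simp [h0]
  have hx : ENNReal.log (a / b) ≠ ⊥ := by
    rw [ne_eq, ENNReal.log_eq_bot_iff, ENNReal.div_eq_zero_iff]
    tauto
  have hr : a.toReal + b.toReal = 1 := by
    rw [← ENNReal.toReal_add ha hb, h, ENNReal.toReal_one]
  have hpos : 0 < a.toReal := ENNReal.toReal_pos h0 ha
  have hl : lik (ENNReal.log (a / b)) = b.toReal / a.toReal := by
    rw [lik, EReal.exp_neg, ENNReal.exp_log, ENNReal.toReal_inv, ENNReal.toReal_div, inv_div]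
  rw [bitProb, one_add_tanhHalf hx, hl]
  have : 2 / (1 + b.toReal / a.toReal) / 2 = a.toReal := by
    field_simp
    linarith
  rw [this, ENNReal.ofReal_toReal ha]

theorem log_div_swap {a b : ℝ≥0∞} (h : a + b = 1) :
    ENNReal.log (b / a) = -ENNReal.log (a / b) := by
  have ha : a ≠ ⊤ := ne_top_of_le_ne_top ENNReal.one_ne_top (h ▸ le_self_add)
  have hb : b ≠ ⊤ := ne_top_of_le_ne_top ENNReal.one_ne_top (h ▸ le_add_self)
  have h0 : b ≠ 0 ∨ a ≠ 0 := by
    by_contra! h0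
    simp [h0.1, h0.2] at h
  rw [← ENNReal.log_inv, ENNReal.inv_div (.inl hb) h0]

namespace BMSChannel

variable {Y : Type*} [MeasurableSpace Y] (W : BMSChannel Y)

/-- The law of the output for a uniform input. -/
def mix : Measure Y := ∑ b : ZMod 2, (2⁻¹ : ℝ≥0∞) • (W.law b : Measure Y)

/-- The conditional probability of the input `b` given the output, for a uniform input. -/
def post (b : ZMod 2) : Y → ℝ≥0∞ :=
  posterior (fun b : ZMod 2 => (2⁻¹ : ℝ≥0∞) • (W.law b : Measure Y)) b

theorem llr_eq (y : Y) : W.llr y = ENNReal.log (W.post 0 y / W.post 1 y) := rfl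

theorem measurable_post (b : ZMod 2) : Measurable (W.post b) := measurable_posterior _ b

instance (b : ZMod 2) : IsFiniteMeasure ((2⁻¹ : ℝ≥0∞) • (W.law b : Measure Y)) :=
  Measure.smul_finite _ (by simp)

instance : IsProbabilityMeasure W.mix := by
  refine ⟨?_⟩
  rw [mix, Measure.finsetSum_apply, sum_zmod_two]
  simp [ENNReal.inv_two_add_inv_two]

theorem withDensity_post (b : ZMod 2) :
    W.mix.withDensity (W.post b) = (2⁻¹ : ℝ≥0∞) • (W.law b : Measure Y) :=
  withDensity_posterior (fun b : ZMod 2 => (2⁻¹ : ℝ≥0∞) • (W.law b : Measure Y)) b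

theorem law_eq_withDensity (b : ZMod 2) :
    (W.law b : Measure Y) = W.mix.withDensity (fun y => 2 * W.post b y) := by
  have h : (fun y => 2 * W.post b y) = (2 : ℝ≥0∞) • W.post b := rfl
  rw [h, withDensity_smul _ (W.measurable_post b), withDensity_post, smul_smul,
    ENNReal.mul_inv_cancel two_ne_zero ENNReal.ofNat_ne_top, one_smul]

theorem lintegral_law (b : ZMod 2) {f : Y → ℝ≥0∞} (hf : Measurable f) :
    ∫⁻ y, f y ∂(W.law b : Measure Y) = ∫⁻ y, 2 * W.post b y * f y ∂W.mix := by
  rw [law_eq_withDensity, lintegral_withDensity_eq_lintegral_mul _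
    ((W.measurable_post b).const_mul 2) hf]
  rfl

theorem ae_post_add : ∀ᵐ y ∂W.mix, W.post 0 y + W.post 1 y = 1 := by
  have h := ae_sum_posterior fun b : ZMod 2 => (2⁻¹ : ℝ≥0∞) • (W.law b : Measure Y)
  filter_upwards [h] with y hy
  rwa [sum_zmod_two] at hy

theorem law_absolutelyContinuous_mix (b : ZMod 2) : (W.law b : Measure Y) ≪ W.mix := by
  rw [law_eq_withDensity]
  exact withDensity_absolutelyContinuous _ _

theorem ae_law_post_ne_zero (b : ZMod 2) : ∀ᵐ y ∂(W.law b : Measure Y), W.post b y ≠ 0 := by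
  have hm : MeasurableSet {y | W.post b y = 0} := W.measurable_post b (measurableSet_singleton 0)
  have h : (W.law b : Measure Y) {y | W.post b y = 0} = 0 := by
    rw [law_eq_withDensity, withDensity_apply _ hm,
      setLIntegral_congr_fun hm (g := fun _ => 0) fun y (hy : W.post b y = 0) => by
        simp [hy]]
    simp
  exact measure_eq_zero_iff_ae_notMem.1 h

/-- The flip of the output as a measurable equivalence. -/
def flipEquiv : Y ≃ᵐ Y where
  toFun := W.flip
  invFun := W.flip
  left_inv := W.flip_flip
  right_inv := W.flip_flip
  measurable_toFun := W.measurable_flip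
  measurable_invFun := W.measurable_flip

theorem map_flip_law (b : ZMod 2) :
    (W.law b : Measure Y).map W.flip = (W.law (b + 1) : Measure Y) := by
  have h1 : (1 : ZMod 2) + 1 = 0 := by decide
  by_cases hb : b = 0
  · rw [hb, zero_add, W.law_one]
  · rw [zmod_two_ne_zero_iff.1 hb, h1, W.law_one,
      Measure.map_map W.measurable_flip W.measurable_flip]
    have : W.flip ∘ W.flip = id := funext W.flip_flip
    rw [this, Measure.map_id]

theorem map_flip_mix : W.mix.map W.flip = W.mix := by
  have h1 : (1 : ZMod 2) + 1 = 0 := by decide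
  rw [mix, sum_zmod_two, Measure.map_add _ _ W.measurable_flip, Measure.map_smul,
    Measure.map_smul, map_flip_law, map_flip_law, zero_add, h1, add_comm]

theorem lintegral_flip_mix {f : Y → ℝ≥0∞} (hf : Measurable f) :
    ∫⁻ y, f (W.flip y) ∂W.mix = ∫⁻ y, f y ∂W.mix := by
  rw [← lintegral_map hf W.measurable_flip, map_flip_mix]

/-- The flip exchanges the two output laws and preserves their mixture, so it carries one
Radon–Nikodym derivative to the other. -/
theorem ae_post_flip (b : ZMod 2) : ∀ᵐ y ∂W.mix, W.post (b + 1) (W.flip y) = W.post b y := by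
  have h := W.flipEquiv.measurableEmbedding.rnDeriv_map
    ((2⁻¹ : ℝ≥0∞) • (W.law b : Measure Y)) W.mix
  have e : ⇑W.flipEquiv = W.flip := rfl
  rw [e, Measure.map_smul, map_flip_law, map_flip_mix] at h
  exact h

/-- Over the mixture, the sign-reversed term has weight `2 * post 0 * post 1`, which the flip
preserves while negating the log-likelihood ratio. After the flip the two terms recombine through
`post 0 + post 1 = 1`. -/
theorem isSym_density : IsSym W.density := by
  intro f hf
  have hc : (W.density : Measure EReal) = (W.law 0 : Measure Y).map W.llr := rfl
  have hp := measurable_bitProb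
  have hllr := W.measurable_llr
  have hg : Measurable fun z => bitProb z * f z + bitProb (-z) * f (-z) :=
    (hp.mul hf).add ((hp.comp measurable_neg).mul (hf.comp measurable_neg))
  have hf' : Measurable fun y => f (W.llr y) := hf.comp hllr
  have hg' : Measurable fun y => bitProb (W.llr y) * f (W.llr y)
      + bitProb (-W.llr y) * f (-W.llr y) := hg.comp hllr
  rw [hc, lintegral_map hf hllr, lintegral_map hg hllr, W.lintegral_law 0 hf',
    W.lintegral_law 0 hg']
  have m0 := W.measurable_post 0
  have m1 := W.measurable_post 1
  have hm1 : Measurable fun y => 2 * W.post 0 y * (W.post 0 y * f (W.llr y)) :=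
    (m0.const_mul 2).mul (m0.mul (hf.comp hllr))
  have hm2 : Measurable fun y => 2 * W.post 0 y * (W.post 1 y * f (-W.llr y)) :=
    (m0.const_mul 2).mul (m1.mul (hf.comp hllr.neg))
  have h10 : (1 : ZMod 2) + 1 = 0 := by decide
  have e1 : ∫⁻ y, 2 * W.post 0 y * (bitProb (W.llr y) * f (W.llr y)
        + bitProb (-W.llr y) * f (-W.llr y)) ∂W.mix
      = ∫⁻ y, 2 * W.post 0 y * (W.post 0 y * f (W.llr y)) ∂W.mix
        + ∫⁻ y, 2 * W.post 0 y * (W.post 1 y * f (-W.llr y)) ∂W.mix := by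
    rw [← lintegral_add_left hm1]
    refine lintegral_congr_ae ?_
    filter_upwards [W.ae_post_add] with y hy
    rw [llr_eq, bitProb_log_div hy, ← log_div_swap hy,
      bitProb_log_div ((add_comm _ _).trans hy)]
    ring
  have e2 : ∫⁻ y, 2 * W.post 0 y * (W.post 1 y * f (-W.llr y)) ∂W.mix
      = ∫⁻ y, 2 * W.post 0 y * (W.post 1 y * f (W.llr y)) ∂W.mix := by
    rw [← W.lintegral_flip_mix hm2]
    refine lintegral_congr_ae ?_
    filter_upwards [W.ae_post_add, W.ae_post_flip 0, W.ae_post_flip 1] with y hy h0 h1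
    rw [zero_add] at h0
    rw [h10] at h1
    rw [llr_eq, llr_eq, h0, h1, log_div_swap hy, neg_neg]
    ring
  refine Eq.trans ?_ e1.symm
  rw [e2, ← lintegral_add_left hm1]
  refine lintegral_congr_ae ?_
  filter_upwards [W.ae_post_add] with y hy
  rw [← mul_add, ← add_mul, hy, one_mul]

end BMSChannel

/-- On a box the indicator also factors over coordinates, and independence turns the integral of the
product into the product of the integrals. -/
theorem pi_withDensity {ι : Type*} [Fintype ι] {X : ι → Type*} [∀ i, MeasurableSpace (X i)]
    (μ : ∀ i, Measure (X i)) [∀ i, IsProbabilityMeasure (μ i)] {f : ∀ i, X i → ℝ≥0∞}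
    (hf : ∀ i, Measurable (f i)) [∀ i, SigmaFinite ((μ i).withDensity (f i))] :
    Measure.pi (fun i => (μ i).withDensity (f i))
      = (Measure.pi μ).withDensity fun x => ∏ i, f i (x i) := by
  refine Measure.pi_eq fun s hs => ?_
  rw [withDensity_apply _ (MeasurableSet.univ_pi hs),
    ← lintegral_indicator (MeasurableSet.univ_pi hs)]
  have hm : ∀ i, Measurable ((s i).indicator (f i)) := fun i => (hf i).indicator (hs i)
  have e : ∀ x : ∀ i, X i, (Set.univ.pi s).indicator (fun x => ∏ i, f i (x i)) x
      = ∏ i, (s i).indicator (f i) (x i) := by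
    intro x
    by_cases hx : x ∈ Set.univ.pi s
    · rw [Set.indicator_of_mem hx]
      exact Finset.prod_congr rfl fun i _ => (Set.indicator_of_mem (hx i (Set.mem_univ i)) _).symm
    · rw [Set.indicator_of_notMem hx]
      simp only [Set.mem_pi, Set.mem_univ, true_implies, not_forall] at hx
      obtain ⟨i, hi⟩ := hx
      exact (Finset.prod_eq_zero (Finset.mem_univ i) (Set.indicator_of_notMem hi _)).symm
  have hind := ProbabilityTheory.iIndepFun_pi (μ := μ) fun i => (hm i).aemeasurable
  simp only [e]
  rw [ProbabilityTheory.lintegral_prod_eq_prod_lintegral_of_indepFun Finset.univ _ hind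
    fun i => (hm i).comp (measurable_pi_apply i)]
  refine Finset.prod_congr rfl fun i _ => ?_
  rw [withDensity_apply _ (hs i), ← lintegral_indicator (hs i),
    ← (measurePreserving_eval μ i).lintegral_comp (hm i)]

namespace BMSChannel

variable {Y : Type*} [MeasurableSpace Y] (W : BMSChannel Y)

/-- Flip the output if the bit `b` is `1`. -/
def shift (b : ZMod 2) : Y ≃ᵐ Y := if b = 0 then MeasurableEquiv.refl Y else W.flipEquiv

theorem map_shift_law (a b : ZMod 2) :
    (W.law b : Measure Y).map (W.shift a) = (W.law (b + a) : Measure Y) := by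
  unfold shift
  split_ifs with ha
  · rw [ha, add_zero]
    exact Measure.map_id
  · rw [zmod_two_ne_zero_iff.1 ha]
    exact W.map_flip_law b

theorem llr_ne_bot_and_post : ∀ᵐ y ∂(W.law 0 : Measure Y), W.post 0 y ≠ 0 ∧
    W.post 0 y + W.post 1 y = 1 :=
  (W.ae_law_post_ne_zero 0).and ((W.law_absolutelyContinuous_mix 0).ae_le W.ae_post_add)

theorem bitWeight_llr {y : Y} (h : W.post 0 y ≠ 0 ∧ W.post 0 y + W.post 1 y = 1) (b : ZMod 2) :
    bitWeight (W.llr y) b = (W.post b y / W.post 0 y).toReal := by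
  have ha : W.post 0 y ≠ ⊤ := ne_top_of_le_ne_top ENNReal.one_ne_top (h.2 ▸ le_self_add)
  by_cases hb : b = 0
  · rw [hb, bitWeight_zero, ENNReal.div_self h.1 ha, ENNReal.toReal_one]
  · rw [zmod_two_ne_zero_iff.1 hb, bitWeight_one, lik, llr_eq, ← log_div_swap h.2,
      ENNReal.exp_log]

end BMSChannel

/-! ### Reduction of the conditional entropy to the zero codeword. -/

namespace FactorGraph

variable {V C : Type*} [Fintype V] [DecidableEq V] [Fintype C] [DecidableEq C]
  {Y : V → Type*} [∀ i, MeasurableSpace (Y i)] {G : FactorGraph V C} (W : ∀ i, BMSChannel (Y i))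

/-- The law of the output when the word `x` is sent. -/
def outputLaw (W : ∀ i, BMSChannel (Y i)) (x : V → ZMod 2) : Measure (∀ i, Y i) :=
  Measure.pi fun i => ((W i).law (x i) : Measure (Y i))

instance (x : V → ZMod 2) : IsProbabilityMeasure (outputLaw W x) := by
  unfold outputLaw; infer_instance

theorem jointLaw_of_mem {x : V → ZMod 2} (hx : x ∈ G.code) :
    G.jointLaw W x = (G.code.card : ℝ≥0∞)⁻¹ • outputLaw W x := if_pos hx

theorem jointLaw_of_notMem {x : V → ZMod 2} (hx : x ∉ G.code) : G.jointLaw W x = 0 := if_neg hx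

theorem card_code_ne_zero : (G.code.card : ℝ≥0∞) ≠ 0 := by
  simpa using Finset.ne_empty_of_mem zero_mem_code

instance (x : V → ZMod 2) : IsFiniteMeasure (G.jointLaw W x) := by
  by_cases hx : x ∈ G.code
  · rw [jointLaw_of_mem W hx]
    exact Measure.smul_finite _ (ENNReal.inv_ne_top.2 card_code_ne_zero)
  · rw [jointLaw_of_notMem W hx]
    infer_instance

instance : IsProbabilityMeasure (∑ x, G.jointLaw W x) := by
  refine ⟨?_⟩
  rw [Measure.finsetSum_apply, ← Finset.sum_subset (Finset.subset_univ G.code) fun x _ hx => by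
    rw [jointLaw_of_notMem W hx]; rfl]
  rw [Finset.sum_congr rfl fun x hx => by rw [jointLaw_of_mem W hx]]
  simp [ENNReal.mul_inv_cancel card_code_ne_zero (ENNReal.natCast_ne_top _)]

theorem add_mem_code_iff {a : V → ZMod 2} (ha : a ∈ G.code) {x : V → ZMod 2} :
    x + a ∈ G.code ↔ x ∈ G.code := by
  simp only [mem_code] at *
  refine forall_congr' fun α => ?_
  simp [Finset.sum_add_distrib, ha α]

/-- Flip the outputs at the positions where the word `a` is `1`. -/
def shift (a : V → ZMod 2) : (∀ i, Y i) ≃ᵐ (∀ i, Y i) :=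
  MeasurableEquiv.piCongrRight fun i => (W i).shift (a i)

theorem map_shift_outputLaw (a x : V → ZMod 2) :
    (outputLaw W x).map (shift W a) = outputLaw W (x + a) := by
  have h1 : ∀ i, ((W i).law (x i) : Measure (Y i)).map ((W i).shift (a i))
      = ((W i).law ((x + a) i) : Measure (Y i)) := fun i => (W i).map_shift_law (a i) (x i)
  have h2 : ∀ i, SigmaFinite (((W i).law (x i) : Measure (Y i)).map ((W i).shift (a i))) :=
    fun i => by rw [h1]; infer_instance
  have h := Measure.pi_map_pi (μ := fun i => ((W i).law (x i) : Measure (Y i)))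
    (f := fun i => (W i).shift (a i)) fun i => ((W i).shift (a i)).measurable.aemeasurable
  simp only [h1] at h
  exact h

theorem map_shift_jointLaw {a : V → ZMod 2} (ha : a ∈ G.code) (x : V → ZMod 2) :
    (G.jointLaw W x).map (shift W a) = G.jointLaw W (x + a) := by
  by_cases hx : x ∈ G.code
  · rw [jointLaw_of_mem W hx, jointLaw_of_mem W ((add_mem_code_iff ha).2 hx), Measure.map_smul,
      map_shift_outputLaw]
  · rw [jointLaw_of_notMem W hx, jointLaw_of_notMem W (mt (add_mem_code_iff ha).1 hx),
      Measure.map_zero]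

theorem map_shift_sum_jointLaw {a : V → ZMod 2} (ha : a ∈ G.code) :
    (∑ x, G.jointLaw W x).map (shift W a) = ∑ x, G.jointLaw W x := by
  rw [Measure.map_finset_sum' (shift W a).measurable.aemeasurable]
  simp only [map_shift_jointLaw W ha]
  exact Fintype.sum_equiv (Equiv.addRight a) _ _ fun x => rfl

/-- Flipping outputs along a codeword `a` permutes the joint laws and fixes their sum, so it carries
the posterior of `0` to that of `a`. -/
theorem lintegral_posterior_eq {a : V → ZMod 2} (ha : a ∈ G.code) (φ : ℝ≥0∞ → ℝ≥0∞) :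
    ∫⁻ y, φ (posterior (G.jointLaw W) a y) ∂(G.jointLaw W a)
      = ∫⁻ y, φ (posterior (G.jointLaw W) 0 y) ∂(G.jointLaw W 0) := by
  have h := (shift W a).measurableEmbedding.rnDeriv_map (G.jointLaw W 0) (∑ x, G.jointLaw W x)
  rw [map_shift_jointLaw W ha, map_shift_sum_jointLaw W ha, zero_add] at h
  have h' : ∀ᵐ y ∂(G.jointLaw W 0), posterior (G.jointLaw W) a (shift W a y)
      = posterior (G.jointLaw W) 0 y := (absolutelyContinuous_sum (G.jointLaw W) 0).ae_le h
  have e := map_shift_jointLaw W ha 0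
  rw [zero_add] at e
  conv_lhs => rw [← e]
  rw [lintegral_map_equiv]
  refine lintegral_congr_ae ?_
  filter_upwards [h'] with y hy
  rw [hy]

theorem condEntropy_jointLaw_eq : condEntropy (G.jointLaw W)
    = (∫⁻ y, ENNReal.ofReal (-Real.logb 2 (posterior (G.jointLaw W) 0 y).toReal)
      ∂(outputLaw W 0)).toReal := by
  rw [condEntropy_eq_toReal, ← Finset.sum_subset (Finset.subset_univ G.code) fun x _ hx => by
    rw [jointLaw_of_notMem W hx, lintegral_zero_measure]]
  rw [Finset.sum_congr rfl fun x hx => lintegral_posterior_eq W hx fun p => ENNReal.ofReal (-Real.logb 2 p.toReal), Finset.sum_const,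
    nsmul_eq_mul, jointLaw_of_mem W zero_mem_code, lintegral_smul_measure, smul_eq_mul,
    ← mul_assoc, ENNReal.mul_inv_cancel card_code_ne_zero (ENNReal.natCast_ne_top _), one_mul]

/-- The density of the output law of the word `x`. -/
def outputDensity (x : V → ZMod 2) (y : ∀ i, Y i) : ℝ≥0∞ := ∏ i, (2 * (W i).post (x i) (y i))

theorem measurable_outputDensity (x : V → ZMod 2) : Measurable (outputDensity W x) :=
  Finset.measurable_prod _ fun i _ =>
    (((W i).measurable_post (x i)).const_mul 2).comp (measurable_pi_apply i)

/-- The density of the joint law at the word `x`. -/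
def jointDensity (G : FactorGraph V C) (W : ∀ i, BMSChannel (Y i)) (x : V → ZMod 2)
    (y : ∀ i, Y i) : ℝ≥0∞ :=
  if x ∈ G.code then (G.code.card : ℝ≥0∞)⁻¹ * outputDensity W x y else 0

theorem measurable_jointDensity (x : V → ZMod 2) : Measurable (G.jointDensity W x) := by
  unfold jointDensity
  split_ifs
  exacts [(measurable_outputDensity W x).const_mul _, measurable_const]

theorem outputLaw_eq_withDensity (x : V → ZMod 2) : outputLaw W x
    = (Measure.pi fun i => (W i).mix).withDensity (outputDensity W x) := by
  have h : ∀ i, SigmaFinite ((W i).mix.withDensity fun y => 2 * (W i).post (x i) y) := fun i => by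
    rw [← BMSChannel.law_eq_withDensity]; infer_instance
  unfold outputLaw
  simp only [BMSChannel.law_eq_withDensity]
  exact pi_withDensity (fun i => (W i).mix) fun i => ((W i).measurable_post (x i)).const_mul 2

theorem jointLaw_eq_withDensity (x : V → ZMod 2) : G.jointLaw W x
    = (Measure.pi fun i => (W i).mix).withDensity (G.jointDensity W x) := by
  unfold jointDensity
  by_cases hx : x ∈ G.code
  · simp only [if_pos hx]
    rw [jointLaw_of_mem W hx, outputLaw_eq_withDensity,
      ← withDensity_smul _ (measurable_outputDensity W x)]
    rfl
  · simp only [if_neg hx]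
    rw [jointLaw_of_notMem W hx]
    exact withDensity_zero.symm

theorem sum_jointLaw_eq_withDensity : ∑ x, G.jointLaw W x
    = (Measure.pi fun i => (W i).mix).withDensity (fun y => ∑ x, G.jointDensity W x y) := by
  ext s hs
  rw [Measure.finsetSum_apply, withDensity_apply _ hs, lintegral_finsetSum _
    fun x _ => measurable_jointDensity W x]
  refine Finset.sum_congr rfl fun x _ => ?_
  rw [jointLaw_eq_withDensity, withDensity_apply _ hs]

theorem outputDensity_ne_top {y : ∀ i, Y i} (hy : ∀ i, (W i).post 0 (y i) ≠ 0 ∧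
    (W i).post 0 (y i) + (W i).post 1 (y i) = 1) (x : V → ZMod 2) :
    outputDensity W x y ≠ ⊤ := by
  refine ENNReal.prod_ne_top fun i _ => ENNReal.mul_ne_top ENNReal.ofNat_ne_top ?_
  refine ne_top_of_le_ne_top ENNReal.one_ne_top ?_
  rw [← (hy i).2]
  by_cases hx : x i = 0
  · rw [hx]; exact le_self_add
  · rw [zmod_two_ne_zero_iff.1 hx]; exact le_add_self

theorem ae_outputLaw_zero : ∀ᵐ y ∂(outputLaw W 0), ∀ i, (W i).post 0 (y i) ≠ 0 ∧
    (W i).post 0 (y i) + (W i).post 1 (y i) = 1 := by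
  refine ae_all_iff.2 fun i => ?_
  exact (measurePreserving_eval (fun i => ((W i).law 0 : Measure (Y i))) i).quasiMeasurePreserving.ae
    (W i).llr_ne_bot_and_post

theorem outputDensity_zero_ne_zero {y : ∀ i, Y i} (hy : ∀ i, (W i).post 0 (y i) ≠ 0 ∧
    (W i).post 0 (y i) + (W i).post 1 (y i) = 1) : outputDensity W 0 y ≠ 0 :=
  Finset.prod_ne_zero_iff.2 fun i _ => mul_ne_zero two_ne_zero (hy i).1

/-- Relative to the zero word, the density of a codeword is the product of its `bitWeight`s; the
uniform prior contributes the same factor to every codeword. -/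
theorem sum_jointDensity_toReal {y : ∀ i, Y i} (hy : ∀ i, (W i).post 0 (y i) ≠ 0 ∧
    (W i).post 0 (y i) + (W i).post 1 (y i) = 1) :
    (∑ x, G.jointDensity W x y).toReal
      = (G.jointDensity W 0 y).toReal * G.partition fun i => (W i).llr (y i) := by
  have hne : ∀ x, G.jointDensity W x y ≠ ⊤ := by
    intro x
    unfold jointDensity
    split_ifs
    · exact ENNReal.mul_ne_top (ENNReal.inv_ne_top.2 card_code_ne_zero) (outputDensity_ne_top W hy x)
    · exact ENNReal.zero_ne_top
  rw [ENNReal.toReal_sum fun x _ => hne x, partition, Finset.mul_sum,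
    ← Finset.sum_subset (Finset.subset_univ G.code) fun x _ hx => by
      rw [jointDensity, if_neg hx, ENNReal.toReal_zero]]
  refine Finset.sum_congr rfl fun x hx => ?_
  rw [jointDensity, jointDensity, if_pos hx, if_pos zero_mem_code, ENNReal.toReal_mul,
    ENNReal.toReal_mul, mul_assoc, outputDensity, outputDensity, ENNReal.toReal_prod,
    ENNReal.toReal_prod, ← Finset.prod_mul_distrib]
  congr 1
  refine Finset.prod_congr rfl fun i _ => ?_
  have h0 : ((W i).post 0 (y i)).toReal ≠ 0 :=
    (ENNReal.toReal_pos (hy i).1 (ne_top_of_le_ne_top ENNReal.one_ne_top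
      ((hy i).2 ▸ le_self_add))).ne'
  rw [(W i).bitWeight_llr (hy i), ENNReal.toReal_mul, ENNReal.toReal_mul, ENNReal.toReal_div,
    Pi.zero_apply]
  field_simp

theorem ae_posterior_jointLaw_zero : ∀ᵐ y ∂(outputLaw W 0),
    -Real.logb 2 (posterior (G.jointLaw W) 0 y).toReal
      = Real.logb 2 (G.partition fun i => (W i).llr (y i)) := by
  set ξ : Measure (∀ i, Y i) := Measure.pi fun i => (W i).mix with hξ
  have hD : Measurable fun y => ∑ x, G.jointDensity W x y :=
    Finset.measurable_sum _ fun x _ => measurable_jointDensity W x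
  have h1 : G.jointLaw W 0 ≪ ξ := by
    rw [jointLaw_eq_withDensity]; exact withDensity_absolutelyContinuous _ _
  have h2 : ∑ x, G.jointLaw W x ≪ ξ := by
    rw [sum_jointLaw_eq_withDensity]; exact withDensity_absolutelyContinuous _ _
  have h3 : outputLaw W 0 ≪ G.jointLaw W 0 := by
    rw [jointLaw_of_mem W zero_mem_code]
    exact Measure.absolutelyContinuous_smul (ENNReal.inv_ne_zero.2 (ENNReal.natCast_ne_top _))
  have h4 : G.jointLaw W 0 ≪ ∑ x, G.jointLaw W x := absolutelyContinuous_sum (G.jointLaw W) 0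
  -- Bayes' rule: the posterior is a quotient of densities with respect to `ξ`, which here is the
  -- reciprocal of the partition function.
  have r := Measure.rnDeriv_eq_div h1 h2
  have r1 : (G.jointLaw W 0).rnDeriv ξ =ᵐ[ξ] G.jointDensity W 0 := by
    rw [jointLaw_eq_withDensity]
    exact Measure.rnDeriv_withDensity ξ (measurable_jointDensity W 0)
  have r2 : (∑ x, G.jointLaw W x).rnDeriv ξ =ᵐ[ξ] fun y => ∑ x, G.jointDensity W x y := by
    rw [sum_jointLaw_eq_withDensity]
    exact Measure.rnDeriv_withDensity ξ hD
  filter_upwards [(h3.trans h4).ae_le r, (h3.trans h1).ae_le r1, (h3.trans h1).ae_le r2,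
    ae_outputLaw_zero W] with y e e1 e2 hy
  have hd : (G.jointDensity W 0 y).toReal ≠ 0 := by
    rw [jointDensity, if_pos zero_mem_code]
    refine (ENNReal.toReal_pos (mul_ne_zero (ENNReal.inv_ne_zero.2 (ENNReal.natCast_ne_top _))
      (outputDensity_zero_ne_zero W hy)) (ENNReal.mul_ne_top
      (ENNReal.inv_ne_top.2 card_code_ne_zero) (outputDensity_ne_top W hy 0))).ne'
  rw [posterior, e, e1, e2, ENNReal.toReal_div, sum_jointDensity_toReal W hy, div_mul_eq_div_div,
    div_self hd, one_div, Real.logb_inv, neg_neg]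

theorem productLaw_density : productLaw (fun i => (W i).density)
    = (outputLaw W 0).map fun y i => (W i).llr (y i) := by
  have h : ∀ i, IsProbabilityMeasure (((W i).law ((0 : V → ZMod 2) i) : Measure (Y i)).map
      (W i).llr) := fun i => Measure.isProbabilityMeasure_map (W i).measurable_llr.aemeasurable
  exact (Measure.pi_map_pi fun i => (W i).measurable_llr.aemeasurable).symm

/-- The conditional entropy of the codeword given the output is the expected logarithm of the
partition function. -/
theorem condEntropy_jointLaw_eq_logPartition :
    condEntropy (G.jointLaw W) = (G.logPartition fun i => (W i).density).toReal := by
  have hm : Measurable fun (y : ∀ i, Y i) i => (W i).llr (y i) :=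
    measurable_pi_lambda _ fun i => (W i).measurable_llr.comp (measurable_pi_apply i)
  rw [condEntropy_jointLaw_eq, logPartition, productLaw_density,
    lintegral_map (measurable_logPartition G) hm]
  congr 1
  refine lintegral_congr_ae ?_
  filter_upwards [ae_posterior_jointLaw_zero (G := G) W] with y hy
  rw [hy]

end FactorGraph

end GapLowerLimit

end

open GapLowerLimit in
theorem mainTheorem5 {V C : Type*} [Fintype V] [DecidableEq V] [Nonempty V]
    [Fintype C] [DecidableEq C] {Y : V → Type*} [∀ i, MeasurableSpace (Y i)]
    (G : FactorGraph V C) (hG : G.IsCycleFree) (W : ∀ i, BMSChannel (Y i))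
    (S : List G.DirectedEdge) (t : ℕ) (ht : t ≤ S.length)
    (decoder : (∀ i, Y i) → (V → ZMod 2))
    (hdecoder : ∀ x, MeasurableSet (decoder ⁻¹' {x})) :
    G.gap (fun i => (W i).density) S t
        ≥ -(1 / (Fintype.card V : ℝ)) * condEntropy (G.jointLaw W) ∧
      -(1 / (Fintype.card V : ℝ)) * condEntropy (G.jointLaw W)
        ≥ -errorProb (G.jointLaw W) decoder
          - binEntropyBits (errorProb (G.jointLaw W) decoder) / (Fintype.card V : ℝ) := by
  have hN : (0 : ℝ) < Fintype.card V := by exact_mod_cast Fintype.card_pos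
  constructor
  · obtain ⟨-, h⟩ := hG.bethe_le_logPartition
      (FactorGraph.IsImproving.messages (G := G) (fun i => (W i).isSym_density) S t)
    rw [FactorGraph.condEntropy_jointLaw_eq_logPartition, FactorGraph.gap,
      FactorGraph.potential_eq]
    exact mul_le_mul_of_nonpos_left h (neg_nonpos.2 (by positivity))
  · have h := condEntropy_le_fano (G.jointLaw W) decoder hdecoder
    -- Fano is applied with all binary words as alphabet, not only codewords, so its logarithm is
    -- exactly `N` and cancels on division.
    have hc : Real.logb 2 (Fintype.card (V → ZMod 2) : ℝ) = Fintype.card V := by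
      rw [Fintype.card_fun, ZMod.card, Nat.cast_pow, Nat.cast_ofNat, Real.logb_pow,
        Real.logb_self_eq_one one_lt_two, mul_one]
    rw [hc] at h
    have h' := div_le_div_of_nonneg_right h hN.le
    rw [add_div, mul_div_cancel_right₀ _ hN.ne'] at h'
    rw [neg_mul, one_div_mul_eq_div]
    linarith
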